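/- Let $d\ge 1$ and let $\Omega\subset\mathbb R^d$ be a bounded polytopal domain: $\Omega$ is bounded, open, connected, equals the interior of $\overline\Omega$, $\overline\Omega$ is a finite union of nondegenerate $d$-simplices, and every point of $\partial\Omega$ has arbitrarily small neighbourhoods $V$ with $\Omega\cap V$ connected (as is the case for every Lipschitz polytopal domain). Let $\gamma\subset\partial\Omega$, $s\in[0,1]$, and let $H^1_{0,\gamma}(\Omega)$ be the closure in $H^1(\Omega)$ of the restrictions to $\Omega$ of the functions in $C^\infty(\mathbb R^d)$ that vanish on $\gamma$. Set \[ \mathscr V:=[L_2(\Omega),H^1_{0,\gamma}(\Omega)]_{s,2},\qquad \mathscr W:=\mathscr V', \] where for $0<s<1$ the norm of $\mathscr V$ is $\big(\int_0^\infty (t^{-s}K(t,u))^2\,\frac{dt}{t}\big)^{1/2}$ with Peetre's functional $K(t,u)=\inf\{\|u-v\|_{L_2(\Omega)}+t\|v\|_{H^1(\Omega)}: v\in H^1_{0,\gamma}(\Omega)\}$, and where $\mathscr V=L_2(\Omega)$ for $s=0$ and $\mathscr V=H^1_{0,\gamma}(\Omega)$ for $s=1$. Via $w\mapsto\langle\cdot,w\rangle_{L_2(\Omega)}$,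 $L_2(\Omega)$ is embedded in $\mathscr W$. Let $\mathbb T$ be a family of conforming partitions $\mathcal T$ of $\overline\Omega$ into closed $d$-simplices that is uniformly shape regular (for some $\kappa$, each $T\in\mathcal T\in\mathbb T$ contains a ball of radius $r_T>0$ with $\operatorname{diam}T\le\kappa r_T$) and such that $\gamma$ is, for each $\mathcal T\in\mathbb T$, a (possibly empty) union of $(d-1)$-faces of simplices of $\mathcal T$. If $d=1$, assume moreover that $|T|\le K|T'|$ for all $T,T'\in\mathcal T\in\mathbb T$ with $T\cap T'\neq\emptyset$, with $K$ independent of $\mathcal T$. Let $N^0_{\mathcal T}$ be the set of vertices of $\mathcal T$ not on $\gamma$, $\omega_\nu:=\bigcup\{T\in\mathcal T:\nu \text{ is a vertex of } T\}$, let $\mathscr V_{\mathcal T}\subset H^1_{0,\gamma}(\Omega)$ be the space of continuous functions that are affine on each $T\in\mathcal T$ and zero on $\gamma$, and let $\Phi_{\mathcal T}=\{\phi_\nu:\nu\in N^0_{\mathcal T}\}$ be its nodal basis, i.e. $\phi_\nu(\nu)=1$ and $\phi_\nu(\nu')=0$ for all other vertices $\nu'$ of $\mathcal T$. For each $\mathcal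 T\in\mathbb T$ let $\Psi_{\mathcal T}=\{\psi_\nu:\nu\in N^0_{\mathcal T}\}\subset L_2(\Omega)\setminus\{0\}$ be such that, with constants $0<c\le C$ independent of $\mathcal T$, \[ c\,\delta_{\nu\nu'}\|\phi_\nu\|_{L_2(\Omega)}\|\psi_{\nu'}\|_{L_2(\Omega)}\le|\langle\phi_\nu,\psi_{\nu'}\rangle_{L_2(\Omega)}|\le C\,\delta_{\nu\nu'}\|\phi_\nu\|_{L_2(\Omega)}\|\psi_{\nu'}\|_{L_2(\Omega)},\qquad \operatorname{supp}\psi_\nu\subseteq\omega_\nu\qquad(\nu,\nu'\in N^0_{\mathcal T}), \] and define \[ P_{\mathcal T}\colon\mathscr W\to\mathscr W,\quad P_{\mathcal T}f=\sum_{\nu\in N^0_{\mathcal T}}\frac{f(\phi_\nu)}{\langle\phi_\nu,\psi_\nu\rangle_{L_2(\Omega)}}\psi_\nu,\qquad P'_{\mathcal T}\colon\mathscr V\to\mathscr V,\quad P'_{\mathcal T}u=\sum_{\nu\in N^0_{\mathcal T}}\frac{\langle u,\psi_\nu\rangle_{L_2(\Omega)}}{\langle\phi_\nu,\psi_\nu\rangle_{L_2(\Omega)}}\phi_\nu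 . \] Then the nodal basis functions $\phi_\nu$ exist in $H^1_{0,\gamma}(\Omega)$; $P_{\mathcal T}$ is a projector with range $\operatorname{span}\Psi_{\mathcal T}$, and the range of $\mathrm{Id}-P_{\mathcal T}$ is $\{f\in\mathscr W: f(v)=0\ \text{for all } v\in\mathscr V_{\mathcal T}\}$; $P'_{\mathcal T}$ is its adjoint, $(P_{\mathcal T}f)(v)=f(P'_{\mathcal T}v)$ for $f\in\mathscr W$, $v\in\mathscr V$; and \[ \sup_{\mathcal T\in\mathbb T}\|P_{\mathcal T}\|_{\mathcal L(\mathscr W,\mathscr W)}=\sup_{\mathcal T\in\mathbb T}\|P'_{\mathcal T}\|_{\mathcal L(\mathscr V,\mathscr V)}<\infty . \] -/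

import Mathlib

open MeasureTheory Set Topology
open scoped ENNReal NNReal ContDiff

noncomputable section

namespace BiorthFE

/-! ### Real interpolation (K-method, second index two) -/

section Interpolation

variable {X Y : Type*} [NormedAddCommGroup X] [NormedSpace ℝ X]
  [NormedAddCommGroup Y] [NormedSpace ℝ Y]

/-- Peetre's K-functional `K(t, x) = inf { ‖x₀‖ + t ‖y‖ : x = x₀ + j y }`
of the couple `j : Y → X`. -/
def kFun (j : Y →L[ℝ] X) (t : ℝ) (x : X) : ℝ≥0∞ :=
  ⨅ y : Y, ‖x - j y‖ₑ + ENNReal.ofReal t * ‖y‖ₑ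

/-- The measure `dt / t` on `(0, ∞)`. -/
def dtOverT : Measure ℝ :=
  (volume.restrict (Ioi (0 : ℝ))).withDensity fun t => ENNReal.ofReal t⁻¹

/-- The norm of `[X, Y]_{s,2}` with values in `[0, ∞]`. For `0 < s < 1` it is
`(∫₀^∞ (t^{-s} K(t, x))² dt/t)^{1/2}`; for `s = 0` it is the norm of `X`, and for `s = 1` the
norm of `Y` (it is `∞` outside `Y`). -/
def interpENorm (j : Y →L[ℝ] X) (s : ℝ) (x : X) : ℝ≥0∞ :=
  open Classical in
  if s = 0 then ‖x‖ₑ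
  else if s = 1 then ⨅ (y : Y) (_ : j y = x), ‖y‖ₑ
  else (∫⁻ t, (ENNReal.ofReal (t ^ (-s)) * kFun j t x) ^ (2 : ℝ) ∂dtOverT) ^ (1 / (2 : ℝ))

lemma kFun_zero (j : Y →L[ℝ] X) (t : ℝ) : kFun j t 0 = 0 := by
  refine le_antisymm ((iInf_le _ (0 : Y)).trans ?_) bot_le
  simp

lemma kFun_add (j : Y →L[ℝ] X) (t : ℝ) (x x' : X) :
    kFun j t (x + x') ≤ kFun j t x + kFun j t x' := by
  unfold kFun
  refine ENNReal.le_iInf_add_iInf fun y y' => (iInf_le _ (y + y')).trans ?_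
  have h1 : ‖x + x' - j (y + y')‖ₑ ≤ ‖x - j y‖ₑ + ‖x' - j y'‖ₑ := by
    have : x + x' - j (y + y') = (x - j y) + (x' - j y') := by rw [map_add]; abel
    rw [this]; exact enorm_add_le _ _
  calc _ ≤ (‖x - j y‖ₑ + ‖x' - j y'‖ₑ) + ENNReal.ofReal t * (‖y‖ₑ + ‖y'‖ₑ) := by
        gcongr; exact enorm_add_le _ _
    _ = _ := by ring

lemma kFun_smul_le (j : Y →L[ℝ] X) (t : ℝ) (c : ℝ) (x : X) :
    kFun j t (c • x) ≤ ‖c‖ₑ * kFun j t x := by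
  unfold kFun
  rw [ENNReal.mul_iInf (by simp)]
  refine le_iInf fun y => (iInf_le _ (c • y)).trans (le_of_eq ?_)
  rw [map_smul, ← smul_sub, enorm_smul, enorm_smul]
  ring

lemma kFun_mono (j : Y →L[ℝ] X) (x : X) : Monotone fun t => kFun j t x := by
  intro t t' h
  refine iInf_mono fun y => ?_
  gcongr

lemma measurable_integrand (j : Y →L[ℝ] X) (s : ℝ) (x : X) :
    Measurable fun t : ℝ => ENNReal.ofReal (t ^ (-s)) * kFun j t x :=
  ((measurable_id.pow_const _).ennreal_ofReal).mul (kFun_mono j x).measurable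

lemma interpENorm_zero (j : Y →L[ℝ] X) (s : ℝ) : interpENorm j s 0 = 0 := by
  unfold interpENorm
  split_ifs
  · simp
  · refine le_antisymm (iInf₂_le_of_le (0 : Y) (map_zero j) ?_) bot_le
    simp
  · simp [kFun_zero]

lemma interpENorm_add (j : Y →L[ℝ] X) (s : ℝ) (x x' : X) :
    interpENorm j s (x + x') ≤ interpENorm j s x + interpENorm j s x' := by
  unfold interpENorm
  split_ifs
  · exact enorm_add_le _ _
  · simp only [iInf_subtype']
    refine ENNReal.le_iInf_add_iInf fun y y' => ?_
    refine iInf_le_of_le ⟨y.1 + y'.1, by rw [map_add, y.2, y'.2]⟩ (enorm_add_le _ _)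
  · refine le_trans ?_ (ENNReal.lintegral_Lp_add_le (measurable_integrand j s x).aemeasurable
      (measurable_integrand j s x').aemeasurable one_le_two)
    gcongr with t
    simp only [Pi.add_apply, ← mul_add]
    gcongr
    exact kFun_add j t x x'

lemma interpENorm_smul_le (j : Y →L[ℝ] X) (s : ℝ) (c : ℝ) (x : X) :
    interpENorm j s (c • x) ≤ ‖c‖ₑ * interpENorm j s x := by
  rcases eq_or_ne c 0 with rfl | hc0
  · simp [interpENorm_zero]
  have hc : ‖c‖ₑ ≠ 0 := by simpa using hc0
  unfold interpENorm
  split_ifs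
  · rw [enorm_smul]
  · simp only [iInf_subtype']
    rw [ENNReal.mul_iInf' (by simp) (fun h => absurd h hc)]
    refine le_iInf fun y => iInf_le_of_le ⟨c • y.1, by rw [map_smul, y.2]⟩ ?_
    rw [enorm_smul]
  · calc _ ≤ (∫⁻ t, ‖c‖ₑ ^ (2 : ℝ) *
            (ENNReal.ofReal (t ^ (-s)) * kFun j t x) ^ (2 : ℝ) ∂dtOverT) ^ (1 / (2 : ℝ)) := by
          gcongr with t
          rw [← ENNReal.mul_rpow_of_nonneg _ _ (by norm_num)]
          refine ENNReal.rpow_le_rpow ?_ (by norm_num)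
          calc _ ≤ ENNReal.ofReal (t ^ (-s)) * (‖c‖ₑ * kFun j t x) := by
                gcongr; exact kFun_smul_le j t c x
            _ = _ := by ring
      _ = _ := by
          rw [lintegral_const_mul _ ((measurable_integrand j s x).pow_const _),
            ENNReal.mul_rpow_of_nonneg _ _ (by norm_num), ← ENNReal.rpow_mul]
          norm_num

lemma interpENorm_smul (j : Y →L[ℝ] X) (s : ℝ) (c : ℝ) (x : X) :
    interpENorm j s (c • x) = ‖c‖ₑ * interpENorm j s x := by
  refine le_antisymm (interpENorm_smul_le j s c x) ?_
  rcases eq_or_ne c 0 with rfl | hc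
  · simp
  · have h := interpENorm_smul_le j s c⁻¹ (c • x)
    rw [smul_smul, inv_mul_cancel₀ hc, one_smul] at h
    calc _ ≤ ‖c‖ₑ * (‖c⁻¹‖ₑ * interpENorm j s (c • x)) := by gcongr
      _ = _ := by
        rw [← mul_assoc, ← enorm_mul, mul_inv_cancel₀ hc]; simp

/-- `[X, Y]_{s,2}` is continuously embedded in `X`. -/
lemma exists_enorm_le (j : Y →L[ℝ] X) (s : ℝ) :
    ∃ C : ℝ≥0, ∀ x : X, ‖x‖ₑ ≤ C * interpENorm j s x := by
  unfold interpENorm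
  split_ifs with h0 h1
  · exact ⟨1, fun x => by simp⟩
  · refine ⟨‖j‖₊ + 1, fun x => ?_⟩
    simp only [iInf_subtype']
    rw [ENNReal.mul_iInf_of_ne (by simp) (by simp)]
    refine le_iInf fun y => ?_
    calc ‖x‖ₑ = ‖j y.1‖ₑ := by rw [y.2]
      _ ≤ ‖j‖ₑ * ‖y.1‖ₑ := j.le_opENorm y.1
      _ ≤ _ := by
        gcongr
        rw [enorm_eq_nnnorm, ENNReal.coe_add]
        exact le_self_add
  · refine ⟨(‖j‖₊ + 1) * (Real.toNNReal ((2 : ℝ) ^ |s|) * 2), fun x => ?_⟩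
    have hK : ‖x‖ₑ ≤ (‖j‖₊ + 1 : ℝ≥0) * kFun j 1 x := by
      unfold kFun
      rw [ENNReal.mul_iInf (fun h => absurd h (by simp))]
      refine le_iInf fun y => ?_
      calc ‖x‖ₑ = ‖(x - j y) + j y‖ₑ := by rw [sub_add_cancel]
        _ ≤ ‖x - j y‖ₑ + ‖j‖ₑ * ‖y‖ₑ :=
          (enorm_add_le _ _).trans (by gcongr; exact j.le_opENorm y)
        _ ≤ (‖j‖₊ + 1 : ℝ≥0) * ‖x - j y‖ₑ + (‖j‖₊ + 1 : ℝ≥0) * ‖y‖ₑ := by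
          have h1 : (1 : ℝ≥0∞) ≤ ((‖j‖₊ + 1 : ℝ≥0) : ℝ≥0∞) := by
            rw [ENNReal.coe_add]; exact le_add_self
          have h2 : ‖j‖ₑ ≤ ((‖j‖₊ + 1 : ℝ≥0) : ℝ≥0∞) := by
            rw [enorm_eq_nnnorm, ENNReal.coe_add]; exact le_self_add
          gcongr
          calc ‖x - j y‖ₑ = 1 * ‖x - j y‖ₑ := (one_mul _).symm
            _ ≤ _ := by gcongr
        _ = _ := by rw [ENNReal.ofReal_one, one_mul, mul_add]
    have hI : kFun j 1 x ≤ (Real.toNNReal ((2 : ℝ) ^ |s|) * 2 : ℝ≥0) *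
        (∫⁻ t, (ENNReal.ofReal (t ^ (-s)) * kFun j t x) ^ (2 : ℝ) ∂dtOverT) ^ (1 / (2 : ℝ)) := by
      have hμ : (2⁻¹ : ℝ≥0∞) ≤ dtOverT (Icc 1 2) := by
        have hsub : Icc (1 : ℝ) 2 ⊆ Ioi 0 := fun t ht => lt_of_lt_of_le one_pos ht.1
        rw [dtOverT, withDensity_apply _ measurableSet_Icc,
          Measure.restrict_restrict measurableSet_Icc, inter_eq_left.2 hsub]
        calc (2⁻¹ : ℝ≥0∞) = ∫⁻ _ in Icc (1 : ℝ) 2, (2⁻¹ : ℝ≥0∞) := by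
              simp only [lintegral_const, Measure.restrict_apply MeasurableSet.univ, univ_inter,
                Real.volume_Icc]
              norm_num
          _ ≤ _ := by
            refine setLIntegral_mono' measurableSet_Icc fun t ht => ?_
            have ht0 : (0 : ℝ) < t := hsub ht
            rw [ENNReal.ofReal_inv_of_pos ht0]
            refine ENNReal.inv_le_inv.2 ?_
            simpa using ENNReal.ofReal_le_ofReal ht.2
      set m : ℝ≥0∞ := ENNReal.ofReal ((2 : ℝ) ^ |s|) with hm
      have hm0 : m ≠ 0 := by simpa [hm] using Real.rpow_pos_of_pos two_pos |s|
      have hmt : m ≠ ⊤ := ENNReal.ofReal_ne_top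
      have hlow : (m⁻¹ * kFun j 1 x) ^ (2 : ℝ) * 2⁻¹ ≤
          ∫⁻ t, (ENNReal.ofReal (t ^ (-s)) * kFun j t x) ^ (2 : ℝ) ∂dtOverT := by
        calc _ ≤ (m⁻¹ * kFun j 1 x) ^ (2 : ℝ) * dtOverT (Icc 1 2) := by gcongr
          _ = ∫⁻ _ in Icc (1 : ℝ) 2, (m⁻¹ * kFun j 1 x) ^ (2 : ℝ) ∂dtOverT := by
              simp
          _ ≤ ∫⁻ t in Icc (1 : ℝ) 2,
                (ENNReal.ofReal (t ^ (-s)) * kFun j t x) ^ (2 : ℝ) ∂dtOverT := by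
              refine setLIntegral_mono' measurableSet_Icc fun t ht => ?_
              refine ENNReal.rpow_le_rpow (mul_le_mul' ?_ (kFun_mono j x ht.1)) (by norm_num)
              have ht0 : (0 : ℝ) < t := lt_of_lt_of_le one_pos ht.1
              rw [hm, ← ENNReal.ofReal_inv_of_pos (Real.rpow_pos_of_pos two_pos _),
                ← Real.rpow_neg two_pos.le]
              refine ENNReal.ofReal_le_ofReal ?_
              calc (2 : ℝ) ^ (-|s|) ≤ t ^ (-|s|) :=
                    Real.rpow_le_rpow_of_nonpos ht0 ht.2 (by simp)
                _ ≤ t ^ (-s) := Real.rpow_le_rpow_of_exponent_le ht.1 (by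
                    simpa using le_abs_self s)
          _ ≤ _ := setLIntegral_le_lintegral _ _
      have hroot := ENNReal.rpow_le_rpow hlow (z := 1 / (2 : ℝ)) (by norm_num)
      rw [ENNReal.mul_rpow_of_nonneg _ _ (by norm_num), ← ENNReal.rpow_mul] at hroot
      norm_num only [ENNReal.rpow_one] at hroot
      have h2 : (2⁻¹ : ℝ≥0∞) ≤ (2⁻¹ : ℝ≥0∞) ^ (1 / 2 : ℝ) := by
        calc (2⁻¹ : ℝ≥0∞) = (2⁻¹ : ℝ≥0∞) ^ (1 : ℝ) := (ENNReal.rpow_one _).symm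
          _ ≤ _ := ENNReal.rpow_le_rpow_of_exponent_ge (by simp) (by norm_num)
      have hc : ((Real.toNNReal ((2 : ℝ) ^ |s|) * 2 : ℝ≥0) : ℝ≥0∞) = m * 2 := by
        rw [ENNReal.coe_mul]; rfl
      rw [hc]
      calc kFun j 1 x = m * 2 * (m⁻¹ * kFun j 1 x * 2⁻¹) := by
            calc kFun j 1 x = (m * m⁻¹) * (2 * 2⁻¹) * kFun j 1 x := by
                  rw [ENNReal.mul_inv_cancel hm0 hmt,
                    ENNReal.mul_inv_cancel two_ne_zero ENNReal.ofNat_ne_top, one_mul, one_mul]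
              _ = _ := by ring
        _ ≤ _ := by
          gcongr
          exact (mul_le_mul_right h2 _).trans hroot
    calc ‖x‖ₑ ≤ _ := hK
      _ ≤ _ := mul_le_mul_right hI _
      _ = _ := by rw [ENNReal.coe_mul (‖j‖₊ + 1), mul_assoc]

/-- The vector space underlying `[X, Y]_{s,2}`. -/
def interpSubmodule (j : Y →L[ℝ] X) (s : ℝ) : Submodule ℝ X where
  carrier := {x | interpENorm j s x < ⊤}
  zero_mem' := by simp [interpENorm_zero]
  add_mem' := fun {x x'} hx hx' =>
    (interpENorm_add j s x x').trans_lt (ENNReal.add_lt_top.2 ⟨hx, hx'⟩)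
  smul_mem' := fun c x hx => by
    simp only [mem_ofPred_eq, interpENorm_smul] at hx ⊢
    exact ENNReal.mul_lt_top (by simp) hx

/-- The interpolation space `[X, Y]_{s,2}`, normed by `interpENorm`. -/
def InterpSpace (j : Y →L[ℝ] X) (s : ℝ) : Type _ := interpSubmodule j s

instance (j : Y →L[ℝ] X) (s : ℝ) : AddCommGroup (InterpSpace j s) :=
  inferInstanceAs (AddCommGroup (interpSubmodule j s))

instance (j : Y →L[ℝ] X) (s : ℝ) : Module ℝ (InterpSpace j s) :=
  inferInstanceAs (Module ℝ (interpSubmodule j s))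

/-- The inclusion of `[X, Y]_{s,2}` into `X`, as a linear map. -/
def InterpSpace.incl (j : Y →L[ℝ] X) (s : ℝ) : InterpSpace j s →ₗ[ℝ] X :=
  (interpSubmodule j s).subtype

lemma InterpSpace.incl_lt_top (j : Y →L[ℝ] X) (s : ℝ) (v : InterpSpace j s) :
    interpENorm j s (InterpSpace.incl j s v) < ⊤ := v.2

lemma InterpSpace.incl_injective (j : Y →L[ℝ] X) (s : ℝ) :
    Function.Injective (InterpSpace.incl j s) := (interpSubmodule j s).injective_subtype

instance (j : Y →L[ℝ] X) (s : ℝ) : Norm (InterpSpace j s) :=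
  ⟨fun v => (interpENorm j s (InterpSpace.incl j s v)).toReal⟩

lemma InterpSpace.norm_def (j : Y →L[ℝ] X) (s : ℝ) (v : InterpSpace j s) :
    ‖v‖ = (interpENorm j s (InterpSpace.incl j s v)).toReal := rfl

lemma InterpSpace.exists_norm_le (j : Y →L[ℝ] X) (s : ℝ) :
    ∃ C : ℝ, ∀ v : InterpSpace j s, ‖InterpSpace.incl j s v‖ ≤ C * ‖v‖ := by
  obtain ⟨C, hC⟩ := exists_enorm_le j s
  refine ⟨C, fun v => ?_⟩
  have h := ENNReal.toReal_mono
    (ENNReal.mul_lt_top ENNReal.coe_lt_top (InterpSpace.incl_lt_top j s v)).ne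
    (hC (InterpSpace.incl j s v))
  simpa [InterpSpace.norm_def] using h

lemma InterpSpace.core (j : Y →L[ℝ] X) (s : ℝ) : NormedSpace.Core ℝ (InterpSpace j s) where
  norm_nonneg v := ENNReal.toReal_nonneg
  norm_smul c v := by
    simp only [InterpSpace.norm_def, map_smul, interpENorm_smul, ENNReal.toReal_mul,
      toReal_enorm]
  norm_triangle v w := by
    simp only [InterpSpace.norm_def, map_add]
    rw [← ENNReal.toReal_add (InterpSpace.incl_lt_top j s v).ne
      (InterpSpace.incl_lt_top j s w).ne]
    exact ENNReal.toReal_mono (ENNReal.add_lt_top.2 ⟨InterpSpace.incl_lt_top j s v,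
      InterpSpace.incl_lt_top j s w⟩).ne (interpENorm_add j s _ _)
  norm_eq_zero_iff v := by
    constructor
    · intro h
      obtain ⟨C, hC⟩ := InterpSpace.exists_norm_le j s
      have h1 := hC v
      rw [h, mul_zero] at h1
      exact InterpSpace.incl_injective j s (by simpa using norm_le_zero_iff.1 h1)
    · rintro rfl
      simp [InterpSpace.norm_def, interpENorm_zero]

instance (j : Y →L[ℝ] X) (s : ℝ) : NormedAddCommGroup (InterpSpace j s) :=
  NormedAddCommGroup.ofCore (InterpSpace.core j s)

instance (j : Y →L[ℝ] X) (s : ℝ) : NormedSpace ℝ (InterpSpace j s) :=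
  NormedSpace.ofCore (InterpSpace.core j s)

/-- The continuous inclusion of `[X, Y]_{s,2}` into `X`. -/
def InterpSpace.toAmbient (j : Y →L[ℝ] X) (s : ℝ) : InterpSpace j s →L[ℝ] X :=
  (InterpSpace.incl j s).mkContinuousOfExistsBound (InterpSpace.exists_norm_le j s)

/-- `Y` is contained in `[X, Y]_{s,2}` for `0 ≤ s ≤ 1`. -/
lemma interpENorm_map_lt_top (j : Y →L[ℝ] X) {s : ℝ} (hs : s ∈ Icc (0 : ℝ) 1) (y : Y) :
    interpENorm j s (j y) < ⊤ := by
  unfold interpENorm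
  split_ifs with h0 h1
  · exact enorm_lt_top
  · exact lt_of_le_of_lt (iInf₂_le (f := fun (z : Y) (_ : j z = j y) => ‖z‖ₑ) y rfl) enorm_lt_top
  have hs0 : 0 < s := lt_of_le_of_ne hs.1 (Ne.symm h0)
  have hs1 : s < 1 := lt_of_le_of_ne hs.2 h1
  refine ENNReal.rpow_lt_top_of_nonneg (by norm_num) (ne_of_lt ?_)
  rw [dtOverT, lintegral_withDensity_eq_lintegral_mul _ (by fun_prop)
    ((measurable_integrand j s (j y)).pow_const _)]
  simp only [Pi.mul_apply]
  rw [← Ioc_union_Ioi_eq_Ioi (zero_le_one' ℝ)]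
  refine (lintegral_union_le _ _ _).trans_lt (ENNReal.add_lt_top.2 ⟨?_, ?_⟩)
  · have hint : IntegrableOn (fun t : ℝ => ‖y‖ ^ 2 * t ^ (1 - 2 * s)) (Ioc 0 1) :=
      ((intervalIntegrable_iff_integrableOn_Ioc_of_le zero_le_one).1
        (intervalIntegral.intervalIntegrable_rpow' (by linarith))).const_mul _
    refine lt_of_le_of_lt (setLIntegral_mono' measurableSet_Ioc fun t ht => ?_)
      hint.lintegral_lt_top
    have hK : kFun j t (j y) ≤ ENNReal.ofReal (t * ‖y‖) := by
      refine (iInf_le _ y).trans (le_of_eq ?_)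
      rw [sub_self, enorm_zero, zero_add, ENNReal.ofReal_mul ht.1.le, ofReal_norm]
    calc _ ≤ ENNReal.ofReal t⁻¹ * (ENNReal.ofReal (t ^ (-s)) * ENNReal.ofReal (t * ‖y‖)) ^ (2 : ℝ) := by
          gcongr
      _ = _ := by
          have h1 := Real.rpow_pos_of_pos ht.1 (-s)
          rw [← ENNReal.ofReal_mul h1.le, ENNReal.ofReal_rpow_of_nonneg
            (mul_nonneg h1.le (mul_nonneg ht.1.le (norm_nonneg _))) (by norm_num),
            ← ENNReal.ofReal_mul (inv_nonneg.2 ht.1.le)]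
          congr 1
          have h3 : t ^ (1 - 2 * s) = t * (t ^ (-s)) ^ 2 := by
            rw [← Real.rpow_natCast, ← Real.rpow_mul ht.1.le]
            nth_rw 2 [← Real.rpow_one t]
            rw [← Real.rpow_add ht.1]
            congr 1; push_cast; ring
          rw [h3, Real.rpow_two]
          have := ht.1.ne'
          field_simp
  · have hint : IntegrableOn (fun t : ℝ => ‖j y‖ ^ 2 * t ^ (-1 - 2 * s)) (Ioi 1) :=
      (integrableOn_Ioi_rpow_of_lt (by linarith) one_pos).const_mul _
    refine lt_of_le_of_lt (setLIntegral_mono' measurableSet_Ioi fun t ht => ?_)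
      hint.lintegral_lt_top
    have ht0 : (0 : ℝ) < t := one_pos.trans ht
    have hK : kFun j t (j y) ≤ ENNReal.ofReal ‖j y‖ := by
      refine (iInf_le _ 0).trans (le_of_eq ?_)
      simp
    calc _ ≤ ENNReal.ofReal t⁻¹ * (ENNReal.ofReal (t ^ (-s)) * ENNReal.ofReal ‖j y‖) ^ (2 : ℝ) := by
          gcongr
      _ = _ := by
          have h1 := Real.rpow_pos_of_pos ht0 (-s)
          rw [← ENNReal.ofReal_mul h1.le, ENNReal.ofReal_rpow_of_nonneg
            (mul_nonneg h1.le (norm_nonneg _)) (by norm_num),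
            ← ENNReal.ofReal_mul (inv_nonneg.2 ht0.le)]
          congr 1
          have h3 : t ^ (-1 - 2 * s) = t⁻¹ * (t ^ (-s)) ^ 2 := by
            rw [← Real.rpow_natCast, ← Real.rpow_mul ht0.le, ← Real.rpow_neg_one,
              ← Real.rpow_add ht0]
            congr 1; push_cast; ring
          rw [h3, Real.rpow_two]
          ring

/-- The inclusion of `Y` into `[X, Y]_{s,2}`, `0 ≤ s ≤ 1`. -/
def InterpSpace.ofSmall (j : Y →L[ℝ] X) {s : ℝ} (hs : s ∈ Icc (0 : ℝ) 1) (y : Y) :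
    InterpSpace j s :=
  ⟨j y, interpENorm_map_lt_top j hs y⟩

end Interpolation

/-! ### Sobolev spaces -/

/-- Euclidean space. -/
abbrev E (d : ℕ) := EuclideanSpace ℝ (Fin d)

/-- `L₂(Ω)`. -/
abbrev L2 {d : ℕ} (Ω : Set (E d)) := Lp ℝ 2 (volume.restrict Ω)

/-- `L₂(Ω; ℝᵈ)`. -/
abbrev L2Vec {d : ℕ} (Ω : Set (E d)) := Lp (E d) 2 (volume.restrict Ω)

/-- `g` is the weak gradient of `u` on the open set `Ω`. -/
def HasWeakGradient {d : ℕ} (Ω : Set (E d)) (u : E d → ℝ) (g : E d → E d) : Prop :=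
  ∀ η : E d → ℝ, ContDiff ℝ ∞ η → HasCompactSupport η → tsupport η ⊆ Ω → ∀ v : E d,
    ∫ x in Ω, u x * fderiv ℝ η x v = - ∫ x in Ω, inner ℝ (g x) v * η x

/-- `H¹(Ω)`: pairs of `u ∈ L₂(Ω)` and its weak gradient `∇u ∈ L₂(Ω; ℝᵈ)`, with norm
`(‖u‖² + ‖∇u‖²)^{1/2}`. -/
def h1Submodule {d : ℕ} (Ω : Set (E d)) : Submodule ℝ (WithLp 2 (L2 Ω × L2Vec Ω)) where
  carrier := {p | HasWeakGradient Ω p.fst p.snd}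
  zero_mem' := by
    intro η _ _ _ v
    have h1 : ∀ᵐ x ∂volume.restrict Ω,
        ((0 : WithLp 2 (L2 Ω × L2Vec Ω)).fst : E d → ℝ) x * fderiv ℝ η x v = 0 := by
      filter_upwards [Lp.coeFn_zero ℝ 2 (volume.restrict Ω)] with x hx
      simp only [WithLp.zero_fst, hx, Pi.zero_apply, zero_mul]
    have h2 : ∀ᵐ x ∂volume.restrict Ω,
        inner ℝ (((0 : WithLp 2 (L2 Ω × L2Vec Ω)).snd : E d → E d) x) v * η x = 0 := by
      filter_upwards [Lp.coeFn_zero (E d) 2 (volume.restrict Ω)] with x hx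
      simp only [WithLp.zero_snd, hx, Pi.zero_apply, inner_zero_left, zero_mul]
    rw [integral_congr_ae h1, integral_congr_ae h2]
    simp
  add_mem' := by
    intro p q hp hq η hη hc hs v
    have hη' : MemLp η 2 (volume.restrict Ω) :=
      (hη.continuous.memLp_of_hasCompactSupport hc).restrict Ω
    have hd : MemLp (fun x => fderiv ℝ η x v) 2 (volume.restrict Ω) :=
      (((hη.continuous_fderiv (by simp)).clm_apply continuous_const).memLp_of_hasCompactSupport
        (hc.fderiv_apply ℝ v)).restrict Ω
    have hg : ∀ r : L2Vec Ω, MemLp (fun x => inner ℝ (r x) v) 2 (volume.restrict Ω) :=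
      fun r => (Lp.memLp r).inner_const v
    have e1 : ∫ x in Ω, (p + q).fst x * fderiv ℝ η x v =
        (∫ x in Ω, p.fst x * fderiv ℝ η x v) + ∫ x in Ω, q.fst x * fderiv ℝ η x v := by
      refine Eq.trans (integral_congr_ae ?_) (integral_add ((Lp.memLp p.fst).integrable_mul hd)
        ((Lp.memLp q.fst).integrable_mul hd))
      filter_upwards [Lp.coeFn_add p.fst q.fst] with x hx
      simp only [WithLp.add_fst, hx, Pi.add_apply, add_mul]
    have e2 : ∫ x in Ω, inner ℝ ((p + q).snd x) v * η x =
        (∫ x in Ω, inner ℝ (p.snd x) v * η x) + ∫ x in Ω, inner ℝ (q.snd x) v * η x := by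
      refine Eq.trans (integral_congr_ae ?_)
        (integral_add ((hg p.snd).integrable_mul hη') ((hg q.snd).integrable_mul hη'))
      filter_upwards [Lp.coeFn_add p.snd q.snd] with x hx
      simp only [WithLp.add_snd, hx, Pi.add_apply, inner_add_left, add_mul]
    rw [e1, e2, hp η hη hc hs v, hq η hη hc hs v, neg_add]
  smul_mem' := by
    intro c p hp η hη hc hs v
    have e1 : ∫ x in Ω, (c • p).fst x * fderiv ℝ η x v =
        c * ∫ x in Ω, p.fst x * fderiv ℝ η x v := by
      rw [← integral_const_mul]
      refine integral_congr_ae ?_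
      filter_upwards [Lp.coeFn_smul c p.fst] with x hx
      simp only [WithLp.smul_fst, hx, Pi.smul_apply, smul_eq_mul, mul_assoc]
    have e2 : ∫ x in Ω, inner ℝ ((c • p).snd x) v * η x =
        c * ∫ x in Ω, inner ℝ (p.snd x) v * η x := by
      rw [← integral_const_mul]
      refine integral_congr_ae ?_
      filter_upwards [Lp.coeFn_smul c p.snd] with x hx
      simp only [WithLp.smul_snd, hx, Pi.smul_apply, real_inner_smul_left, mul_assoc]
    rw [e1, e2, hp η hη hc hs v, mul_neg]

/-- The space `H¹(Ω)` as a normed space. -/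
def H1 {d : ℕ} (Ω : Set (E d)) : Type := h1Submodule Ω

instance {d : ℕ} (Ω : Set (E d)) : NormedAddCommGroup (H1 Ω) :=
  inferInstanceAs (NormedAddCommGroup (h1Submodule Ω))

instance {d : ℕ} (Ω : Set (E d)) : NormedSpace ℝ (H1 Ω) :=
  inferInstanceAs (NormedSpace ℝ (h1Submodule Ω))

/-- The embedding `H¹(Ω) → L₂(Ω)`. -/
def H1.toL2 {d : ℕ} (Ω : Set (E d)) : H1 Ω →L[ℝ] L2 Ω :=
  (WithLp.fstL 2 ℝ (L2 Ω) (L2Vec Ω)).comp (h1Submodule Ω).subtypeL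

/-- `H¹_{0,γ}(Ω)`: the closure in `H¹(Ω)` of the (restrictions to `Ω` of) smooth functions that
vanish on `γ`. -/
def H10 {d : ℕ} (Ω γ : Set (E d)) : Submodule ℝ (H1 Ω) :=
  (Submodule.span ℝ {u : H1 Ω | ∃ v : E d → ℝ, ContDiff ℝ ∞ v ∧ (∀ x ∈ γ, v x = 0) ∧
    H1.toL2 Ω u =ᵐ[volume.restrict Ω] v}).topologicalClosure

/-- The embedding `H¹_{0,γ}(Ω) → L₂(Ω)`. -/
def H10.toL2 {d : ℕ} (Ω γ : Set (E d)) : H10 Ω γ →L[ℝ] L2 Ω :=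
  (H1.toL2 Ω).comp (H10 Ω γ).subtypeL

/-- The space `𝒱 = [L₂(Ω), H¹_{0,γ}(Ω)]_{s,2}`. -/
abbrev VSpace {d : ℕ} (Ω γ : Set (E d)) (s : ℝ) := InterpSpace (H10.toL2 Ω γ) s

/-- The space `𝒲 = 𝒱'`, with the dual norm. -/
abbrev WSpace {d : ℕ} (Ω γ : Set (E d)) (s : ℝ) := StrongDual ℝ (VSpace Ω γ s)

/-- The embedding `𝒱 → L₂(Ω)`. -/
abbrev VSpace.toL2 {d : ℕ} (Ω γ : Set (E d)) (s : ℝ) : VSpace Ω γ s →L[ℝ] L2 Ω :=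
  InterpSpace.toAmbient (H10.toL2 Ω γ) s

/-- The embedding `L₂(Ω) ≃ L₂(Ω)' → 𝒲`, sending `w` to `v ↦ ⟨w, v⟩_{L₂(Ω)}`. -/
def L2.toW {d : ℕ} (Ω γ : Set (E d)) (s : ℝ) (w : L2 Ω) : WSpace Ω γ s :=
  (innerSL ℝ w).comp (VSpace.toL2 Ω γ s)

/-! ### Domains and partitions -/

/-- Bounded polytopal domains: bounded connected open sets whose closure is a finite union of
nondegenerate simplices, which are the interior of their closure, and which do not touch
themselves at the boundary (every boundary point has arbitrarily small neighbourhoods with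
connected intersection with `Ω`; every Lipschitz domain has this property). -/
structure IsPolytopalDomain {d : ℕ} (Ω : Set (E d)) : Prop where
  isBounded : Bornology.IsBounded Ω
  isConnected : IsConnected Ω
  interior_closure : interior (closure Ω) = Ω
  closure_eq : ∃ 𝒮 : Finset (Finset (E d)),
    (∀ S ∈ 𝒮, S.card = d + 1 ∧ AffineIndependent ℝ ((↑) : S → E d)) ∧
      closure Ω = ⋃ S ∈ 𝒮, convexHull ℝ (S : Set (E d))
  locallyConnected : ∀ x ∈ frontier Ω, ∀ U ∈ 𝓝 x, ∃ V ∈ 𝓝 x, V ⊆ U ∧ IsConnected (Ω ∩ V)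

/-- Conforming partitions of `Ω` into closed `d`-simplices. A simplex is given by its set of
vertices. -/
structure IsConformingPartition {d : ℕ} (Ω : Set (E d)) (𝒯 : Finset (Finset (E d))) : Prop where
  card_eq : ∀ T ∈ 𝒯, T.card = d + 1
  affineIndependent : ∀ T ∈ 𝒯, AffineIndependent ℝ ((↑) : T → E d)
  inter_eq : ∀ T ∈ 𝒯, ∀ T' ∈ 𝒯, convexHull ℝ (T : Set (E d)) ∩ convexHull ℝ (T' : Set (E d)) =
    convexHull ℝ ((T : Set (E d)) ∩ T')
  cover : ⋃ T ∈ 𝒯, convexHull ℝ (T : Set (E d)) = closure Ω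

/-- Every simplex contains a ball whose radius is at least its diameter divided by `κ`. -/
def IsShapeRegular {d : ℕ} (κ : ℝ) (𝒯 : Finset (Finset (E d))) : Prop :=
  ∀ T ∈ 𝒯, ∃ x : E d, ∃ r : ℝ, 0 < r ∧ Metric.closedBall x r ⊆ convexHull ℝ (T : Set (E d)) ∧
    Metric.diam (convexHull ℝ (T : Set (E d))) ≤ κ * r

/-- The mesh size `h_T = |T|^{1/d}`. -/
def meshSize {d : ℕ} (T : Finset (E d)) : ℝ :=
  (volume.real (convexHull ℝ (T : Set (E d)))) ^ (1 / (d : ℝ))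

/-- The `K`-mesh property: neighbouring simplices have comparable sizes. -/
def IsKMesh {d : ℕ} (K : ℝ) (𝒯 : Finset (Finset (E d))) : Prop :=
  ∀ T ∈ 𝒯, ∀ T' ∈ 𝒯,
    (convexHull ℝ (T : Set (E d)) ∩ convexHull ℝ (T' : Set (E d))).Nonempty →
      meshSize T ≤ K * meshSize T'

/-- `γ` is a (possibly empty) union of `(d-1)`-faces of simplices of the partition. -/
def IsUnionOfFaces {d : ℕ} (𝒯 : Finset (Finset (E d))) (γ : Set (E d)) : Prop :=
  ∃ ℱ : Set (Finset (E d)), (∀ F ∈ ℱ, F.card = d ∧ ∃ T ∈ 𝒯, F ⊆ T) ∧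
    γ = ⋃ F ∈ ℱ, convexHull ℝ (F : Set (E d))

/-- The vertices of the partition. -/
def vertices {d : ℕ} (𝒯 : Finset (Finset (E d))) : Finset (E d) :=
  open Classical in 𝒯.biUnion id

/-- The vertices of the partition that are not on `γ`. -/
def freeVertices {d : ℕ} (𝒯 : Finset (Finset (E d))) (γ : Set (E d)) : Finset (E d) :=
  open Classical in (vertices 𝒯).filter (· ∉ γ)

/-- The patch `ω_ν`, the union of the simplices that have `ν` as a vertex. -/
def patch {d : ℕ} (𝒯 : Finset (Finset (E d))) (ν : E d) : Set (E d) :=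
  ⋃ T ∈ {T ∈ 𝒯 | ν ∈ T}, convexHull ℝ (T : Set (E d))

/-! ### The finite element space and the biorthogonal projector -/

section FiniteElements

variable {d : ℕ} (Ω γ : Set (E d)) (𝒯 : Finset (Finset (E d)))

/-- `g` is continuous on the closure of `Ω` and coincides on each simplex of the partition with
an affine function. -/
def IsContPiecewiseLinear (g : E d → ℝ) : Prop :=
  ContinuousOn g (closure Ω) ∧
    ∀ T ∈ 𝒯, ∃ a : E d →ᵃ[ℝ] ℝ, EqOn g a (convexHull ℝ (T : Set (E d)))

/-- `𝒱_𝒯`: the continuous piecewise linears in `H¹_{0,γ}(Ω)` that are zero on `γ`. -/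
def feSpace : Set (H10 Ω γ) :=
  {u | ∃ g : E d → ℝ, IsContPiecewiseLinear Ω 𝒯 g ∧ (∀ x ∈ γ, g x = 0) ∧
    H10.toL2 Ω γ u =ᵐ[volume.restrict Ω] g}

/-- `u` is the nodal basis function of `ν`: the member of `H¹_{0,γ}(Ω)` represented by the
continuous piecewise linear function with value `1` at `ν` and `0` at all other vertices. -/
def IsNodal (ν : E d) (u : H10 Ω γ) : Prop :=
  ∃ g : E d → ℝ, IsContPiecewiseLinear Ω 𝒯 g ∧ g ν = 1 ∧
    (∀ ν' ∈ vertices 𝒯, ν' ≠ ν → g ν' = 0) ∧ H10.toL2 Ω γ u =ᵐ[volume.restrict Ω] g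

/-- The nodal basis function `φ_ν`. -/
def nodal (ν : E d) : H10 Ω γ := Classical.epsilon (IsNodal Ω γ 𝒯 ν)

/-- `φ_ν` as a member of `L₂(Ω)`. -/
def nodalL2 (ν : E d) : L2 Ω := H10.toL2 Ω γ (nodal Ω γ 𝒯 ν)

/-- `φ_ν` as a member of `𝒱`. -/
def nodalV {s : ℝ} (hs : s ∈ Icc (0 : ℝ) 1) (ν : E d) : VSpace Ω γ s :=
  InterpSpace.ofSmall (H10.toL2 Ω γ) hs (nodal Ω γ 𝒯 ν)

/-- The assumptions on the collection `Ψ_𝒯 = (ψ_ν)`, with constants `c` and `C`: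
`|⟨φ_ν, ψ_ν'⟩|` lies between `c δ_{νν'} ‖φ_ν‖ ‖ψ_ν'‖` and `C δ_{νν'} ‖φ_ν‖ ‖ψ_ν'‖`,
the support of `ψ_ν` is contained in `ω_ν`, and (as `dim span Ψ_𝒯 = dim 𝒱_𝒯`) no `ψ_ν` is zero. -/
structure IsBiorthogonalLocal (c C : ℝ) (ψ : freeVertices 𝒯 γ → L2 Ω) : Prop where
  lower : ∀ ν ν' : freeVertices 𝒯 γ, c * (if ν = ν' then 1 else 0) * ‖nodalL2 Ω γ 𝒯 ν‖ * ‖ψ ν'‖ ≤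
    |inner ℝ (nodalL2 Ω γ 𝒯 ν) (ψ ν')|
  upper : ∀ ν ν' : freeVertices 𝒯 γ, |inner ℝ (nodalL2 Ω γ 𝒯 ν) (ψ ν')| ≤
    C * (if ν = ν' then 1 else 0) * ‖nodalL2 Ω γ 𝒯 ν‖ * ‖ψ ν'‖
  support : ∀ ν : freeVertices 𝒯 γ, ∀ᵐ x ∂volume.restrict Ω, x ∉ patch 𝒯 (ν : E d) → ψ ν x = 0
  ne_zero : ∀ ν : freeVertices 𝒯 γ, ψ ν ≠ 0

variable {𝒯}

/-- The projector `P_𝒯 : 𝒲 → 𝒲`, `P_𝒯 f = ∑_ν f(φ_ν) / ⟨φ_ν, ψ_ν⟩ ψ_ν`. -/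
def projW {s : ℝ} (hs : s ∈ Icc (0 : ℝ) 1) (ψ : freeVertices 𝒯 γ → L2 Ω) :
    WSpace Ω γ s →L[ℝ] WSpace Ω γ s :=
  ∑ ν : freeVertices 𝒯 γ, (inner ℝ (nodalL2 Ω γ 𝒯 ν) (ψ ν))⁻¹ •
    (ContinuousLinearMap.apply ℝ ℝ (nodalV Ω γ 𝒯 hs ν)).smulRight (L2.toW Ω γ s (ψ ν))

/-- The operator `P_𝒯' : 𝒱 → 𝒱`, `P_𝒯' u = ∑_ν ⟨u, ψ_ν⟩ / ⟨φ_ν, ψ_ν⟩ φ_ν`. -/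
def projV {s : ℝ} (hs : s ∈ Icc (0 : ℝ) 1) (ψ : freeVertices 𝒯 γ → L2 Ω) :
    VSpace Ω γ s →L[ℝ] VSpace Ω γ s :=
  ∑ ν : freeVertices 𝒯 γ, (inner ℝ (nodalL2 Ω γ 𝒯 ν) (ψ ν))⁻¹ •
    (L2.toW Ω γ s (ψ ν)).smulRight (nodalV Ω γ 𝒯 hs ν)

end FiniteElements

end BiorthFE

open BiorthFE

namespace BiorthFE

/-! ### Barycentric coordinates of simplices given by their vertices -/

/-! `P_𝒯` is the transpose of `P_𝒯'`, so the two norms coincide (`norm_eq_of_transpose`) and only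
`P_𝒯'` needs a bound. Since every `ψ_ν` is in `L₂(Ω)`, the formula for `P_𝒯'` acts on all of
`L₂(Ω)`, and it maps `H¹_{0,γ}(Ω)` to itself. Bounds on these two spaces with a common constant pass
through the K-functional to all `s` (`interpENorm_map_le`). The statements on ranges are algebra
with biorthogonality.

On `L₂(Ω)`: the lower biorthogonality bound and the support of `ψ_ν` control the coefficient of
`φ_ν` by the norm of `u` on the patch divided by `‖φ_ν‖`, and `‖φ_ν‖²` dominates the volume of each
simplex of the patch. Shape regularity bounds the number of simplices at a vertex (`card_star_le`),
so the local bounds can be summed (`sq_norm_projL2_le`).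

On `H¹_{0,γ}(Ω)`: by density `u` is smooth and vanishes on `γ`. The gradient of `P_𝒯' u` on `T`
depends only on differences of coefficients, so it suffices that the coefficients at the vertices of
`T` are close to an approximate mean of `u` on `T`, measured by scaled gradients of `u` nearby.
`P_𝒯'` reproduces finite element functions; hence its coefficients differ from those of a
quasi-interpolant by coefficients of the interpolation error, to which the local `L₂` estimate
applies (`sq_projCoeff_sub_mean_le`). The quasi-interpolant takes element means as nodal values off
`γ` and zero on `γ` (`exists_nodal_values`).

Its accuracy rests on comparing means across common faces (`sq_mean_sub_mean_le_of_insert`), on a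
Friedrichs inequality at faces in `γ`, and on chains of face-adjacent simplices inside the star of a
vertex. Such chains exist because `Ω` is locally connected up to its boundary and a generic segment
misses all faces of codimension two (`star_connected`). They also make the diameters in a star
comparable; for `d = 1` the K-mesh property supplies this comparison.

Existence of the nodal functions: the hat function is globally Lipschitz on the closure of `Ω`, and
a Lipschitz function vanishing on `γ` is an `L₂` limit of smooth functions vanishing on `γ` that are
bounded in `H¹`. Weak compactness places it in `H¹_{0,γ}(Ω)` (`exists_H10_of_lipschitz`). -/

/-- `T` is the set of vertices of a nondegenerate `d`-simplex. -/
structure IsSimplex {d : ℕ} (T : Finset (E d)) : Prop where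
  card_eq : T.card = d + 1
  affineIndependent : AffineIndependent ℝ ((↑) : T → E d)

local notation "Δ " T:max => convexHull ℝ (SetLike.coe (T : Finset (E _)) : Set (E _))

section Simplex

variable {d : ℕ} {T : Finset (E d)}

lemma IsSimplex.affineSpan_eq_top (hT : IsSimplex T) :
    affineSpan ℝ (range ((↑) : T → E d)) = ⊤ := by
  rw [hT.affineIndependent.affineSpan_eq_top_iff_card_eq_finrank_add_one]
  simp [hT.card_eq]

/-- The vertices of a simplex as an affine basis. -/
def IsSimplex.basis (hT : IsSimplex T) : AffineBasis T ℝ (E d) :=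
  ⟨(↑), hT.affineIndependent, hT.affineSpan_eq_top⟩

lemma IsSimplex.basis_apply (hT : IsSimplex T) (w : T) : hT.basis w = w := rfl

open Classical in
/-- The barycentric coordinate with respect to `w` of the simplex with vertices `T`. It is
zero when `w` is not a vertex. -/
def bary (T : Finset (E d)) (w : E d) : E d →ᵃ[ℝ] ℝ :=
  if h : IsSimplex T ∧ w ∈ T then h.1.basis.coord ⟨w, h.2⟩ else AffineMap.const ℝ (E d) 0

lemma IsSimplex.bary_eq (hT : IsSimplex T) {w : E d} (hw : w ∈ T) :
    bary T w = hT.basis.coord ⟨w, hw⟩ := by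
  rw [bary, dif_pos ⟨hT, hw⟩]

lemma bary_of_notMem {w : E d} (hw : w ∉ T) (x : E d) : bary T w x = 0 := by
  rw [bary, dif_neg (fun h => hw h.2)]; rfl

lemma IsSimplex.bary_self (hT : IsSimplex T) {w : E d} (hw : w ∈ T) : bary T w w = 1 := by
  rw [hT.bary_eq hw]
  exact hT.basis.coord_apply_eq ⟨w, hw⟩

lemma IsSimplex.bary_of_ne (hT : IsSimplex T) {w v : E d} (hv : v ∈ T) (h : v ≠ w) :
    bary T w v = 0 := by
  by_cases hw : w ∈ T
  · rw [hT.bary_eq hw]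
    exact hT.basis.coord_apply_ne (i := ⟨w, hw⟩) (j := ⟨v, hv⟩) (by simpa using h.symm)
  · exact bary_of_notMem hw v

lemma IsSimplex.sum_bary (hT : IsSimplex T) (x : E d) : ∑ w ∈ T, bary T w x = 1 := by
  rw [← hT.basis.sum_coord_apply_eq_one x, ← Finset.sum_attach]
  refine Finset.sum_congr rfl fun w _ => ?_
  rw [hT.bary_eq w.2]

lemma IsSimplex.sum_bary_smul (hT : IsSimplex T) (x : E d) : ∑ w ∈ T, bary T w x • w = x := by
  conv_rhs => rw [← hT.basis.linear_combination_coord_eq_self x]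
  rw [← Finset.sum_attach]
  refine Finset.sum_congr rfl fun w _ => ?_
  rw [hT.bary_eq w.2]; rfl

lemma IsSimplex.affineMap_apply (hT : IsSimplex T) (a : E d →ᵃ[ℝ] ℝ) (x : E d) :
    a x = ∑ w ∈ T, bary T w x * a w := by
  have h := Finset.map_affineCombination T id (fun w => bary T w x) (hT.sum_bary x) a
  rw [Finset.affineCombination_eq_linear_combination _ _ _ (hT.sum_bary x),
    Finset.affineCombination_eq_linear_combination _ _ _ (hT.sum_bary x)] at h
  simpa [hT.sum_bary_smul x] using h

lemma continuous_bary (T : Finset (E d)) (w : E d) : Continuous (bary T w) :=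
  AffineMap.continuous_of_finiteDimensional _

lemma IsSimplex.mem_hull (hT : IsSimplex T) {x : E d} :
    x ∈ Δ T ↔ ∀ w, 0 ≤ bary T w x := by
  have h : (Δ T : Set (E d)) = convexHull ℝ (range hT.basis) := by
    congr 1
    ext w; simp [IsSimplex.basis_apply]
  rw [h, hT.basis.convexHull_eq_nonneg_coord]
  constructor
  · intro hx w
    by_cases hw : w ∈ T
    · rw [hT.bary_eq hw]; exact hx _
    · rw [bary_of_notMem hw]
  · intro hx w
    have := hx w
    rwa [hT.bary_eq w.2] at this

lemma IsSimplex.bary_nonneg (hT : IsSimplex T) {x : E d} (hx : x ∈ Δ T) (w : E d) :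
    0 ≤ bary T w x := hT.mem_hull.1 hx w

lemma IsSimplex.bary_le_one (hT : IsSimplex T) {x : E d} (hx : x ∈ Δ T) (w : E d) :
    bary T w x ≤ 1 := by
  by_cases hw : w ∈ T
  · rw [← hT.sum_bary x]
    exact Finset.single_le_sum (f := fun w => bary T w x) (fun v _ => hT.bary_nonneg hx v) hw
  · rw [bary_of_notMem hw]; exact zero_le_one

/-- Convex combinations of the vertices have the weights as barycentric coordinates. -/
lemma IsSimplex.bary_sum_smul (hT : IsSimplex T) {c : E d → ℝ} (hc : ∑ w ∈ T, c w = 1)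
    {v : E d} (hv : v ∈ T) : bary T v (∑ w ∈ T, c w • w) = c v := by
  have h := Finset.map_affineCombination T id c hc (bary T v)
  rw [Finset.affineCombination_eq_linear_combination _ _ _ hc,
    Finset.affineCombination_eq_linear_combination _ _ _ hc] at h
  simp only [id, Function.comp_apply, smul_eq_mul] at h
  rw [h, Finset.sum_eq_single v]
  · rw [hT.bary_self hv, mul_one]
  · intro w hw hne; rw [hT.bary_of_ne hw hne, mul_zero]
  · exact fun h => absurd hv h

/-- Reduces incidence questions in a conforming partition to the vanishing of barycentric
coordinates. -/
lemma IsSimplex.mem_subface (hT : IsSimplex T) {F : Finset (E d)} (hF : F ⊆ T) {x : E d} :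
    x ∈ Δ F ↔ x ∈ Δ T ∧ ∀ w, w ∉ F → bary T w x = 0 := by
  constructor
  · intro hx
    refine ⟨convexHull_mono (by exact_mod_cast hF) hx, fun w hw => ?_⟩
    have : (Δ F : Set (E d)) ⊆ (bary T w) ⁻¹' {0} := by
      refine convexHull_min ?_ ((convex_singleton (0 : ℝ)).affine_preimage _)
      intro v hv
      exact hT.bary_of_ne (hF hv) (fun h => hw (h ▸ hv))
    exact this hx
  · rintro ⟨hx, h0⟩
    have hs : ∑ w ∈ F, bary T w x = 1 := by
      rw [← hT.sum_bary x]
      exact Finset.sum_subset hF fun w _ hw => h0 w hw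
    have hx' : ∑ w ∈ F, bary T w x • w = x := by
      conv_rhs => rw [← hT.sum_bary_smul x]
      exact Finset.sum_subset hF fun w _ hw => by rw [h0 w hw, zero_smul]
    rw [← hx']
    exact (convex_convexHull ℝ _).sum_mem (fun w _ => hT.bary_nonneg hx w) hs
      fun w hw => subset_convexHull ℝ _ hw

lemma isCompact_hull (T : Finset (E d)) : IsCompact (Δ T) :=
  (Finset.finite_toSet T).isCompact_convexHull ℝ

lemma isClosed_hull (T : Finset (E d)) : IsClosed (Δ T) := (isCompact_hull T).isClosed

lemma measurableSet_hull (T : Finset (E d)) : MeasurableSet (Δ T) := (isClosed_hull T).measurableSet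

lemma IsSimplex.interior_nonempty (hT : IsSimplex T) : (interior (Δ T)).Nonempty := by
  rw [interior_convexHull_nonempty_iff_affineSpan_eq_top, ← hT.affineSpan_eq_top]
  simp

lemma IsSimplex.volume_pos (hT : IsSimplex T) : 0 < volume (Δ T) :=
  Measure.measure_pos_of_nonempty_interior _ hT.interior_nonempty

lemma volume_hull_lt_top (T : Finset (E d)) : volume (Δ T) < ⊤ :=
  (isCompact_hull T).measure_lt_top

lemma interior_ae_eq_hull (T : Finset (E d)) : (interior (Δ T) : Set (E d)) =ᵐ[volume] Δ T :=
  interior_ae_eq_of_null_frontier ((convex_convexHull ℝ _).addHaar_frontier volume)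

lemma restrict_interior_hull (T : Finset (E d)) :
    (volume : Measure (E d)).restrict (interior (Δ T)) = volume.restrict (Δ T) :=
  Measure.restrict_congr_set (interior_ae_eq_hull T)

lemma dist_le_diam_hull (T : Finset (E d)) {x y : E d} (hx : x ∈ Δ T) (hy : y ∈ Δ T) :
    dist x y ≤ Metric.diam (Δ T) :=
  Metric.dist_le_diam_of_mem (isCompact_hull T).isBounded hx hy

/-- The gradient of a barycentric coordinate is bounded by the inverse of the diameter of any
inscribed ball. -/
lemma IsSimplex.norm_bary_linear_le (hT : IsSimplex T) (w : E d) {x : E d} {r : ℝ} (hr : 0 < r)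
    (hx : Metric.closedBall x r ⊆ Δ T) (v : E d) :
    2 * r * |(bary T w).linear v| ≤ ‖v‖ := by
  rcases eq_or_ne v 0 with rfl | hv
  · simp
  have hv' : 0 < ‖v‖ := norm_pos_iff.2 hv
  -- Both `x + e` and `x - e` lie in the inscribed ball, where the coordinate takes values in `[0,
  -- 1]`; its increment between them is twice its linear part at `e`.
  set e : E d := (r / ‖v‖) • v with he
  have hen : ‖e‖ = r := by
    rw [he, norm_smul, Real.norm_of_nonneg (by positivity)]; field_simp
  have h1 : x + e ∈ Δ T := hx (by simp [hen])
  have h2 : x - e ∈ Δ T := hx (by simp [hen])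
  have e1 : bary T w (x + e) = (bary T w).linear e + bary T w x := by
    simpa [add_comm] using (bary T w).map_vadd x e
  have e2 : bary T w (x - e) = -(bary T w).linear e + bary T w x := by
    have := (bary T w).map_vadd x (-e)
    simp only [vadd_eq_add, map_neg] at this
    rw [← this]; congr 1; abel
  have b1 := hT.bary_nonneg h1 w
  have b2 := hT.bary_le_one h1 w
  have b3 := hT.bary_nonneg h2 w
  have b4 := hT.bary_le_one h2 w
  have h3 : 2 * |(bary T w).linear e| ≤ 1 := by
    rcases abs_cases ((bary T w).linear e) with ⟨h, _⟩ | ⟨h, _⟩ <;> rw [h] <;> linarith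
  rw [he, map_smul, smul_eq_mul, abs_mul, abs_of_nonneg (by positivity)] at h3
  calc 2 * r * |(bary T w).linear v| = ‖v‖ * (2 * (r / ‖v‖ * |(bary T w).linear v|)) := by
        field_simp
    _ ≤ ‖v‖ * 1 := by gcongr
    _ = _ := mul_one _

/-- Along the edge the coordinate of `v` drops from one to zero, with slope at most `1 / (2 r)`.
Under shape regularity every edge is therefore comparable to the diameter. -/
lemma IsSimplex.two_mul_inradius_le_dist (hT : IsSimplex T) {x : E d} {r : ℝ} (hr : 0 < r)
    (hx : Metric.closedBall x r ⊆ Δ T) {v w : E d} (hv : v ∈ T) (hw : w ∈ T) (hne : v ≠ w) :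
    2 * r ≤ dist v w := by
  have h := hT.norm_bary_linear_le v hr hx (v - w)
  have h1 : (bary T v).linear (v - w) = 1 := by
    have := (bary T v).linearMap_vsub v w
    rw [vsub_eq_sub] at this
    rw [this, hT.bary_self hv, hT.bary_of_ne hw hne.symm, vsub_eq_sub, sub_zero]
  rwa [h1, abs_one, mul_one, ← dist_eq_norm] at h

end Simplex

/-! ### Conforming partitions -/

lemma volume_affineSpan_eq_zero {d : ℕ} {F : Finset (E d)} (hF : F.card ≤ d) :
    volume (affineSpan ℝ (F : Set (E d)) : Set (E d)) = 0 := by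
  classical
  refine Measure.addHaar_affineSubspace _ _ fun h => ?_
  rcases F.eq_empty_or_nonempty with rfl | hne
  · have : (0 : E d) ∈ affineSpan ℝ ((∅ : Finset (E d)) : Set (E d)) := by rw [h]; trivial
    rw [Finset.coe_empty, AffineSubspace.span_empty] at this
    exact AffineSubspace.notMem_bot ℝ _ _ this
  · obtain ⟨n, hn⟩ : ∃ n, F.card = n + 1 := ⟨F.card - 1, by have := hne.card_pos; omega⟩
    have h1 := finrank_vectorSpan_image_finset_le ℝ (id : E d → E d) F hn
    rw [Finset.image_id, ← direction_affineSpan, h, AffineSubspace.direction_top, finrank_top] at h1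
    simp at h1
    omega

section Partition

variable {d : ℕ} {Ω : Set (E d)} {𝒯 : Finset (Finset (E d))}

lemma IsConformingPartition.isSimplex (h : IsConformingPartition Ω 𝒯) {T : Finset (E d)}
    (hT : T ∈ 𝒯) : IsSimplex T := ⟨h.card_eq T hT, h.affineIndependent T hT⟩

open Classical in
/-- The simplices of the partition that have `ν` as a vertex. -/
def star (𝒯 : Finset (Finset (E d))) (ν : E d) : Finset (Finset (E d)) := 𝒯.filter (ν ∈ ·)

lemma mem_star {ν : E d} {T : Finset (E d)} : T ∈ star 𝒯 ν ↔ T ∈ 𝒯 ∧ ν ∈ T := by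
  simp [star]

lemma mem_vertices {ν : E d} : ν ∈ vertices 𝒯 ↔ ∃ T ∈ 𝒯, ν ∈ T := by
  simp [vertices]

lemma mem_freeVertices {γ : Set (E d)} {ν : E d} :
    ν ∈ freeVertices 𝒯 γ ↔ ν ∈ vertices 𝒯 ∧ ν ∉ γ := by
  simp [freeVertices]

lemma IsConformingPartition.inter_eq_hull [DecidableEq (E d)] (h : IsConformingPartition Ω 𝒯)
    {T T' : Finset (E d)} (hT : T ∈ 𝒯) (hT' : T' ∈ 𝒯) : (Δ T) ∩ (Δ T') = Δ (T ∩ T') := by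
  rw [h.inter_eq T hT T' hT', Finset.coe_inter]

/-- There are no hanging nodes: conformity puts `ν` on the face spanned by the common vertices, and
the coordinate of `ν`, which is one at `ν`, vanishes on faces that do not have `ν` as a vertex. -/
lemma IsConformingPartition.mem_of_mem_hull (h : IsConformingPartition Ω 𝒯) {ν : E d}
    (hν : ν ∈ vertices 𝒯) {T : Finset (E d)} (hT : T ∈ 𝒯) (hνT : ν ∈ Δ T) : ν ∈ T := by
  classical
  obtain ⟨T₀, hT₀, hν₀⟩ := mem_vertices.1 hν
  have h1 : ν ∈ Δ (T₀ ∩ T) := by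
    rw [← h.inter_eq_hull hT₀ hT]; exact ⟨subset_convexHull ℝ _ hν₀, hνT⟩
  by_contra hn
  have h2 := ((h.isSimplex hT₀).mem_subface Finset.inter_subset_left).1 h1
  have h3 := h2.2 ν (fun hh => hn (Finset.mem_inter.1 hh).2)
  rw [(h.isSimplex hT₀).bary_self hν₀] at h3
  exact one_ne_zero h3

lemma IsConformingPartition.hull_subset_closure (h : IsConformingPartition Ω 𝒯)
    {T : Finset (E d)} (hT : T ∈ 𝒯) : (Δ T) ⊆ closure Ω := by
  rw [← h.cover]; exact subset_biUnion_of_mem (u := fun T : Finset (E d) => (Δ T)) hT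

lemma IsConformingPartition.exists_mem_hull (h : IsConformingPartition Ω 𝒯) {x : E d}
    (hx : x ∈ closure Ω) : ∃ T ∈ 𝒯, x ∈ Δ T := by
  rw [← h.cover] at hx; simpa using hx

lemma IsConformingPartition.interior_hull_subset (h : IsConformingPartition Ω 𝒯)
    (hΩ : interior (closure Ω) = Ω) {T : Finset (E d)} (hT : T ∈ 𝒯) : interior (Δ T) ⊆ Ω := by
  rw [← hΩ]; exact interior_mono (h.hull_subset_closure hT)

/-- Distinct simplices have at most `d` common vertices, so their intersection lies in a proper
affine subspace. -/
lemma IsConformingPartition.aedisjoint (h : IsConformingPartition Ω 𝒯)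
    {T T' : Finset (E d)} (hT : T ∈ 𝒯) (hT' : T' ∈ 𝒯) (hne : T ≠ T') :
    AEDisjoint volume (Δ T) (Δ T') := by
  classical
  have hc : (T ∩ T').card ≤ d := by
    by_contra hlt
    have h1 := h.card_eq T hT
    have h2 := h.card_eq T' hT'
    have e1 : T ∩ T' = T := Finset.eq_of_subset_of_card_le Finset.inter_subset_left (by omega)
    have e2 : T ∩ T' = T' := Finset.eq_of_subset_of_card_le Finset.inter_subset_right (by omega)
    exact hne (e1.symm.trans e2)
  refine measure_mono_null ?_ (volume_affineSpan_eq_zero hc)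
  rw [h.inter_eq_hull hT hT']
  exact convexHull_subset_affineSpan _

/-- The interiors of the simplices lie in `Ω` because `Ω` is the interior of its closure, and
frontiers of convex sets are null. In particular the boundary of `Ω` carries no mass. -/
lemma IsConformingPartition.ae_eq_biUnion (h : IsConformingPartition Ω 𝒯)
    (hΩ : interior (closure Ω) = Ω) : Ω =ᵐ[volume] ⋃ T ∈ 𝒯, Δ T := by
  refine Filter.EventuallyLE.antisymm ?_ ?_
  · rw [h.cover]; exact subset_closure.eventuallyLE
  · refine Filter.EventuallyLE.trans (g := ⋃ T ∈ 𝒯, interior (Δ T)) ?_ ?_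
    · have h1 : ∀ T ∈ 𝒯, (Δ T : Set (E d)) ≤ᵐ[volume] interior (Δ T) := fun T _ =>
        (interior_ae_eq_hull T).symm.le
      have h2 : ∀ᵐ x : E d, ∀ T ∈ 𝒯, x ∈ (Δ T) → x ∈ interior (Δ T) :=
        (Filter.eventually_all_finset 𝒯).2 h1
      filter_upwards [h2] with x hx hx'
      obtain ⟨T, hT, hxT⟩ := mem_iUnion₂.1 hx'
      exact mem_iUnion₂.2 ⟨T, hT, hx T hT hxT⟩
    · have h3 : (⋃ T ∈ 𝒯, interior (Δ T)) ⊆ Ω :=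
        iUnion₂_subset fun T hT => h.interior_hull_subset hΩ hT
      exact h3.eventuallyLE

lemma IsConformingPartition.lintegral_eq_sum (h : IsConformingPartition Ω 𝒯)
    (hΩ : interior (closure Ω) = Ω) (f : E d → ℝ≥0∞) :
    ∫⁻ x in Ω, f x = ∑ T ∈ 𝒯, ∫⁻ x in Δ T, f x := by
  rw [Measure.restrict_congr_set (h.ae_eq_biUnion hΩ)]
  exact lintegral_biUnion_finset₀ (fun T hT T' hT' hne => h.aedisjoint hT hT' hne)
    (fun T _ => (measurableSet_hull T).nullMeasurableSet) f

lemma IsConformingPartition.restrict_hull_le (h : IsConformingPartition Ω 𝒯)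
    (hΩ : interior (closure Ω) = Ω) {T : Finset (E d)} (hT : T ∈ 𝒯) :
    (volume : Measure (E d)).restrict (Δ T) ≤ volume.restrict Ω := by
  rw [← restrict_interior_hull]
  exact Measure.restrict_mono (h.interior_hull_subset hΩ hT) le_rfl

lemma IsConformingPartition.ae_restrict_iff (h : IsConformingPartition Ω 𝒯)
    (hΩ : interior (closure Ω) = Ω) {p : E d → Prop} :
    (∀ᵐ x ∂volume.restrict Ω, p x) ↔ ∀ T ∈ 𝒯, ∀ᵐ x ∂volume.restrict (Δ T), p x := by
  refine ⟨fun hp T hT => ae_mono (h.restrict_hull_le hΩ hT) hp, fun hp => ?_⟩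
  rw [Measure.restrict_congr_set (h.ae_eq_biUnion hΩ)]
  exact (ae_restrict_biUnion_finset_iff _ _ _).2 hp

/-! ### Size of simplices -/

lemma IsSimplex.exists_ne (hd : 0 < d) {T : Finset (E d)} (hT : IsSimplex T) {v : E d}
    (_hv : v ∈ T) : ∃ w ∈ T, w ≠ v :=
  Finset.exists_mem_ne (by rw [hT.card_eq]; omega) v

lemma IsSimplex.diam_pos (hd : 0 < d) {T : Finset (E d)} (hT : IsSimplex T) :
    0 < Metric.diam (Δ T) := by
  obtain ⟨v, hv⟩ : T.Nonempty := Finset.card_pos.1 (by rw [hT.card_eq]; omega)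
  obtain ⟨w, hw, hne⟩ := hT.exists_ne hd hv
  exact (dist_pos.2 hne).trans_le
    (dist_le_diam_hull T (subset_convexHull ℝ _ hw) (subset_convexHull ℝ _ hv))

/-- No sign of `κ` is assumed; its positivity is read off from one simplex, any edge of which has
length between `2 r` and `κ r`. -/
lemma IsConformingPartition.two_le_shape (hd : 0 < d) {κ : ℝ} (h : IsConformingPartition Ω 𝒯)
    (hκ : IsShapeRegular κ 𝒯) {T : Finset (E d)} (hT : T ∈ 𝒯) : 2 ≤ κ := by
  obtain ⟨x, r, hr, hsub, hle⟩ := hκ T hT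
  have hS := h.isSimplex hT
  obtain ⟨v, hv⟩ : T.Nonempty := Finset.card_pos.1 (by rw [hS.card_eq]; omega)
  obtain ⟨w, hw, hne⟩ := hS.exists_ne hd hv
  have h1 := hS.two_mul_inradius_le_dist hr hsub hw hv hne
  have h2 := dist_le_diam_hull T (subset_convexHull ℝ _ hw) (subset_convexHull ℝ _ hv)
  have : 2 * r ≤ κ * r := h1.trans (h2.trans hle)
  exact le_of_mul_le_mul_right this hr

lemma volume_real_hull_le {T : Finset (E d)} {v : E d} (hv : v ∈ T) :
    volume.real (Δ T) ≤ Metric.diam (Δ T) ^ d * volume.real (Metric.ball (0 : E d) 1) := by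
  have h1 : (Δ T) ⊆ Metric.closedBall v (Metric.diam (Δ T)) := fun y hy =>
    dist_le_diam_hull T hy (subset_convexHull ℝ _ hv)
  have h2 := measureReal_mono h1 (μ := volume) (Metric.isBounded_closedBall.measure_lt_top.ne)
  rwa [Measure.addHaar_real_closedBall _ _ Metric.diam_nonneg, finrank_euclideanSpace_fin] at h2

lemma le_volume_real_hull {T : Finset (E d)} {κ : ℝ} (hκ : 0 < κ)
    (h : ∃ x : E d, ∃ r : ℝ, 0 < r ∧ Metric.closedBall x r ⊆ Δ T ∧ Metric.diam (Δ T) ≤ κ * r) :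
    (Metric.diam (Δ T) / κ) ^ d * volume.real (Metric.ball (0 : E d) 1) ≤ volume.real (Δ T) := by
  obtain ⟨x, r, hr, hsub, hle⟩ := h
  have h2 := measureReal_mono hsub (μ := volume) (volume_hull_lt_top T).ne
  rw [Measure.addHaar_real_closedBall _ _ hr.le, finrank_euclideanSpace_fin] at h2
  refine le_trans ?_ h2
  have h3 : Metric.diam (Δ T) / κ ≤ r := by rw [div_le_iff₀ hκ]; linarith
  have h4 : 0 ≤ Metric.diam (Δ T) / κ := div_nonneg Metric.diam_nonneg hκ.le
  gcongr

lemma volume_real_ball_pos : 0 < volume.real (Metric.ball (0 : E d) 1) :=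
  ENNReal.toReal_pos (Metric.measure_ball_pos _ _ one_pos).ne'
    Metric.isBounded_ball.measure_lt_top.ne

/-- The number of simplices that share a vertex is bounded in terms of the shape regularity. -/
lemma IsConformingPartition.card_star_le (hd : 0 < d) {κ : ℝ} (h : IsConformingPartition Ω 𝒯)
    (hκ : IsShapeRegular κ 𝒯) {ν : E d} (hν : ν ∈ vertices 𝒯) :
    ((star 𝒯 ν).card : ℝ) ≤ κ ^ d := by
  have hne : (star 𝒯 ν).Nonempty := by
    obtain ⟨T, hT, hνT⟩ := mem_vertices.1 hν
    exact ⟨T, mem_star.2 ⟨hT, hνT⟩⟩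
  have hmem : ∀ T ∈ star 𝒯 ν, T ∈ 𝒯 ∧ ν ∈ T := fun T hT => mem_star.1 hT
  -- Volumes are compared at the scale `ρ` of the smallest simplex, as sizes within the star are not
  -- yet known to be comparable. Shrinking a simplex of diameter `D` towards `ν` by the factor `ρ /
  -- D ≤ 1` keeps it inside itself and inside the ball of radius `ρ`, while its inscribed ball still
  -- has radius at least `ρ / κ`. These balls are almost disjoint, so there are at most `κ ^ d` of
  -- them.
  obtain ⟨T₁, hT₁, hmin⟩ := (star 𝒯 ν).exists_min_image (fun T => Metric.diam (Δ T)) hne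
  have hκ2 := h.two_le_shape hd hκ (hmem T₁ hT₁).1
  have hκ0 : 0 < κ := by linarith
  set ρ := Metric.diam (Δ T₁) with hρ
  have hρ0 : 0 < ρ := (h.isSimplex (hmem T₁ hT₁).1).diam_pos hd
  have key : ∀ T ∈ star 𝒯 ν, ∃ y, Metric.closedBall y (ρ / κ) ⊆ (Δ T) ∩ Metric.closedBall ν ρ := by
    intro T hT
    obtain ⟨x, r, hr, hsub, hle⟩ := hκ T (hmem T hT).1
    set D := Metric.diam (Δ T) with hD
    have hD0 : 0 < D := hρ0.trans_le (hmin T hT)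
    refine ⟨ν + (ρ / D) • (x - ν), fun z hz => ?_⟩
    have hx' : ν + (D / ρ) • (z - ν) ∈ Δ T := by
      apply hsub
      rw [mem_closedBall_iff_norm] at hz ⊢
      have e : ν + (D / ρ) • (z - ν) - x = (D / ρ) • (z - (ν + (ρ / D) • (x - ν))) := by
        rw [sub_add_eq_sub_sub, smul_sub _ (z - ν), smul_smul, div_mul_div_cancel₀ hρ0.ne',
          div_self hD0.ne', one_smul]
        abel
      rw [e, norm_smul, Real.norm_of_nonneg (by positivity)]
      calc D / ρ * _ ≤ D / ρ * (ρ / κ) := by gcongr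
        _ = D / κ := by field_simp
        _ ≤ r := by rw [div_le_iff₀ hκ0]; linarith
    have hν : ν ∈ Δ T := subset_convexHull ℝ _ (hmem T hT).2
    have ez : z = ν + (ρ / D) • ((ν + (D / ρ) • (z - ν)) - ν) := by
      rw [add_sub_cancel_left, smul_smul, div_mul_div_cancel₀ hD0.ne', div_self hρ0.ne', one_smul]
      abel
    constructor
    · rw [ez]
      exact (convex_convexHull ℝ _).add_smul_sub_mem hν hx'
        ⟨by positivity, (div_le_one hD0).2 (hmin T hT)⟩
    · have h1 := dist_le_diam_hull T hx' hν
      rw [dist_eq_norm] at h1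
      rw [mem_closedBall_iff_norm]
      nth_rw 1 [ez]
      rw [add_sub_cancel_left, norm_smul, Real.norm_of_nonneg (by positivity)]
      calc _ ≤ ρ / D * D := by gcongr
        _ = ρ := by field_simp
  choose! y hy using key
  have hsum : ∑ T ∈ star 𝒯 ν, volume (Metric.closedBall (y T) (ρ / κ)) ≤
      volume (Metric.closedBall ν ρ) := by
    rw [← measure_biUnion_finset₀]
    · exact measure_mono (iUnion₂_subset fun T hT => (hy T hT).trans inter_subset_right)
    · intro T hT T' hT' hne
      exact (h.aedisjoint (hmem T hT).1 (hmem T' hT').1 hne).mono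
        ((hy T hT).trans inter_subset_left) ((hy T' hT').trans inter_subset_left)
    · intro T _; exact measurableSet_closedBall.nullMeasurableSet
  have hreal : ((star 𝒯 ν).card : ℝ) * ((ρ / κ) ^ d * volume.real (Metric.ball (0 : E d) 1)) ≤
      ρ ^ d * volume.real (Metric.ball (0 : E d) 1) := by
    have h1 := ENNReal.toReal_mono (Metric.isBounded_closedBall.measure_lt_top.ne) hsum
    rw [ENNReal.toReal_sum (fun T _ => Metric.isBounded_closedBall.measure_lt_top.ne)] at h1
    change ∑ T ∈ star 𝒯 ν, volume.real (Metric.closedBall (y T) (ρ / κ)) ≤ volume.real _ at h1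
    rw [Finset.sum_congr rfl (fun T _ => Measure.addHaar_real_closedBall volume (y T)
      (by positivity : 0 ≤ ρ / κ)), Measure.addHaar_real_closedBall _ _ hρ0.le] at h1
    simpa using h1
  have hb := volume_real_ball_pos (d := d)
  rw [← mul_assoc] at hreal
  have h2 := le_of_mul_le_mul_right hreal hb
  rw [div_pow, ← mul_div_assoc, div_le_iff₀ (by positivity)] at h2
  have h3 : 0 < ρ ^ d := by positivity
  nlinarith

end Partition

/-! ### Face-connectivity of vertex stars -/

section Chains

variable {α : Type*}

/-- Propagation of a graded predicate along chains in a finite set: chains need not be longer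
than the cardinality of the set. -/
lemma propagate_of_reflTransGen (S : Finset α) (R : α → α → Prop) (hR : ∀ x y, R x y → R y x)
    {a b : α} (ha : a ∈ S)
    (h : Relation.ReflTransGen (fun x y => y ∈ S ∧ R x y) a b) (P : ℕ → α → Prop)
    (h0 : P 0 a) (hmono : ∀ n x, P n x → P (n + 1) x)
    (hstep : ∀ n, ∀ x ∈ S, ∀ y ∈ S, R x y → P n x → P (n + 1) y) : P S.card b := by
  classical
  let G : SimpleGraph S := SimpleGraph.fromRel fun x y => R x y
  have hadj : ∀ x y : S, G.Adj x y → R x y := by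
    intro x y hxy
    rcases ((SimpleGraph.fromRel_adj _ x y).1 hxy).2 with h | h
    exacts [h, hR _ _ h]
  have hreach : ∃ hb : b ∈ S, G.Reachable ⟨a, ha⟩ ⟨b, hb⟩ := by
    induction h with
    | refl => exact ⟨ha, SimpleGraph.Reachable.refl _⟩
    | @tail x y _ hxy ih =>
      obtain ⟨hx, hr⟩ := ih
      refine ⟨hxy.1, ?_⟩
      by_cases he : x = y
      · subst he; exact hr
      · refine hr.trans (SimpleGraph.Adj.reachable ?_)
        rw [SimpleGraph.fromRel_adj]
        exact ⟨by simpa using he, Or.inl hxy.2⟩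
  obtain ⟨hb, hr⟩ := hreach
  -- A path visits no element twice, so it has fewer than `S.card` steps; `hmono` raises the grade
  -- from its length to `S.card`.
  obtain ⟨p, hp⟩ := hr.exists_isPath
  have hlen : p.length < S.card := by simpa using hp.length_lt
  have hwalk : ∀ {u v : S} (q : G.Walk u v) (n : ℕ), P n u → P (n + q.length) v := by
    intro u v q
    induction q with
    | nil => intro n hn; simpa using hn
    | cons hadj' q ih =>
      intro n hn
      have := ih (n + 1) (hstep n _ (Subtype.coe_prop _) _ (Subtype.coe_prop _) (hadj _ _ hadj') hn)
      rw [SimpleGraph.Walk.length_cons]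
      convert this using 1
      ring
  have hfin := hwalk p 0 h0
  rw [zero_add] at hfin
  have hm : ∀ m k, P m b → P (m + k) b := by
    intro m k hm
    induction k with
    | zero => exact hm
    | succ k ih => exact hmono _ _ ih
  have := hm _ (S.card - p.length) hfin
  rwa [Nat.add_sub_cancel' hlen.le] at this

end Chains

section Connectivity

variable {d : ℕ} {Ω : Set (E d)} {𝒯 : Finset (Finset (E d))}

open Classical in
/-- Two simplices share a face of codimension at most one. -/
def FaceAdj (T T' : Finset (E d)) : Prop := d ≤ (T ∩ T').card

lemma FaceAdj.symm {T T' : Finset (E d)} (h : FaceAdj T T') : FaceAdj T' T := by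
  classical
  unfold FaceAdj at *
  convert h using 2
  ext; simp [and_comm]

lemma IsPolytopalDomain.isOpen (h : IsPolytopalDomain Ω) : IsOpen Ω := by
  rw [← h.interior_closure]; exact isOpen_interior

lemma IsPolytopalDomain.exists_connected_nhds (h : IsPolytopalDomain Ω) {x : E d}
    (hx : x ∈ closure Ω) {U : Set (E d)} (hU : U ∈ 𝓝 x) :
    ∃ V ∈ 𝓝 x, V ⊆ U ∧ IsConnected (Ω ∩ V) := by
  by_cases hxΩ : x ∈ Ω
  · obtain ⟨r, hr, hball⟩ := Metric.mem_nhds_iff.1 (Filter.inter_mem hU (h.isOpen.mem_nhds hxΩ))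
    refine ⟨Metric.ball x r, Metric.ball_mem_nhds x hr, hball.trans inter_subset_left, ?_⟩
    rw [inter_eq_right.2 (hball.trans inter_subset_right)]
    exact ⟨⟨x, Metric.mem_ball_self hr⟩, (convex_ball x r).isPreconnected⟩
  · exact h.locallyConnected x ⟨hx, by rwa [h.isOpen.interior_eq]⟩ U hU

/-- A generic segment between two simplices crosses codimension-one faces only. -/
lemma exists_faceAdj_of_ball (h : IsConformingPartition Ω 𝒯) {z : E d} {r : ℝ}
    (A B : Finset (Finset (E d))) (hA : A ⊆ 𝒯) (hB : B ⊆ 𝒯)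
    (hcov : Metric.ball z r ⊆ (⋃ T ∈ A, Δ T) ∪ ⋃ T ∈ B, Δ T)
    (hzA : ∃ T ∈ A, z ∈ Δ T) (hzB : ∃ T ∈ B, z ∈ Δ T) (hr : 0 < r) :
    ∃ T ∈ A, ∃ T' ∈ B, FaceAdj T T' := by
  classical
  obtain ⟨T₁, hT₁, hz₁⟩ := hzA
  obtain ⟨T₂, hT₂, hz₂⟩ := hzB
  by_contra hno
  push Not at hno
  have hcard : ∀ S ∈ A, ∀ S' ∈ B, (S ∩ S').card < d := fun S hS S' hS' => by
    have := hno S hS S' hS'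
    unfold FaceAdj at this
    omega
  have hfin : ∀ N : Set (E d), volume N = 0 → ∀ T ∈ 𝒯, z ∈ Δ T →
      ∃ x ∈ Metric.ball z r, x ∈ Δ T ∧ x ∉ N := by
    intro N hN T hT hzT
    have hne : (interior (Δ T) ∩ Metric.ball z r).Nonempty := by
      have hz : z ∈ closure (interior (Δ T)) := by
        rw [(convex_convexHull ℝ _).closure_interior_eq_closure_of_nonempty_interior
          (h.isSimplex hT).interior_nonempty]
        exact subset_closure hzT
      obtain ⟨y, hy, hy'⟩ := mem_closure_iff.1 hz _ Metric.isOpen_ball (Metric.mem_ball_self hr)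
      exact ⟨y, hy', hy⟩
    have hpos := (isOpen_interior.inter Metric.isOpen_ball).measure_pos volume hne
    by_contra hcon
    push Not at hcon
    refine hpos.ne' (measure_mono_null (fun x hx => ?_) hN)
    exact hcon x hx.2 (interior_subset hx.1)
  -- If no pair shares `d` vertices, each common face has at most `d - 1` vertices. The faces are
  -- null, and so are the affine spans of a face together with one extra point. Hence `x` can avoid
  -- all faces, and `y` all spans of `x` with a face.
  obtain ⟨x, hxb, hxT, hxN⟩ := hfin (⋃ S ∈ A, ⋃ S' ∈ B, Δ (S ∩ S'))
    ((measure_biUnion_null_iff A.countable_toSet).2 fun S hS =>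
      (measure_biUnion_null_iff B.countable_toSet).2 fun S' hS' =>
        measure_mono_null (convexHull_subset_affineSpan _)
          (volume_affineSpan_eq_zero (hcard S hS S' hS').le)) T₁ (hA hT₁) hz₁
  obtain ⟨y, hyb, hyT, hyN⟩ := hfin
    (⋃ S ∈ A, ⋃ S' ∈ B, (affineSpan ℝ ((insert x (S ∩ S') : Finset (E d)) : Set (E d)) : Set (E d)))
    ((measure_biUnion_null_iff A.countable_toSet).2 fun S hS =>
      (measure_biUnion_null_iff B.countable_toSet).2 fun S' hS' =>
        volume_affineSpan_eq_zero ((Finset.card_insert_le _ _).trans (hcard S hS S' hS')))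
    T₂ (hB hT₂) hz₂
  have hclosed : ∀ C : Finset (Finset (E d)), IsClosed (⋃ T ∈ C, Δ T) := fun C =>
    C.finite_toSet.isClosed_biUnion fun T _ => isClosed_hull T
  -- The segment from `x` to `y` must meet both closed unions at some `w`, which then lies on a
  -- common face. As `w ≠ x`, the point `y` is on the line through `x` and `w`, hence in an excluded
  -- span.
  obtain ⟨w, hw, hwA, hwB⟩ := isPreconnected_closed_iff.1 (convex_segment x y).isPreconnected
    _ _ (hclosed A) (hclosed B) (((convex_ball z r).segment_subset hxb hyb).trans hcov)
    ⟨x, left_mem_segment ℝ x y, mem_iUnion₂.2 ⟨T₁, hT₁, hxT⟩⟩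
    ⟨y, right_mem_segment ℝ x y, mem_iUnion₂.2 ⟨T₂, hT₂, hyT⟩⟩
  obtain ⟨S, hS, hwS⟩ := mem_iUnion₂.1 hwA
  obtain ⟨S', hS', hwS'⟩ := mem_iUnion₂.1 hwB
  have hwF : w ∈ Δ (S ∩ S') := by rw [← h.inter_eq_hull (hA hS) (hB hS')]; exact ⟨hwS, hwS'⟩
  have hwx : w ≠ x := by
    rintro rfl
    exact hxN (mem_iUnion₂.2 ⟨S, hS, mem_iUnion₂.2 ⟨S', hS', hwF⟩⟩)
  refine hyN (mem_iUnion₂.2 ⟨S, hS, mem_iUnion₂.2 ⟨S', hS', ?_⟩⟩)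
  rw [segment_eq_image_lineMap] at hw
  obtain ⟨t, ht, rfl⟩ := hw
  have ht0 : t ≠ 0 := by rintro rfl; simp at hwx
  have hxs : x ∈ affineSpan ℝ ((insert x (S ∩ S') : Finset (E d)) : Set (E d)) :=
    subset_affineSpan ℝ _ (by simp)
  have hws : AffineMap.lineMap x y t ∈
      affineSpan ℝ ((insert x (S ∩ S') : Finset (E d)) : Set (E d)) :=
    affineSpan_mono ℝ (by simp) (convexHull_subset_affineSpan _ hwF)
  have hy : y = AffineMap.lineMap x (AffineMap.lineMap x y t : E d) t⁻¹ := by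
    simp [AffineMap.lineMap_apply, smul_smul, inv_mul_cancel₀ ht0]
  rw [hy]
  exact AffineMap.lineMap_mem _ hxs hws

/-- Any two simplices that share a vertex are connected, within the star of that vertex, by a chain
of simplices that successively share faces. -/
lemma IsConformingPartition.star_connected (h : IsConformingPartition Ω 𝒯)
    (hΩ : IsPolytopalDomain Ω) {ν : E d} {T T' : Finset (E d)} (hT : T ∈ star 𝒯 ν)
    (hT' : T' ∈ star 𝒯 ν) :
    Relation.ReflTransGen (fun S S' => S' ∈ star 𝒯 ν ∧ FaceAdj S S') T T' := by
  classical
  by_contra hcon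
  set R := Relation.ReflTransGen (fun S S' => S' ∈ star 𝒯 ν ∧ FaceAdj S S') T with hR
  -- `A` collects the reachable simplices, `B` the others. Near `ν` only the star is present, so
  -- connectedness of `Ω ∩ V` makes the closed unions over `A` and `B` meet at a point of `Ω`. A
  -- small ball around that point is covered by `A` and `B`, which yields a face between them and
  -- contradicts the definition of `B`.
  set A := (star 𝒯 ν).filter (fun S => R S) with hA
  set B := (star 𝒯 ν).filter (fun S => ¬ R S) with hB
  have hνv : ν ∈ vertices 𝒯 := mem_vertices.2 ⟨T, (mem_star.1 hT).1, (mem_star.1 hT).2⟩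
  set U : Set (E d) := (⋃ S ∈ 𝒯.filter (ν ∉ ·), Δ S)ᶜ with hU
  have hUo : IsOpen U := by
    rw [hU, isOpen_compl_iff]
    exact (Finset.finite_toSet _).isClosed_biUnion fun T _ => isClosed_hull T
  have hνU : ν ∈ U := by
    intro hν
    obtain ⟨S, hS, hνS⟩ := mem_iUnion₂.1 hν
    rw [Finset.mem_filter] at hS
    exact hS.2 (h.mem_of_mem_hull hνv hS.1 hνS)
  have hcov : Ω ∩ U ⊆ (⋃ S ∈ A, Δ S) ∪ ⋃ S ∈ B, Δ S := by
    rintro x ⟨hxΩ, hxU⟩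
    obtain ⟨S, hS, hxS⟩ := h.exists_mem_hull (subset_closure hxΩ)
    have hνS : ν ∈ S := by
      by_contra hn
      exact hxU (mem_iUnion₂.2 ⟨S, Finset.mem_filter.2 ⟨hS, hn⟩, hxS⟩)
    have hSs : S ∈ star 𝒯 ν := mem_star.2 ⟨hS, hνS⟩
    by_cases hRS : R S
    · exact Or.inl (mem_iUnion₂.2 ⟨S, Finset.mem_filter.2 ⟨hSs, hRS⟩, hxS⟩)
    · exact Or.inr (mem_iUnion₂.2 ⟨S, Finset.mem_filter.2 ⟨hSs, hRS⟩, hxS⟩)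
  have hνcl : ν ∈ closure Ω :=
    h.hull_subset_closure (mem_star.1 hT).1 (subset_convexHull ℝ _ (mem_star.1 hT).2)
  obtain ⟨V, hV, hVU, hVc⟩ := hΩ.exists_connected_nhds hνcl (hUo.mem_nhds hνU)
  have hmeet : ∀ S ∈ star 𝒯 ν, ∃ x ∈ Ω ∩ V, x ∈ Δ S := by
    intro S hS
    have hz : ν ∈ closure (interior (Δ S)) := by
      rw [(convex_convexHull ℝ _).closure_interior_eq_closure_of_nonempty_interior
        (h.isSimplex (mem_star.1 hS).1).interior_nonempty]
      exact subset_closure (subset_convexHull ℝ _ (mem_star.1 hS).2)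
    obtain ⟨y, hy, hy'⟩ := mem_closure_iff_nhds.1 hz V hV
    exact ⟨y, ⟨h.interior_hull_subset hΩ.interior_closure (mem_star.1 hS).1 hy', hy⟩,
      interior_subset hy'⟩
  have hclosed : ∀ C : Finset (Finset (E d)), IsClosed (⋃ T ∈ C, Δ T) := fun C =>
    C.finite_toSet.isClosed_biUnion fun T _ => isClosed_hull T
  have hTA : T ∈ A := Finset.mem_filter.2 ⟨hT, Relation.ReflTransGen.refl⟩
  have hTB : T' ∈ B := Finset.mem_filter.2 ⟨hT', hcon⟩
  obtain ⟨x, hx, hxT⟩ := hmeet T hT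
  obtain ⟨y, hy, hyT⟩ := hmeet T' hT'
  obtain ⟨z, hz, hzA, hzB⟩ := isPreconnected_closed_iff.1 hVc.isPreconnected _ _ (hclosed A)
    (hclosed B) ((inter_subset_inter_right _ hVU).trans hcov)
    ⟨x, hx, mem_iUnion₂.2 ⟨T, hTA, hxT⟩⟩ ⟨y, hy, mem_iUnion₂.2 ⟨T', hTB, hyT⟩⟩
  obtain ⟨r, hr, hball⟩ := Metric.mem_nhds_iff.1
    (Filter.inter_mem (hΩ.isOpen.mem_nhds hz.1) (hUo.mem_nhds (hVU hz.2)))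
  have hsub : star 𝒯 ν ⊆ 𝒯 := fun S hS => (mem_star.1 hS).1
  obtain ⟨S, hS, S', hS', hadj⟩ := exists_faceAdj_of_ball h A B
    ((Finset.filter_subset _ _).trans hsub) ((Finset.filter_subset _ _).trans hsub)
    (hball.trans hcov) (by simpa using hzA) (by simpa using hzB) hr
  rw [Finset.mem_filter] at hS hS'
  exact hS'.2 (hS.2.tail ⟨hS'.1, hadj⟩)

/-- The constant in the comparison of diameters of simplices that share a face. -/
def adjConst (κ K : ℝ) : ℝ := 1 + |κ| + |κ * K|

lemma one_le_adjConst (κ K : ℝ) : 1 ≤ adjConst κ K := by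
  unfold adjConst; have := abs_nonneg κ; have := abs_nonneg (κ * K); linarith

lemma diam_le_of_faceAdj (hd : 0 < d) {κ K : ℝ} (h : IsConformingPartition Ω 𝒯)
    (hκ : IsShapeRegular κ 𝒯) (hK : d = 1 → IsKMesh K 𝒯) {T T' : Finset (E d)} (hT : T ∈ 𝒯)
    (hT' : T' ∈ 𝒯) (hadj : FaceAdj T T') :
    Metric.diam (Δ T) ≤ adjConst κ K * Metric.diam (Δ T') := by
  classical
  have hκ2 := h.two_le_shape hd hκ hT
  have hκ0 : 0 < κ := by linarith
  have hD' : 0 ≤ Metric.diam (Δ T') := Metric.diam_nonneg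
  -- In dimension one a common face is a single point and carries no length; sizes are compared
  -- through the K-mesh property.
  rcases (show d = 1 ∨ 2 ≤ d by omega) with h1 | h2
  · subst h1
    unfold FaceAdj at hadj
    obtain ⟨v, hv⟩ : (T ∩ T').Nonempty := Finset.card_pos.1 hadj
    rw [Finset.mem_inter] at hv
    have hm := hK rfl T hT T' hT'
      ⟨v, subset_convexHull ℝ _ hv.1, subset_convexHull ℝ _ hv.2⟩
    simp only [meshSize, Nat.cast_one, div_one, Real.rpow_one] at hm
    have l1 := le_volume_real_hull hκ0 (hκ T hT)
    have l2 := volume_real_hull_le hv.2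
    simp only [pow_one] at l1 l2
    have hb := volume_real_ball_pos (d := 1)
    set b₁ := volume.real (Metric.ball (0 : E 1) 1)
    have l3 : Metric.diam (Δ T) / κ * b₁ ≤ |K| * Metric.diam (Δ T') * b₁ := by
      calc _ ≤ _ := l1
        _ ≤ _ := hm
        _ ≤ |K| * volume.real (Δ T') := by gcongr; exact le_abs_self K
        _ ≤ |K| * (Metric.diam (Δ T') * b₁) := by gcongr
        _ = _ := by ring
    have l4 := le_of_mul_le_mul_right l3 hb
    rw [div_le_iff₀ hκ0] at l4
    have e : |κ * K| = κ * |K| := by rw [abs_mul, abs_of_pos hκ0]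
    unfold adjConst
    rw [e]
    have := abs_nonneg κ
    nlinarith [mul_nonneg this hD']
  -- For `d ≥ 2` a common face contains an edge, of length at least `2 r` seen from `T` and at most
  -- the diameter of `T'`.
  · unfold FaceAdj at hadj
    obtain ⟨v, hv, w, hw, hne⟩ := Finset.one_lt_card.1 (show 1 < (T ∩ T').card by omega)
    rw [Finset.mem_inter] at hv hw
    obtain ⟨x, r, hr, hsub, hle⟩ := hκ T hT
    have l1 := (h.isSimplex hT).two_mul_inradius_le_dist hr hsub hv.1 hw.1 hne
    have l2 := dist_le_diam_hull T' (subset_convexHull ℝ _ hv.2) (subset_convexHull ℝ _ hw.2)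
    have l3 : r ≤ Metric.diam (Δ T') := by linarith
    calc _ ≤ κ * r := hle
      _ ≤ κ * Metric.diam (Δ T') := by gcongr
      _ ≤ _ := by
        gcongr
        unfold adjConst
        have := le_abs_self κ; have := abs_nonneg (κ * K); linarith

/-- A bound on the number of simplices in a star. -/
def starConst (d : ℕ) (κ : ℝ) : ℕ := ⌊κ ^ d⌋₊

lemma IsConformingPartition.card_star_le_starConst (hd : 0 < d) {κ : ℝ}
    (h : IsConformingPartition Ω 𝒯) (hκ : IsShapeRegular κ 𝒯) {ν : E d} (hν : ν ∈ vertices 𝒯) :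
    (star 𝒯 ν).card ≤ starConst d κ := Nat.le_floor (h.card_star_le hd hκ hν)

/-- Simplices that share a vertex have comparable diameters. -/
lemma diam_le_of_mem_star (hd : 0 < d) {κ K : ℝ} (hΩ : IsPolytopalDomain Ω)
    (h : IsConformingPartition Ω 𝒯) (hκ : IsShapeRegular κ 𝒯) (hK : d = 1 → IsKMesh K 𝒯)
    {ν : E d} {T T' : Finset (E d)} (hT : T ∈ star 𝒯 ν) (hT' : T' ∈ star 𝒯 ν) :
    Metric.diam (Δ T) ≤ adjConst κ K ^ starConst d κ * Metric.diam (Δ T') := by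
  have hC := one_le_adjConst κ K
  have hν : ν ∈ vertices 𝒯 := mem_vertices.2 ⟨T, (mem_star.1 hT).1, (mem_star.1 hT).2⟩
  have hp := propagate_of_reflTransGen (star 𝒯 ν) FaceAdj (fun _ _ => FaceAdj.symm) hT
    (h.star_connected hΩ hT hT')
    (fun n S => Metric.diam (Δ T) ≤ adjConst κ K ^ n * Metric.diam (Δ S)) (by simp)
    (fun n S hS => hS.trans (by
      have : (0 : ℝ) ≤ Metric.diam (Δ S) := Metric.diam_nonneg
      gcongr
      exact n.le_succ))
    (fun n S hS S' hS' hadj hn => by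
      calc _ ≤ _ := hn
        _ ≤ adjConst κ K ^ n * (adjConst κ K * Metric.diam (Δ S')) := by
          gcongr
          exact diam_le_of_faceAdj hd h hκ hK (mem_star.1 hS).1 (mem_star.1 hS').1 hadj
        _ = _ := by ring)
  refine hp.trans ?_
  have : (0 : ℝ) ≤ Metric.diam (Δ T') := Metric.diam_nonneg
  gcongr
  exact h.card_star_le_starConst hd hκ hν

end Connectivity

/-! ### Poincaré type inequalities on simplices -/

section Poincare

variable {d : ℕ}

lemma sq_lintegral_le {α : Type*} [MeasurableSpace α] {μ : Measure α} [IsProbabilityMeasure μ]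
    {f : α → ℝ} (hf : AEStronglyMeasurable f μ) :
    (∫⁻ x, ‖f x‖ₑ ∂μ) ^ 2 ≤ ∫⁻ x, ‖f x‖ₑ ^ 2 ∂μ := by
  have h := eLpNorm_le_eLpNorm_of_exponent_le (μ := μ) (p := 1) (q := (2 : ℝ≥0)) (by norm_num) hf
  rw [eLpNorm_one_eq_lintegral_enorm] at h
  have h2 := eLpNorm_nnreal_pow_eq_lintegral (f := f) (μ := μ) (p := 2) two_ne_zero
  have h3 := pow_le_pow_left' h 2
  refine h3.trans (le_of_eq ?_)
  norm_num at h2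
  exact_mod_cast h2

/-- The increment of a smooth function along a path. -/
lemma enorm_sub_sq_le_lintegral_path {u : E d → ℝ} (hu : ContDiff ℝ 1 u) {c c' : ℝ → E d}
    (hc : ∀ s, HasDerivAt c (c' s) s) (hc' : Continuous c') :
    ‖u (c 1) - u (c 0)‖ₑ ^ 2 ≤
      ∫⁻ s in Ioc (0 : ℝ) 1, ‖c' s‖ₑ ^ 2 * ‖fderiv ℝ u (c s)‖ₑ ^ 2 := by
  have hcc : Continuous c := continuous_iff_continuousAt.2 fun s => (hc s).continuousAt
  have hder : ∀ s, HasDerivAt (fun s => u (c s)) (fderiv ℝ u (c s) (c' s)) s := fun s =>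
    ((hu.differentiable one_ne_zero).differentiableAt.hasFDerivAt).comp_hasDerivAt s (hc s)
  have hcont : Continuous fun s => fderiv ℝ u (c s) (c' s) :=
    ((hu.continuous_fderiv one_ne_zero).comp hcc).clm_apply hc'
  have h1 := intervalIntegral.integral_eq_sub_of_hasDerivAt (a := 0) (b := 1)
    (fun s _ => hder s) (hcont.intervalIntegrable 0 1)
  rw [← h1, intervalIntegral.integral_of_le zero_le_one]
  have : IsProbabilityMeasure (volume.restrict (Ioc (0 : ℝ) 1)) := ⟨by simp⟩
  calc _ ≤ (∫⁻ s in Ioc (0 : ℝ) 1, ‖fderiv ℝ u (c s) (c' s)‖ₑ) ^ 2 := by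
        gcongr; exact enorm_integral_le_lintegral_enorm _
    _ ≤ ∫⁻ s in Ioc (0 : ℝ) 1, ‖fderiv ℝ u (c s) (c' s)‖ₑ ^ 2 :=
        sq_lintegral_le hcont.aestronglyMeasurable
    _ ≤ _ := by
        gcongr with s
        rw [← mul_pow, mul_comm]
        gcongr
        exact (fderiv ℝ u (c s)).le_opENorm _

/-- Only an upper bound is needed: `g` is extended by zero outside `S'` and the integral enlarged to
the whole space, so the image of `S` need not be identified. -/
lemma setLIntegral_comp_affine_le {L : E d →ₗ[ℝ] E d} (hL : LinearMap.det L ≠ 0) (a : E d)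
    {S S' : Set (E d)} (hS' : MeasurableSet S') (hS : MeasurableSet S)
    (h : ∀ x ∈ S, L x + a ∈ S') {g : E d → ℝ≥0∞} (hg : Measurable g) :
    ∫⁻ x in S, g (L x + a) ≤ ENNReal.ofReal |(LinearMap.det L)⁻¹| * ∫⁻ x in S', g x := by
  have hLm : Measurable L := (LinearMap.continuous_of_finiteDimensional L).measurable
  have hgi : Measurable (S'.indicator g) := hg.indicator hS'
  calc ∫⁻ x in S, g (L x + a) ≤ ∫⁻ x in S, S'.indicator g (L x + a) := by
        refine setLIntegral_mono' hS fun x hx => ?_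
        rw [indicator_of_mem (h x hx)]
    _ ≤ ∫⁻ x, S'.indicator g (L x + a) := setLIntegral_le_lintegral _ _
    _ = ∫⁻ y, S'.indicator g (y + a) ∂(Measure.map L volume) :=
        (lintegral_map (hgi.comp (measurable_add_const a)) hLm).symm
    _ = ENNReal.ofReal |(LinearMap.det L)⁻¹| * ∫⁻ y, S'.indicator g (y + a) := by
        rw [Measure.map_linearMap_addHaar_eq_smul_addHaar _ hL, lintegral_smul_measure]; rfl
    _ = _ := by rw [lintegral_add_right_eq_self, lintegral_indicator hS']

/-- Change of variables for the shears and compressions `x ↦ x + f x • v`. -/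
lemma setLIntegral_comp_shear_le (f : E d →ᵃ[ℝ] ℝ) (v : E d) (hδ : 1 + f.linear v ≠ 0)
    {S S' : Set (E d)} (hS' : MeasurableSet S') (hS : MeasurableSet S)
    (h : ∀ x ∈ S, x + f x • v ∈ S') {g : E d → ℝ≥0∞} (hg : Measurable g) :
    ∫⁻ x in S, g (x + f x • v) ≤
      ENNReal.ofReal |(1 + f.linear v)⁻¹| * ∫⁻ x in S', g x := by
  -- The linear part is a transvection, whose determinant is `1 + f.linear v`.
  have hform : ∀ x, x + f x • v = LinearMap.transvection f.linear v x + f 0 • v := by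
    intro x
    rw [LinearMap.transvection.apply, add_assoc, ← add_smul]
    congr 2
    have := congrFun f.decomp x
    simpa using this
  have hdet : LinearMap.det (LinearMap.transvection f.linear v) = 1 + f.linear v :=
    LinearMap.transvection.det _ _
  simp only [hform] at h ⊢
  rw [← hdet] at hδ ⊢
  exact setLIntegral_comp_affine_le hδ _ hS' hS h hg

lemma volume_image_shear (f : E d →ᵃ[ℝ] ℝ) (v : E d) (S : Set (E d)) :
    volume ((fun x => x + f x • v) '' S) = ENNReal.ofReal |1 + f.linear v| * volume S := by
  have hform : (fun x => x + f x • v) =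
      (fun y => y + f 0 • v) ∘ LinearMap.transvection f.linear v := by
    ext1 x
    rw [Function.comp_apply, LinearMap.transvection.apply, add_assoc, ← add_smul]
    congr 2
    have := congrFun f.decomp x
    simpa using this
  rw [hform, image_comp, image_add_right, measure_preimage_add_right,
    Measure.addHaar_image_linearMap, LinearMap.transvection.det]

/-- Differences are integrated along segments and the order of integration is exchanged. For `t ≥
1/2` the homothety `x ↦ y + t (x - y)` has Jacobian `t ^ d`, which costs at most `2 ^ d`; for `t ≤
1/2` the roles of `x` and `y` are swapped. -/
lemma lintegral_pairs_le {u : E d → ℝ} (hu : ContDiff ℝ 1 u) (T : Finset (E d)) :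
    ∫⁻ y in Δ T, ∫⁻ x in Δ T, ‖u x - u y‖ₑ ^ 2 ≤
      volume (Δ T) * (2 ^ d * (ENNReal.ofReal (Metric.diam (Δ T)) ^ 2 *
        ∫⁻ x in Δ T, ‖fderiv ℝ u x‖ₑ ^ 2)) := by
  set h := ENNReal.ofReal (Metric.diam (Δ T)) with hh
  set G := ∫⁻ x in Δ T, ‖fderiv ℝ u x‖ₑ ^ 2 with hG
  have hm := measurableSet_hull T
  have hfm : Measurable fun x => ‖fderiv ℝ u x‖ₑ ^ 2 :=
    (hu.continuous_fderiv one_ne_zero).enorm.measurable.pow_const 2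
  have hstep : ∀ t : ℝ, 2⁻¹ ≤ t → t ≤ 1 → ∀ y ∈ Δ T,
      ∫⁻ x in Δ T, ‖fderiv ℝ u (y + t • (x - y))‖ₑ ^ 2 ≤ 2 ^ d * G := by
    intro t ht ht1 y hy
    have ht0 : 0 < t := by linarith [show (0 : ℝ) < 2⁻¹ by norm_num]
    have hdet : LinearMap.det (t • (LinearMap.id : E d →ₗ[ℝ] E d)) = t ^ d := by simp
    have e : ∀ x, y + t • (x - y) = (t • (LinearMap.id : E d →ₗ[ℝ] E d)) x + (y - t • y) := by
      intro x; simp only [LinearMap.smul_apply, LinearMap.id_apply, smul_sub]; abel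
    have h1 := setLIntegral_comp_affine_le (L := t • (LinearMap.id : E d →ₗ[ℝ] E d))
      (by rw [hdet]; positivity) (y - t • y) hm hm (fun x hx => by
        rw [← e]; exact (convex_convexHull ℝ _).add_smul_sub_mem hy hx ⟨ht0.le, ht1⟩) hfm
    simp only [← e] at h1
    refine h1.trans ?_
    gcongr
    rw [hdet, abs_of_pos (by positivity), ← inv_pow]
    calc ENNReal.ofReal (t⁻¹ ^ d) ≤ ENNReal.ofReal (2 ^ d) := by
          apply ENNReal.ofReal_le_ofReal
          gcongr
          rw [inv_le_comm₀ ht0 two_pos]; exact ht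
      _ = 2 ^ d := by rw [ENNReal.ofReal_pow zero_le_two]; simp
  have hpair : ∀ y ∈ Δ T, ∀ x ∈ Δ T, ‖u x - u y‖ₑ ^ 2 ≤
      ∫⁻ t in Ioc (0 : ℝ) 1, h ^ 2 * ‖fderiv ℝ u (y + t • (x - y))‖ₑ ^ 2 := by
    intro y hy x hx
    have h1 := enorm_sub_sq_le_lintegral_path hu (c := fun t => y + t • (x - y))
      (c' := fun _ => x - y) (fun t => by
        simpa using ((hasDerivAt_id t).smul_const (x - y)).const_add y) continuous_const
    simp only [one_smul, zero_smul, add_zero, add_sub_cancel] at h1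
    refine h1.trans ?_
    gcongr
    rw [hh, ← ofReal_norm, ← dist_eq_norm]
    exact ENNReal.ofReal_le_ofReal (dist_le_diam_hull T hx hy)
  have hF : Continuous fun p : (ℝ × E d) × E d =>
      h ^ 2 * ‖fderiv ℝ u (p.1.2 + p.1.1 • (p.2 - p.1.2))‖ₑ ^ 2 := by
    refine ENNReal.continuous_const_mul (by simp [hh]) |>.comp ?_
    refine (ENNReal.continuous_pow 2).comp (Continuous.enorm ?_)
    exact (hu.continuous_fderiv one_ne_zero).comp (by fun_prop)
  have hslice : ∀ t ∈ Ioc (0 : ℝ) 1, ∫⁻ y in Δ T, ∫⁻ x in Δ T,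
      h ^ 2 * ‖fderiv ℝ u (y + t • (x - y))‖ₑ ^ 2 ≤ volume (Δ T) * (2 ^ d * (h ^ 2 * G)) := by
    intro t ht
    have hmain : ∀ t : ℝ, 2⁻¹ ≤ t → t ≤ 1 → ∫⁻ y in Δ T, ∫⁻ x in Δ T,
        h ^ 2 * ‖fderiv ℝ u (y + t • (x - y))‖ₑ ^ 2 ≤ volume (Δ T) * (2 ^ d * (h ^ 2 * G)) := by
      intro t ht ht1
      calc _ ≤ ∫⁻ y in Δ T, 2 ^ d * (h ^ 2 * G) := by
            refine setLIntegral_mono' hm fun y hy => ?_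
            rw [lintegral_const_mul' _ _ (by simp [hh])]
            calc _ ≤ h ^ 2 * (2 ^ d * G) := by gcongr; exact hstep t ht ht1 y hy
              _ = _ := by ring
        _ = _ := by simp [mul_comm]
    rcases le_total 2⁻¹ t with h1 | h1
    · exact hmain t h1 ht.2
    · rw [lintegral_lintegral_swap]
      · have h2 := hmain (1 - t) (by norm_num at h1 ⊢; linarith) (by linarith [ht.1])
        refine le_trans (le_of_eq ?_) h2
        refine lintegral_congr fun x => lintegral_congr fun y => ?_
        congr 4
        module
      · exact (hF.comp (f := fun p : E d × E d => ((t, p.1), p.2)) (by fun_prop)).aemeasurable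
  calc _ ≤ ∫⁻ y in Δ T, ∫⁻ x in Δ T, ∫⁻ t in Ioc (0 : ℝ) 1,
          h ^ 2 * ‖fderiv ℝ u (y + t • (x - y))‖ₑ ^ 2 :=
        setLIntegral_mono' hm fun y hy => setLIntegral_mono' hm fun x hx => hpair y hy x hx
    _ = ∫⁻ y in Δ T, ∫⁻ t in Ioc (0 : ℝ) 1, ∫⁻ x in Δ T,
          h ^ 2 * ‖fderiv ℝ u (y + t • (x - y))‖ₑ ^ 2 := by
        refine lintegral_congr fun y => lintegral_lintegral_swap ?_
        exact (hF.comp (f := fun p : E d × ℝ => ((p.2, y), p.1)) (by fun_prop)).aemeasurable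
    _ = ∫⁻ t in Ioc (0 : ℝ) 1, ∫⁻ y in Δ T, ∫⁻ x in Δ T,
          h ^ 2 * ‖fderiv ℝ u (y + t • (x - y))‖ₑ ^ 2 := by
        refine lintegral_lintegral_swap ?_
        refine Measurable.aemeasurable ?_
        exact (Measurable.lintegral_prod_right' (f := fun p : (E d × ℝ) × E d =>
          h ^ 2 * ‖fderiv ℝ u (p.1.1 + p.1.2 • (p.2 - p.1.1))‖ₑ ^ 2)
          (hF.comp (f := fun p : (E d × ℝ) × E d => ((p.1.2, p.1.1), p.2)) (by fun_prop)).measurable)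
    _ ≤ ∫⁻ t in Ioc (0 : ℝ) 1, volume (Δ T) * (2 ^ d * (h ^ 2 * G)) :=
        setLIntegral_mono' measurableSet_Ioc hslice
    _ = _ := by simp

/-- The projection of a simplex onto the face opposite to the vertex `q`, in the direction of the
edge from `q` to `o`. -/
def faceProj (T : Finset (E d)) (q o x : E d) : E d := x + bary T q x • (o - q)

lemma bary_add_smul_sub (T : Finset (E d)) (w q o x : E d) (t : ℝ) :
    bary T w (x + t • (o - q)) = bary T w x + t * (bary T w o - bary T w q) := by
  have h1 := (bary T w).map_vadd x (t • (o - q))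
  have h2 := (bary T w).linearMap_vsub o q
  rw [vsub_eq_sub, vsub_eq_sub] at h2
  rw [vadd_eq_add, vadd_eq_add, map_smul, h2, smul_eq_mul] at h1
  rw [add_comm x, h1, add_comm]

/-- The barycentric weight of `q` is transferred to `o`, all other weights being kept. -/
lemma IsSimplex.faceProj_mem [DecidableEq (E d)] {T : Finset (E d)} (hT : IsSimplex T) {q o : E d}
    (hq : q ∈ T) (ho : o ∈ T) (hne : o ≠ q) {x : E d} (hx : x ∈ Δ T) :
    faceProj T q o x ∈ Δ (T.erase q) := by
  have key : ∀ w, bary T w (faceProj T q o x) =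
      bary T w x + bary T q x * (bary T w o - bary T w q) := fun w => bary_add_smul_sub _ _ _ _ _ _
  rw [hT.mem_subface (Finset.erase_subset _ _)]
  refine ⟨hT.mem_hull.2 fun w => ?_, fun w hw => ?_⟩
  · rw [key]
    by_cases hwq : w = q
    · subst hwq; rw [hT.bary_self hq, hT.bary_of_ne ho hne]; linarith
    · rw [hT.bary_of_ne hq (Ne.symm hwq)]
      by_cases hwo : w = o
      · subst hwo; rw [hT.bary_self ho]
        linarith [hT.bary_nonneg hx w, hT.bary_nonneg hx q]
      · rw [hT.bary_of_ne ho (Ne.symm hwo)]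
        linarith [hT.bary_nonneg hx w]
  · by_cases hwq : w = q
    · subst hwq; rw [key, hT.bary_self hq, hT.bary_of_ne ho hne]; ring
    · exact bary_of_notMem (fun h => hw (Finset.mem_erase.2 ⟨hwq, h⟩)) _

/-- Takes the place of a trace inequality: values on the face enter only through composition with a
projection of the full simplex, so no surface measure occurs. -/
lemma lintegral_sub_faceProj_le {u : E d → ℝ} (hu : ContDiff ℝ 1 u) {T : Finset (E d)}
    (hT : IsSimplex T) {q o : E d} (hq : q ∈ T) (ho : o ∈ T) (hne : o ≠ q) :
    ∫⁻ x in Δ T, ‖u x - u (faceProj T q o x)‖ₑ ^ 2 ≤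
      4 * (ENNReal.ofReal (Metric.diam (Δ T)) ^ 2 * ∫⁻ x in Δ T, ‖fderiv ℝ u x‖ₑ ^ 2) := by
  classical
  set h := ENNReal.ofReal (Metric.diam (Δ T)) with hh
  set G := ∫⁻ x in Δ T, ‖fderiv ℝ u x‖ₑ ^ 2 with hG
  have hm := measurableSet_hull T
  have hfm : Measurable fun x => ‖fderiv ℝ u x‖ₑ ^ 2 :=
    (hu.continuous_fderiv one_ne_zero).enorm.measurable.pow_const 2
  -- The quadratic parameter is essential. The projection collapses the simplex and `p s` has
  -- Jacobian `s ^ 2`; the squared speed, at most `4 * s ^ 2` times the squared diameter, cancels it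
  -- exactly. With a linear parameter the resulting bound would be `∫ ds / s`.
  let p : ℝ → E d → E d := fun s x => x + bary T q x • ((1 - s ^ 2) • (o - q))
  have hpath : ∀ x ∈ Δ T, ‖u x - u (faceProj T q o x)‖ₑ ^ 2 ≤
      ∫⁻ s in Ioc (0 : ℝ) 1, (ENNReal.ofReal (4 * s ^ 2) * h ^ 2) * ‖fderiv ℝ u (p s x)‖ₑ ^ 2 := by
    intro x hx
    have h1 := enorm_sub_sq_le_lintegral_path hu (c := fun s => p s x)
      (c' := fun s => bary T q x • ((-(2 * s)) • (o - q))) (fun s => by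
        have h2 : HasDerivAt (fun s : ℝ => 1 - s ^ 2) (-(2 * s)) s := by
          simpa using ((hasDerivAt_id s).pow 2).const_sub 1
        exact ((h2.smul_const (o - q)).const_smul (bary T q x)).const_add x) (by fun_prop)
    have e1 : p 1 x = x := by simp [p]
    have e0 : p 0 x = faceProj T q o x := by simp [p, faceProj]
    rw [e1, e0] at h1
    refine h1.trans (setLIntegral_mono' measurableSet_Ioc fun s hs => ?_)
    gcongr
    rw [hh, ← ofReal_norm, ← ENNReal.ofReal_pow (norm_nonneg _),
      ← ENNReal.ofReal_pow Metric.diam_nonneg, ← ENNReal.ofReal_mul (by positivity)]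
    apply ENNReal.ofReal_le_ofReal
    rw [norm_smul, norm_smul, mul_pow, mul_pow, Real.norm_eq_abs, Real.norm_eq_abs, sq_abs, sq_abs,
      ← dist_eq_norm]
    have b0 := hT.bary_nonneg hx q
    have b1 := hT.bary_le_one hx q
    have hdist := dist_le_diam_hull T (subset_convexHull ℝ _ ho) (subset_convexHull ℝ _ hq)
    calc bary T q x ^ 2 * ((-(2 * s)) ^ 2 * dist o q ^ 2)
        ≤ 1 ^ 2 * ((-(2 * s)) ^ 2 * Metric.diam (Δ T) ^ 2) := by gcongr
      _ = _ := by ring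
  have hslice : ∀ s ∈ Ioc (0 : ℝ) 1, ∫⁻ x in Δ T, (ENNReal.ofReal (4 * s ^ 2) * h ^ 2) *
      ‖fderiv ℝ u (p s x)‖ₑ ^ 2 ≤ 4 * (h ^ 2 * G) := by
    intro s hs
    have hs0 : 0 < s := hs.1
    have hlin : 1 + (bary T q).linear ((1 - s ^ 2) • (o - q)) = s ^ 2 := by
      have h2 := (bary T q).linearMap_vsub o q
      rw [vsub_eq_sub, vsub_eq_sub, hT.bary_self hq, hT.bary_of_ne ho hne] at h2
      rw [map_smul, h2, smul_eq_mul]; ring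
    have h1 := setLIntegral_comp_shear_le (bary T q) ((1 - s ^ 2) • (o - q))
      (by rw [hlin]; positivity) hm hm (fun x hx => by
        have e : x + bary T q x • ((1 - s ^ 2) • (o - q)) =
            x + (1 - s ^ 2) • (faceProj T q o x - x) := by
          simp only [faceProj]; module
        rw [e]
        refine (convex_convexHull ℝ _).add_smul_sub_mem hx ?_ ⟨?_, ?_⟩
        · exact convexHull_mono (by simp) (hT.faceProj_mem hq ho hne hx)
        · nlinarith [hs.1, hs.2]
        · nlinarith [hs.1]) hfm
    rw [hlin] at h1
    rw [lintegral_const_mul' _ _ (ENNReal.mul_ne_top ENNReal.ofReal_ne_top (by simp [hh]))]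
    calc _ ≤ (ENNReal.ofReal (4 * s ^ 2) * h ^ 2) * (ENNReal.ofReal |(s ^ 2)⁻¹| * G) := by
          gcongr
      _ = (ENNReal.ofReal (4 * s ^ 2) * ENNReal.ofReal |(s ^ 2)⁻¹|) * (h ^ 2 * G) := by ring
      _ = _ := by
          rw [← ENNReal.ofReal_mul (by positivity), abs_of_pos (by positivity), mul_assoc,
            mul_inv_cancel₀ (by positivity)]
          simp
  calc _ ≤ ∫⁻ x in Δ T, ∫⁻ s in Ioc (0 : ℝ) 1,
          (ENNReal.ofReal (4 * s ^ 2) * h ^ 2) * ‖fderiv ℝ u (p s x)‖ₑ ^ 2 :=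
        setLIntegral_mono' hm hpath
    _ = ∫⁻ s in Ioc (0 : ℝ) 1, ∫⁻ x in Δ T,
          (ENNReal.ofReal (4 * s ^ 2) * h ^ 2) * ‖fderiv ℝ u (p s x)‖ₑ ^ 2 := by
        refine lintegral_lintegral_swap (Measurable.aemeasurable ?_)
        change Measurable fun z : E d × ℝ =>
          (ENNReal.ofReal (4 * z.2 ^ 2) * h ^ 2) * ‖fderiv ℝ u (p z.2 z.1)‖ₑ ^ 2
        have m1 : Measurable fun z : E d × ℝ => ENNReal.ofReal (4 * z.2 ^ 2) * h ^ 2 :=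
          ((Continuous.measurable (by fun_prop)).ennreal_ofReal).mul_const _
        have m2 : Measurable fun z : E d × ℝ => ‖fderiv ℝ u (p z.2 z.1)‖ₑ ^ 2 := by
          refine (Continuous.enorm ?_).measurable.pow_const 2
          refine (hu.continuous_fderiv one_ne_zero).comp ?_
          have := continuous_bary T q
          simp only [p]
          fun_prop
        exact m1.mul m2
    _ ≤ ∫⁻ s in Ioc (0 : ℝ) 1, 4 * (h ^ 2 * G) :=
        setLIntegral_mono' measurableSet_Ioc hslice
    _ = _ := by simp

end Poincare

/-! ### Poincaré and Friedrichs inequalities on a simplex; means across a common face. -/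

section PoincareReal

variable {d : ℕ}

/-- The squared `L₂`-norm of the gradient on a simplex. -/
def energy (u : E d → ℝ) (T : Finset (E d)) : ℝ := ∫ x in Δ T, ‖fderiv ℝ u x‖ ^ 2

/-- The mean value of the squared gradient, scaled with the squared diameter. -/
def osc (u : E d → ℝ) (T : Finset (E d)) : ℝ :=
  Metric.diam (Δ T) ^ 2 * energy u T / volume.real (Δ T)

lemma energy_nonneg (u : E d → ℝ) (T : Finset (E d)) : 0 ≤ energy u T :=
  integral_nonneg fun _ => by positivity

lemma osc_nonneg (u : E d → ℝ) (T : Finset (E d)) : 0 ≤ osc u T :=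
  div_nonneg (mul_nonneg (sq_nonneg _) (energy_nonneg u T)) measureReal_nonneg

lemma lintegral_enorm_sq_hull {F : Type*} [NormedAddCommGroup F] {f : E d → F}
    (hf : Continuous f) (T : Finset (E d)) :
    ∫⁻ x in Δ T, ‖f x‖ₑ ^ 2 = ENNReal.ofReal (∫ x in Δ T, ‖f x‖ ^ 2) := by
  rw [ofReal_integral_eq_lintegral_ofReal]
  · refine lintegral_congr fun x => ?_
    rw [ENNReal.ofReal_pow (norm_nonneg _), ofReal_norm]
  · exact ((hf.norm.pow 2).continuousOn).integrableOn_compact (isCompact_hull T)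
  · exact Filter.Eventually.of_forall fun x => by positivity

lemma ofReal_energy {u : E d → ℝ} (hu : ContDiff ℝ 1 u) (T : Finset (E d)) :
    ∫⁻ x in Δ T, ‖fderiv ℝ u x‖ₑ ^ 2 = ENNReal.ofReal (energy u T) :=
  lintegral_enorm_sq_hull (hu.continuous_fderiv one_ne_zero) T

lemma enorm_sq_eq (r : ℝ) : ‖r‖ₑ ^ 2 = ENNReal.ofReal (r ^ 2) := by
  rw [← ofReal_norm, ← ENNReal.ofReal_pow (norm_nonneg _), Real.norm_eq_abs, sq_abs]

lemma diam_mul_energy {u : E d → ℝ} (hu : ContDiff ℝ 1 u) (T : Finset (E d)) :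
    ENNReal.ofReal (Metric.diam (Δ T)) ^ 2 * ∫⁻ x in Δ T, ‖fderiv ℝ u x‖ₑ ^ 2 =
      ENNReal.ofReal (Metric.diam (Δ T) ^ 2 * energy u T) := by
  rw [ofReal_energy hu, ENNReal.ofReal_mul (by positivity), ENNReal.ofReal_pow Metric.diam_nonneg]

lemma IsSimplex.volume_real_pos {T : Finset (E d)} (hT : IsSimplex T) : 0 < volume.real (Δ T) :=
  ENNReal.toReal_pos hT.volume_pos.ne' (volume_hull_lt_top T).ne

/-- Poincaré's inequality on a simplex. -/
lemma IsSimplex.exists_mean {u : E d → ℝ} (hu : ContDiff ℝ 1 u) {T : Finset (E d)}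
    (hT : IsSimplex T) :
    ∃ b : ℝ, ∫⁻ x in Δ T, ‖u x - b‖ₑ ^ 2 ≤
      ENNReal.ofReal (2 ^ d * (Metric.diam (Δ T) ^ 2 * energy u T)) := by
  have hmeas : Measurable fun y => ∫⁻ x in Δ T, ‖u x - u y‖ₑ ^ 2 := by
    have := hu.continuous
    exact Measurable.lintegral_prod_right' (f := fun p : E d × E d => ‖u p.2 - u p.1‖ₑ ^ 2)
      ((Continuous.enorm (by fun_prop)).measurable.pow_const 2)
  -- The constant is not the mean value but a value `u y`, at a point `y` where the integral over
  -- `x` does not exceed its average over `y`.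
  obtain ⟨y, _, hy⟩ := exists_le_setLAverage hT.volume_pos.ne' (volume_hull_lt_top T).ne
    hmeas.aemeasurable
  refine ⟨u y, hy.trans ?_⟩
  rw [setLAverage_eq]
  refine ENNReal.div_le_of_le_mul' ((lintegral_pairs_le hu T).trans (le_of_eq ?_))
  rw [diam_mul_energy hu, ENNReal.ofReal_mul (p := 2 ^ d) (by positivity),
    ENNReal.ofReal_pow zero_le_two]
  simp

lemma volume_mul_ofReal_sq_le {T : Finset (E d)} {b : ℝ} {f : E d → ℝ≥0∞}
    (h : ∀ x ∈ Δ T, ENNReal.ofReal (b ^ 2) ≤ f x) :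
    volume (Δ T) * ENNReal.ofReal (b ^ 2) ≤ ∫⁻ x in Δ T, f x := by
  calc _ = ∫⁻ _ in Δ T, ENNReal.ofReal (b ^ 2) := by simp [mul_comm]
    _ ≤ _ := setLIntegral_mono' (measurableSet_hull T) h

/-- Friedrichs' inequality on a simplex for functions that vanish on a face. -/
lemma IsSimplex.sq_mean_le_of_face [DecidableEq (E d)] (hd : 0 < d) {u : E d → ℝ}
    (hu : ContDiff ℝ 1 u) {T : Finset (E d)}
    (hT : IsSimplex T) {q : E d} (hq : q ∈ T) (h0 : ∀ x ∈ Δ (T.erase q), u x = 0) {b : ℝ}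
    (hb : ∫⁻ x in Δ T, ‖u x - b‖ₑ ^ 2 ≤
      ENNReal.ofReal (2 ^ d * (Metric.diam (Δ T) ^ 2 * energy u T))) :
    b ^ 2 ≤ 2 * (2 ^ d + 4) * osc u T := by
  obtain ⟨o, ho, hne⟩ := hT.exists_ne hd hq
  have h1 := lintegral_sub_faceProj_le hu hT hq ho hne
  have hc := hu.continuous
  have hcb := continuous_bary T q
  set H := Metric.diam (Δ T) ^ 2 * energy u T with hH
  have hH0 : 0 ≤ H := mul_nonneg (sq_nonneg _) (energy_nonneg u T)
  have key : volume (Δ T) * ENNReal.ofReal (b ^ 2) ≤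
      ENNReal.ofReal (2 * (2 ^ d + 4) * H) := by
    -- The projection lands on the face where `u` vanishes, so the second term is the square of `u
    -- x`, and `b ^ 2 ≤ 2 (u x - b) ^ 2 + 2 (u x) ^ 2`.
    calc _ ≤ ∫⁻ x in Δ T, 2 * (‖u x - b‖ₑ ^ 2 + ‖u x - u (faceProj T q o x)‖ₑ ^ 2) := by
          refine volume_mul_ofReal_sq_le fun x hx => ?_
          rw [h0 _ (hT.faceProj_mem hq ho hne hx), enorm_sq_eq, enorm_sq_eq,
            ← ENNReal.ofReal_add (sq_nonneg _) (sq_nonneg _),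
            show (2 : ℝ≥0∞) = ENNReal.ofReal 2 by simp, ← ENNReal.ofReal_mul zero_le_two]
          apply ENNReal.ofReal_le_ofReal
          nlinarith [sq_nonneg (u x - b + u x)]
      _ = 2 * ((∫⁻ x in Δ T, ‖u x - b‖ₑ ^ 2) +
            ∫⁻ x in Δ T, ‖u x - u (faceProj T q o x)‖ₑ ^ 2) := by
          rw [lintegral_const_mul' _ _ (by simp), lintegral_add_left]
          exact (Continuous.enorm (by fun_prop)).measurable.pow_const 2
      _ ≤ 2 * (ENNReal.ofReal (2 ^ d * H) + 4 * ENNReal.ofReal H) := by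
          rw [diam_mul_energy hu] at h1
          gcongr
      _ = _ := by
          rw [show (4 : ℝ≥0∞) = ENNReal.ofReal 4 by simp,
            show (2 : ℝ≥0∞) = ENNReal.ofReal 2 by simp, ← ENNReal.ofReal_mul (by norm_num),
            ← ENNReal.ofReal_add (by positivity) (by positivity),
            ← ENNReal.ofReal_mul (by norm_num)]
          congr 1; ring
  have h2 := ENNReal.toReal_mono ENNReal.ofReal_ne_top key
  rw [ENNReal.toReal_mul, ENNReal.toReal_ofReal (sq_nonneg _),
    ENNReal.toReal_ofReal (by positivity)] at h2
  have hv := hT.volume_real_pos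
  change volume.real (Δ T) * b ^ 2 ≤ _ at h2
  rw [osc, ← hH, ← mul_div_assoc, le_div_iff₀ hv]
  linarith

/-- The shear that maps a simplex onto a neighbouring simplex and fixes the common face. -/
def faceShear (T : Finset (E d)) (q q' x : E d) : E d := x + bary T q x • (q' - q)

section FaceShear

variable [DecidableEq (E d)] {F : Finset (E d)} {q q' : E d}

/-- The shear keeps barycentric weights and replaces the vertex `q` by `q'`; its other properties
follow from the uniqueness of barycentric coordinates. -/
lemma faceShear_eq_sum (hT : IsSimplex (insert q F)) (hq : q ∉ F) (hq' : q' ∉ F) (x : E d) :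
    faceShear (insert q F) q q' x = ∑ w ∈ insert q' F,
      (if w = q' then bary (insert q F) q x else bary (insert q F) w x) • w := by
  have hx := hT.sum_bary_smul x
  rw [Finset.sum_insert hq] at hx
  rw [Finset.sum_insert hq', if_pos rfl]
  have : ∑ w ∈ F, (if w = q' then bary (insert q F) q x else bary (insert q F) w x) • w =
      ∑ w ∈ F, bary (insert q F) w x • w :=
    Finset.sum_congr rfl fun w hw => by rw [if_neg (ne_of_mem_of_not_mem hw hq')]
  rw [this, faceShear]
  nth_rw 1 [← hx]
  module

lemma sum_faceShear_weights (hT : IsSimplex (insert q F)) (hq : q ∉ F) (hq' : q' ∉ F) (x : E d) :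
    ∑ w ∈ insert q' F,
      (if w = q' then bary (insert q F) q x else bary (insert q F) w x) = 1 := by
  have hx := hT.sum_bary x
  rw [Finset.sum_insert hq] at hx
  rw [Finset.sum_insert hq', if_pos rfl, ← hx]
  congr 1
  exact Finset.sum_congr rfl fun w hw => by rw [if_neg (ne_of_mem_of_not_mem hw hq')]

lemma bary_faceShear (hT : IsSimplex (insert q F)) (hT' : IsSimplex (insert q' F)) (hq : q ∉ F)
    (hq' : q' ∉ F) (x : E d) :
    bary (insert q' F) q' (faceShear (insert q F) q q' x) = bary (insert q F) q x := by
  rw [faceShear_eq_sum hT hq hq', hT'.bary_sum_smul (sum_faceShear_weights hT hq hq' x)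
    (Finset.mem_insert_self _ _), if_pos rfl]

lemma faceShear_mem (hT : IsSimplex (insert q F)) (hq : q ∉ F)
    (hq' : q' ∉ F) {x : E d} (hx : x ∈ Δ (insert q F)) :
    faceShear (insert q F) q q' x ∈ Δ (insert q' F) := by
  rw [faceShear_eq_sum hT hq hq']
  refine (convex_convexHull ℝ _).sum_mem (fun w _ => ?_) (sum_faceShear_weights hT hq hq' x)
    fun w hw => subset_convexHull ℝ _ hw
  split_ifs <;> exact hT.bary_nonneg hx _

lemma faceShear_faceShear (hT : IsSimplex (insert q F)) (hT' : IsSimplex (insert q' F))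
    (hq : q ∉ F) (hq' : q' ∉ F) (x : E d) :
    faceShear (insert q' F) q' q (faceShear (insert q F) q q' x) = x := by
  rw [faceShear, bary_faceShear hT hT' hq hq', faceShear]; module

/-- A point and its sheared image project to the same point of the common face. The value of `u`
there links the two simplices. -/
lemma faceProj_faceShear (hT : IsSimplex (insert q F)) (hT' : IsSimplex (insert q' F))
    (hq : q ∉ F) (hq' : q' ∉ F) (o x : E d) :
    faceProj (insert q' F) q' o (faceShear (insert q F) q q' x) = faceProj (insert q F) q o x := by
  rw [faceProj, bary_faceShear hT hT' hq hq', faceShear, faceProj]; module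

/-- The shear is onto the neighbour, its inverse being the opposite shear. The bound shows that the
determinant is nonzero, and it turns the Jacobian factor into the ratio of the two volumes, so that
each simplex enters with its own mean and no shape constant appears. -/
lemma volume_le_det_faceShear (hT : IsSimplex (insert q F)) (hT' : IsSimplex (insert q' F))
    (hq : q ∉ F) (hq' : q' ∉ F) :
    volume.real (Δ (insert q' F)) ≤ |1 + (bary (insert q F) q).linear (q' - q)| *
      volume.real (Δ (insert q F)) := by
  have h1 : (Δ (insert q' F) : Set (E d)) ⊆
      (fun x => x + bary (insert q F) q x • (q' - q)) '' (Δ (insert q F)) := by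
    intro y hy
    exact ⟨faceShear (insert q' F) q' q y, faceShear_mem hT' hq' hq hy,
      faceShear_faceShear hT' hT hq' hq y⟩
  have h2 := measure_mono (μ := volume) h1
  rw [volume_image_shear] at h2
  have h3 := ENNReal.toReal_mono
    (ENNReal.mul_ne_top ENNReal.ofReal_ne_top (volume_hull_lt_top _).ne) h2
  rwa [ENNReal.toReal_mul, ENNReal.toReal_ofReal (abs_nonneg _)] at h3

/-- Comparison of the mean values of a function on simplices with a common face. -/
lemma sq_mean_sub_mean_le_of_insert (hF : F.Nonempty) {u : E d → ℝ} (hu : ContDiff ℝ 1 u)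
    (hT : IsSimplex (insert q F)) (hT' : IsSimplex (insert q' F)) (hq : q ∉ F) (hq' : q' ∉ F)
    {b b' : ℝ}
    (hb : ∫⁻ x in Δ (insert q F), ‖u x - b‖ₑ ^ 2 ≤
      ENNReal.ofReal (2 ^ d * (Metric.diam (Δ (insert q F)) ^ 2 * energy u (insert q F))))
    (hb' : ∫⁻ x in Δ (insert q' F), ‖u x - b'‖ₑ ^ 2 ≤
      ENNReal.ofReal (2 ^ d * (Metric.diam (Δ (insert q' F)) ^ 2 * energy u (insert q' F)))) :
    (b - b') ^ 2 ≤ 4 * (2 ^ d + 4) * (osc u (insert q F) + osc u (insert q' F)) := by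
  obtain ⟨o, ho⟩ := hF
  have hc := hu.continuous
  set T := insert q F with hTdef
  set T' := insert q' F with hTdef'
  have hoq : o ≠ q := fun h => hq (h ▸ ho)
  have hoq' : o ≠ q' := fun h => hq' (h ▸ ho)
  have h1 := lintegral_sub_faceProj_le hu hT (Finset.mem_insert_self q F)
    (Finset.mem_insert_of_mem ho) hoq
  have h1' := lintegral_sub_faceProj_le hu hT' (Finset.mem_insert_self q' F)
    (Finset.mem_insert_of_mem ho) hoq'
  rw [diam_mul_energy hu] at h1 h1'
  set H := Metric.diam (Δ T) ^ 2 * energy u T with hH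
  set H' := Metric.diam (Δ T') ^ 2 * energy u T' with hH'
  have hH0 : 0 ≤ H := mul_nonneg (sq_nonneg _) (energy_nonneg u T)
  have hH0' : 0 ≤ H' := mul_nonneg (sq_nonneg _) (energy_nonneg u T')
  have hdet := volume_le_det_faceShear hT hT' hq hq'
  set δ := 1 + (bary T q).linear (q' - q) with hδdef
  have hv := hT.volume_real_pos
  have hv' := hT'.volume_real_pos
  have hδ : 0 < |δ| := by
    by_contra hn
    have : |δ| = 0 := le_antisymm (not_lt.1 hn) (abs_nonneg _)
    rw [this, zero_mul] at hdet
    linarith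
  have hcb := continuous_bary T q
  have hcb' := continuous_bary T' q'
  let g : E d → ℝ≥0∞ := fun y => ‖u y - b'‖ₑ ^ 2 + ‖u y - u (faceProj T' q' o y)‖ₑ ^ 2
  have m1 : Measurable fun x => ‖u x - b‖ₑ ^ 2 :=
    (Continuous.enorm (by fun_prop)).measurable.pow_const 2
  have m2 : Measurable fun x => ‖u x - u (faceProj T q o x)‖ₑ ^ 2 := by
    unfold faceProj
    exact (Continuous.enorm (by fun_prop)).measurable.pow_const 2
  have m3 : Measurable fun y => ‖u y - b'‖ₑ ^ 2 :=
    (Continuous.enorm (by fun_prop)).measurable.pow_const 2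
  have m4 : Measurable fun y => ‖u y - u (faceProj T' q' o y)‖ₑ ^ 2 := by
    unfold faceProj
    exact (Continuous.enorm (by fun_prop)).measurable.pow_const 2
  have hg : Measurable g := m3.add m4
  have hcv := setLIntegral_comp_shear_le (bary T q) (q' - q) (abs_pos.1 hδ) (measurableSet_hull T')
    (measurableSet_hull T) (fun x hx => faceShear_mem hT hq hq' hx) hg
  have hgT' : ∫⁻ y in Δ T', g y ≤ ENNReal.ofReal ((2 ^ d + 4) * H') := by
    calc _ = (∫⁻ y in Δ T', ‖u y - b'‖ₑ ^ 2) +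
            ∫⁻ y in Δ T', ‖u y - u (faceProj T' q' o y)‖ₑ ^ 2 := lintegral_add_left m3 _
      _ ≤ ENNReal.ofReal (2 ^ d * H') + 4 * ENNReal.ofReal H' := by gcongr
      _ = _ := by
          rw [show (4 : ℝ≥0∞) = ENNReal.ofReal 4 by simp, ← ENNReal.ofReal_mul (by norm_num),
            ← ENNReal.ofReal_add (by positivity) (by positivity)]
          congr 1; ring
  have hgT : ∫⁻ y in Δ T, (‖u y - b‖ₑ ^ 2 + ‖u y - u (faceProj T q o y)‖ₑ ^ 2) ≤
      ENNReal.ofReal ((2 ^ d + 4) * H) := by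
    calc _ = (∫⁻ y in Δ T, ‖u y - b‖ₑ ^ 2) +
            ∫⁻ y in Δ T, ‖u y - u (faceProj T q o y)‖ₑ ^ 2 := lintegral_add_left m1 _
      _ ≤ ENNReal.ofReal (2 ^ d * H) + 4 * ENNReal.ofReal H := by gcongr
      _ = _ := by
          rw [show (4 : ℝ≥0∞) = ENNReal.ofReal 4 by simp, ← ENNReal.ofReal_mul (by norm_num),
            ← ENNReal.ofReal_add (by positivity) (by positivity)]
          congr 1; ring
  have key : volume (Δ T) * ENNReal.ofReal ((b - b') ^ 2) ≤
      ENNReal.ofReal (4 * (2 ^ d + 4) * (H + |δ⁻¹| * H')) := by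
    calc _ ≤ ∫⁻ x in Δ T, 4 * ((‖u x - b‖ₑ ^ 2 + ‖u x - u (faceProj T q o x)‖ₑ ^ 2) +
            g (faceShear T q q' x)) := by
          -- The difference `b - b'` telescopes through `u x`, `u` at the common projection, and `u`
          -- at the sheared point; the factor `4` comes from squaring a sum of four terms.
          refine volume_mul_ofReal_sq_le fun x hx => ?_
          simp only [g]
          rw [faceProj_faceShear hT hT' hq hq', enorm_sq_eq, enorm_sq_eq, enorm_sq_eq, enorm_sq_eq,
            ← ENNReal.ofReal_add (sq_nonneg _) (sq_nonneg _),
            ← ENNReal.ofReal_add (sq_nonneg _) (sq_nonneg _),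
            ← ENNReal.ofReal_add (by positivity) (by positivity),
            show (4 : ℝ≥0∞) = ENNReal.ofReal 4 by simp, ← ENNReal.ofReal_mul (by norm_num)]
          apply ENNReal.ofReal_le_ofReal
          generalize u (faceShear T q q' x) = r
          generalize u (faceProj T q o x) = p
          generalize u x = y
          nlinarith [sq_nonneg ((y - b) + (y - p)), sq_nonneg ((y - b) - (r - p)),
            sq_nonneg ((y - b) + (r - b')), sq_nonneg ((y - p) + (r - p)),
            sq_nonneg ((y - p) - (r - b')), sq_nonneg ((r - p) + (r - b'))]
      _ = 4 * ((∫⁻ x in Δ T, (‖u x - b‖ₑ ^ 2 + ‖u x - u (faceProj T q o x)‖ₑ ^ 2)) +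
            ∫⁻ x in Δ T, g (faceShear T q q' x)) := by
          rw [lintegral_const_mul' _ _ (by simp)]
          exact congrArg _ (lintegral_add_left (m1.add m2) _)
      _ ≤ 4 * (ENNReal.ofReal ((2 ^ d + 4) * H) +
            ENNReal.ofReal |δ⁻¹| * ENNReal.ofReal ((2 ^ d + 4) * H')) := by
          gcongr
          exact hcv.trans (mul_le_mul_right hgT' _)
      _ = _ := by
          rw [← ENNReal.ofReal_mul (abs_nonneg _),
            ← ENNReal.ofReal_add (by positivity) (by positivity),
            show (4 : ℝ≥0∞) = ENNReal.ofReal 4 by simp, ← ENNReal.ofReal_mul (by norm_num)]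
          congr 1; ring
  have h2 := ENNReal.toReal_mono ENNReal.ofReal_ne_top key
  rw [ENNReal.toReal_mul, ENNReal.toReal_ofReal (sq_nonneg _),
    ENNReal.toReal_ofReal (by positivity)] at h2
  change volume.real (Δ T) * (b - b') ^ 2 ≤ _ at h2
  have h3 : |δ⁻¹| * H' ≤ volume.real (Δ T) * (H' / volume.real (Δ T')) := by
    rw [abs_inv, inv_mul_le_iff₀ hδ]
    calc H' = volume.real (Δ T') * (H' / volume.real (Δ T')) := by field_simp
      _ ≤ (|δ| * volume.real (Δ T)) * (H' / volume.real (Δ T')) := by gcongr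
      _ = _ := by ring
  have h4 : H = volume.real (Δ T) * (H / volume.real (Δ T)) := by field_simp
  simp only [osc]
  rw [← hH, ← hH']
  refine le_of_mul_le_mul_left ?_ hv
  calc _ ≤ _ := h2
    _ ≤ 4 * (2 ^ d + 4) * (volume.real (Δ T) * (H / volume.real (Δ T)) +
          volume.real (Δ T) * (H' / volume.real (Δ T'))) := by
        gcongr
        exact h4.le
    _ = _ := by ring

end FaceShear

/-- `b` assigns to each simplex an approximate mean value of `u`. -/
def IsMeanOn (u : E d → ℝ) (T : Finset (E d)) (b : ℝ) : Prop :=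
  ∫⁻ x in Δ T, ‖u x - b‖ₑ ^ 2 ≤ ENNReal.ofReal (2 ^ d * (Metric.diam (Δ T) ^ 2 * energy u T))

/-- Distinct face-adjacent simplices have exactly `d` common vertices, so each is the common face
with one vertex inserted. -/
lemma sq_mean_sub_mean_le_of_faceAdj (hd : 0 < d) {u : E d → ℝ} (hu : ContDiff ℝ 1 u)
    {T T' : Finset (E d)} (hT : IsSimplex T) (hT' : IsSimplex T') (hadj : FaceAdj T T')
    (hne : T ≠ T') {b b' : ℝ} (hb : IsMeanOn u T b) (hb' : IsMeanOn u T' b') :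
    (b - b') ^ 2 ≤ 4 * (2 ^ d + 4) * (osc u T + osc u T') := by
  classical
  have hadj' : d ≤ (T ∩ T').card := by
    unfold FaceAdj at hadj; convert hadj
  have hlt : (T ∩ T').card < d + 1 := by
    by_contra hge
    have e1 : T ∩ T' = T := Finset.eq_of_subset_of_card_le Finset.inter_subset_left
      (by rw [hT.card_eq]; omega)
    have e2 : T ∩ T' = T' := Finset.eq_of_subset_of_card_le Finset.inter_subset_right
      (by rw [hT'.card_eq]; omega)
    exact hne (e1.symm.trans e2)
  have hc : (T ∩ T').card = d := by omega
  have hex : ∀ S : Finset (E d), S.card = d + 1 → T ∩ T' ⊆ S →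
      ∃ q, q ∉ T ∩ T' ∧ S = insert q (T ∩ T') := by
    intro S hS hsub
    have hcard : (S \ (T ∩ T')).card = 1 := by
      rw [Finset.card_sdiff_of_subset hsub]; omega
    obtain ⟨q, hq⟩ := Finset.card_eq_one.1 hcard
    refine ⟨q, ?_, ?_⟩
    · have : q ∈ S \ (T ∩ T') := by rw [hq]; simp
      exact (Finset.mem_sdiff.1 this).2
    · rw [Finset.insert_eq, ← hq, Finset.sdiff_union_of_subset hsub]
  obtain ⟨q, hq, e⟩ := hex T hT.card_eq Finset.inter_subset_left
  obtain ⟨q', hq', e'⟩ := hex T' hT'.card_eq Finset.inter_subset_right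
  have hF : (T ∩ T').Nonempty := Finset.card_pos.1 (by omega)
  generalize T ∩ T' = F at *
  subst e e'
  exact sq_mean_sub_mean_le_of_insert hF hu hT hT' hq hq' hb hb'

end PoincareReal

/-! ### Element means around a vertex and nodal values of a quasi-interpolant. -/

section StarMeans

variable {d : ℕ} {Ω γ : Set (E d)} {𝒯 : Finset (Finset (E d))} {u : E d → ℝ}

/-- The sum of the local oscillations of `u` over the star of `ν`. -/
def starOsc (u : E d → ℝ) (𝒯 : Finset (Finset (E d))) (ν : E d) : ℝ := ∑ S ∈ star 𝒯 ν, osc u S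

lemma starOsc_nonneg (u : E d → ℝ) (𝒯 : Finset (Finset (E d))) (ν : E d) : 0 ≤ starOsc u 𝒯 ν :=
  Finset.sum_nonneg fun _ _ => osc_nonneg _ _

lemma osc_le_starOsc {ν : E d} {T : Finset (E d)} (hT : T ∈ star 𝒯 ν) :
    osc u T ≤ starOsc u 𝒯 ν :=
  Finset.single_le_sum (f := fun S => osc u S) (fun _ _ => osc_nonneg _ _) hT

/-- Each step of a chain of face-adjacent simplices in the star changes the mean by at most a fixed
amount, the square root of the one-face bound with both oscillations replaced by their sum over the
star. The number of steps is at most `starConst d κ`, which appears squared. -/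
lemma sq_mean_sub_mean_le_starOsc (hd : 0 < d) (hΩ : IsPolytopalDomain Ω)
    (h : IsConformingPartition Ω 𝒯) {κ : ℝ} (hκ : IsShapeRegular κ 𝒯) (hu : ContDiff ℝ 1 u)
    {b : Finset (E d) → ℝ} (hb : ∀ T ∈ 𝒯, IsMeanOn u T (b T)) {ν : E d} {T T' : Finset (E d)}
    (hT : T ∈ star 𝒯 ν) (hT' : T' ∈ star 𝒯 ν) :
    (b T - b T') ^ 2 ≤ starConst d κ ^ 2 * (4 * (2 ^ d + 4) * starOsc u 𝒯 ν) := by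
  classical
  have hν : ν ∈ vertices 𝒯 := mem_vertices.2 ⟨T, (mem_star.1 hT).1, (mem_star.1 hT).2⟩
  have hE := starOsc_nonneg u 𝒯 ν
  set M := Real.sqrt (4 * (2 ^ d + 4) * starOsc u 𝒯 ν) with hM
  have hM0 : 0 ≤ M := Real.sqrt_nonneg _
  have hp := propagate_of_reflTransGen (star 𝒯 ν) FaceAdj (fun _ _ => FaceAdj.symm) hT
    (h.star_connected hΩ hT hT') (fun n S => |b T - b S| ≤ n * M) (by simp)
    (fun n S hS => hS.trans (by push_cast; nlinarith))
    (fun n S hS S' hS' hadj hn => by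
      have h1 : |b S - b S'| ≤ M := by
        by_cases hne : S = S'
        · subst hne; simpa using hM0
        · refine Real.abs_le_sqrt ((sq_mean_sub_mean_le_of_faceAdj hd hu
            (h.isSimplex (mem_star.1 hS).1) (h.isSimplex (mem_star.1 hS').1) hadj hne
            (hb S (mem_star.1 hS).1) (hb S' (mem_star.1 hS').1)).trans ?_)
          gcongr
          rw [← Finset.sum_pair (f := fun S => osc u S) hne]
          refine Finset.sum_le_sum_of_subset_of_nonneg ?_ fun _ _ _ => osc_nonneg _ _
          intro R hR
          rcases Finset.mem_insert.1 hR with rfl | hR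
          · exact hS
          · rw [Finset.mem_singleton.1 hR]; exact hS'
      calc |b T - b S'| = |(b T - b S) + (b S - b S')| := by congr 1; ring
        _ ≤ |b T - b S| + |b S - b S'| := abs_add_le _ _
        _ ≤ n * M + M := add_le_add hn h1
        _ = _ := by push_cast; ring)
  have hcard : ((star 𝒯 ν).card : ℝ) ≤ starConst d κ := by
    exact_mod_cast h.card_star_le_starConst hd hκ hν
  have h2 : |b T - b T'| ≤ starConst d κ * M := hp.trans (by gcongr)
  calc (b T - b T') ^ 2 = |b T - b T'| ^ 2 := (sq_abs _).symm
    _ ≤ (starConst d κ * M) ^ 2 := by gcongr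
    _ = _ := by rw [mul_pow, hM, Real.sq_sqrt (by positivity)]

/-- A point of `γ` lies on a face contained in `γ`. Conformity makes `ν` a vertex of the simplex
with that face, and Friedrichs' inequality applies there. Other simplices of the star need not have
a face in `γ`; they are reached by chains. -/
lemma sq_mean_le_osc_of_mem (hd : 0 < d) (h : IsConformingPartition Ω 𝒯)
    (hγ : IsUnionOfFaces 𝒯 γ) (hu : ContDiff ℝ 1 u) (hu0 : ∀ x ∈ γ, u x = 0)
    {b : Finset (E d) → ℝ} (hb : ∀ T ∈ 𝒯, IsMeanOn u T (b T)) {ν : E d} (hν : ν ∈ vertices 𝒯)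
    (hνγ : ν ∈ γ) : ∃ T ∈ star 𝒯 ν, b T ^ 2 ≤ 2 * (2 ^ d + 4) * osc u T := by
  classical
  obtain ⟨ℱ, hℱ, rfl⟩ := hγ
  obtain ⟨F, hF, hνF⟩ := mem_iUnion₂.1 hνγ
  obtain ⟨hcard, T, hT, hFT⟩ := hℱ F hF
  have hS := h.isSimplex hT
  have hνT : ν ∈ T := h.mem_of_mem_hull hν hT
    (convexHull_mono (by exact_mod_cast hFT) hνF)
  refine ⟨T, mem_star.2 ⟨hT, hνT⟩, ?_⟩
  obtain ⟨q, hq⟩ : ∃ q, T \ F = {q} := by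
    rw [← Finset.card_eq_one, Finset.card_sdiff_of_subset hFT, hS.card_eq]; omega
  have hqT : q ∈ T \ F := by rw [hq]; simp
  have he : T.erase q = F := by
    rw [Finset.erase_eq, ← hq, Finset.sdiff_sdiff_eq_self hFT]
  refine hS.sq_mean_le_of_face hd hu (Finset.mem_sdiff.1 hqT).1 (fun x hx => ?_) (hb T hT)
  rw [he] at hx
  exact hu0 x (mem_iUnion₂.2 ⟨F, hF, hx⟩)

/-- The constant in the comparison of element means with nodal values. -/
def meanConst (d : ℕ) (κ : ℝ) : ℝ := 8 * (2 ^ d + 4) * (starConst d κ ^ 2 + 1)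

lemma meanConst_nonneg (d : ℕ) (κ : ℝ) : 0 ≤ meanConst d κ := by unfold meanConst; positivity

/-- There are nodal values that vanish on `γ` and are close to the element means. -/
lemma exists_nodal_values (hd : 0 < d) (hΩ : IsPolytopalDomain Ω)
    (h : IsConformingPartition Ω 𝒯) (hγ : IsUnionOfFaces 𝒯 γ) {κ : ℝ}
    (hκ : IsShapeRegular κ 𝒯) (hu : ContDiff ℝ 1 u) (hu0 : ∀ x ∈ γ, u x = 0)
    {b : Finset (E d) → ℝ} (hb : ∀ T ∈ 𝒯, IsMeanOn u T (b T)) :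
    ∃ β : E d → ℝ, (∀ ν ∈ γ, β ν = 0) ∧ ∀ ν, ∀ T ∈ star 𝒯 ν,
      (b T - β ν) ^ 2 ≤ meanConst d κ * starOsc u 𝒯 ν := by
  classical
  have hex : ∀ ν, ∃ r : ℝ, (ν ∈ γ → r = 0) ∧ ∀ T ∈ star 𝒯 ν,
      (b T - r) ^ 2 ≤ meanConst d κ * starOsc u 𝒯 ν := by
    intro ν
    have hE := starOsc_nonneg u 𝒯 ν
    rcases (star 𝒯 ν).eq_empty_or_nonempty with he | ⟨T₀, hT₀⟩
    · exact ⟨0, fun _ => rfl, fun T hT => by rw [he] at hT; simp at hT⟩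
    by_cases hνγ : ν ∈ γ
    · refine ⟨0, fun _ => rfl, fun T hT => ?_⟩
      have hν : ν ∈ vertices 𝒯 := mem_vertices.2 ⟨T, (mem_star.1 hT).1, (mem_star.1 hT).2⟩
      obtain ⟨T₁, hT₁, hle⟩ := sq_mean_le_osc_of_mem hd h hγ hu hu0 hb hν hνγ
      have h1 := sq_mean_sub_mean_le_starOsc hd hΩ h hκ hu hb hT hT₁
      have h2 : b T₁ ^ 2 ≤ 2 * (2 ^ d + 4) * starOsc u 𝒯 ν :=
        hle.trans (by gcongr; exact osc_le_starOsc hT₁)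
      have h3 : (0 : ℝ) ≤ (2 ^ d + 4) * starOsc u 𝒯 ν := by positivity
      unfold meanConst
      rw [sub_zero]
      -- This uses `b T ^ 2 ≤ 2 (b T - b T₁) ^ 2 + 2 (b T₁) ^ 2`, where the difference of the two
      -- sides is the square in the hint.
      nlinarith [sq_nonneg (b T - 2 * b T₁)]
    · refine ⟨b T₀, fun hh => absurd hh hνγ, fun T hT => ?_⟩
      have h1 := sq_mean_sub_mean_le_starOsc hd hΩ h hκ hu hb hT hT₀
      have h3 : (0 : ℝ) ≤ (2 ^ d + 4) * starOsc u 𝒯 ν := by positivity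
      have h4 : (0 : ℝ) ≤ starConst d κ ^ 2 * ((2 ^ d + 4) * starOsc u 𝒯 ν) := by positivity
      unfold meanConst
      nlinarith
  choose β hβ0 hβ using hex
  exact ⟨β, hβ0, hβ⟩

end StarMeans

/-! ### Sobolev spaces on bounded open sets -/

/-- Images under a bounded operator of bounded sequences in a Hilbert space: their limits are in
the range of the operator. -/
lemma exists_preimage_of_bounded {H X : Type*} [NormedAddCommGroup H] [InnerProductSpace ℝ H]
    [CompleteSpace H] [NormedAddCommGroup X] [NormedSpace ℝ X] (j : H →L[ℝ] X) {u : ℕ → H} {R : ℝ}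
    (hR : ∀ n, ‖u n‖ ≤ R) {x : X} (hx : Filter.Tendsto (fun n => j (u n)) Filter.atTop (𝓝 x)) :
    ∃ h, j h = x := by
  let Φ : ℕ → WeakDual ℝ H := fun n =>
    StrongDual.toWeakDual (InnerProductSpace.toDual ℝ H (u n))
  have hΦ : ∀ n y, Φ n y = inner ℝ (u n) y := fun n y =>
    InnerProductSpace.toDual_apply_apply (𝕜 := ℝ) (x := u n) (y := y)
  -- A limit along a free ultrafilter replaces a weakly convergent subsequence. Banach–Alaoglu
  -- provides it and the Riesz representation turns it into a vector of `H`.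
  let 𝒰 : Filter ℕ := Filter.hyperfilter ℕ
  have hne : 𝒰.NeBot := Ultrafilter.neBot _
  obtain ⟨ℓ, hℓ⟩ : ∃ ℓ : WeakDual ℝ H, Filter.Tendsto Φ 𝒰 (𝓝 ℓ) := by
    obtain ⟨ℓ, _, hℓ⟩ := (WeakDual.isCompact_closedBall (𝕜 := ℝ) (E := H) 0 R).ultrafilter_le_nhds
      ((Filter.hyperfilter ℕ).map Φ) (by
        rw [Filter.le_principal_iff]
        refine Ultrafilter.mem_map.2 (Filter.univ_mem' fun n : ℕ => ?_)
        change InnerProductSpace.toDual ℝ H (u n) ∈ Metric.closedBall 0 R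
        simpa using hR n)
    exact ⟨ℓ, hℓ⟩
  have hlim : ∀ y : H, Filter.Tendsto (fun n : ℕ => (inner ℝ (u n) y : ℝ)) 𝒰 (𝓝 (ℓ y)) := by
    intro y
    have h := ((WeakDual.eval_continuous y).tendsto ℓ).comp hℓ
    exact h.congr fun n => hΦ n y
  set h : H := (InnerProductSpace.toDual ℝ H).symm (WeakDual.toStrongDual ℓ) with hh
  have hhℓ : ∀ y, inner ℝ h y = ℓ y := fun y => InnerProductSpace.toDual_symm_apply
  refine ⟨h, (SeparatingDual.eq_iff_forall_dual_eq (R := ℝ)).2 fun f => ?_⟩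
  set w : H := (InnerProductSpace.toDual ℝ H).symm (f.comp j) with hw
  have hfw : ∀ z, f (j z) = inner ℝ z w := fun z => by
    rw [real_inner_comm]
    exact (InnerProductSpace.toDual_symm_apply (y := f.comp j)).symm
  have h1 : Filter.Tendsto (fun n : ℕ => f (j (u n))) 𝒰 (𝓝 (f x)) :=
    ((f.continuous.tendsto x).comp hx).mono_left Nat.hyperfilter_le_atTop
  have h2 : Filter.Tendsto (fun n : ℕ => f (j (u n))) 𝒰 (𝓝 (ℓ w)) :=
    (hlim w).congr fun n => (hfw (u n)).symm
  rw [tendsto_nhds_unique h1 h2, hfw, hhℓ]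

lemma enorm_Lp_two_sq {α F : Type*} [MeasurableSpace α] [NormedAddCommGroup F] {μ : Measure α}
    (f : Lp F 2 μ) : ‖f‖ₑ ^ 2 = ∫⁻ x, ‖f x‖ₑ ^ 2 ∂μ := by
  have h2 := eLpNorm_nnreal_pow_eq_lintegral (f := (f : α → F)) (μ := μ) (p := 2) two_ne_zero
  rw [Lp.enorm_def]
  norm_num at h2
  exact_mod_cast h2

section Sobolev

variable {d : ℕ} {Ω γ : Set (E d)}

instance instInnerProductSpaceH1 (Ω : Set (E d)) : InnerProductSpace ℝ (H1 Ω) :=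
  inferInstanceAs (InnerProductSpace ℝ (h1Submodule Ω))

/-- The weak gradient. -/
def H1.grad (Ω : Set (E d)) : H1 Ω →L[ℝ] L2Vec Ω :=
  (WithLp.sndL 2 ℝ (L2 Ω) (L2Vec Ω)).comp (h1Submodule Ω).subtypeL

lemma H1.hasWeakGradient (u : H1 Ω) : HasWeakGradient Ω (H1.toL2 Ω u) (H1.grad Ω u) := u.2

lemma H1.norm_sq (u : H1 Ω) : ‖u‖ ^ 2 = ‖H1.toL2 Ω u‖ ^ 2 + ‖H1.grad Ω u‖ ^ 2 :=
  WithLp.prod_norm_sq_eq_of_L2 (u : h1Submodule Ω).1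

/-- Each test function and direction imposes an equality between two `L₂` inner products, which is a
closed condition. The resulting completeness is what weak compactness needs. -/
lemma isClosed_h1Submodule (Ω : Set (E d)) :
    IsClosed (h1Submodule Ω : Set (WithLp 2 (L2 Ω × L2Vec Ω))) := by
  have hset : (h1Submodule Ω : Set (WithLp 2 (L2 Ω × L2Vec Ω))) =
      ⋂ (η : E d → ℝ) (_ : ContDiff ℝ ∞ η) (_ : HasCompactSupport η) (_ : tsupport η ⊆ Ω) (v : E d),
        {p | ∫ x in Ω, p.fst x * fderiv ℝ η x v = - ∫ x in Ω, inner ℝ (p.snd x) v * η x} := by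
    ext p
    simp only [mem_iInter]
    rfl
  rw [hset]
  refine isClosed_iInter fun η => isClosed_iInter fun hη => isClosed_iInter fun hc =>
    isClosed_iInter fun _ => isClosed_iInter fun v => ?_
  have hη' : MemLp (fun x => η x • v) 2 (volume.restrict Ω) :=
    ((hη.continuous.smul continuous_const).memLp_of_hasCompactSupport (hc.smul_right)).restrict Ω
  have hd : MemLp (fun x => fderiv ℝ η x v) 2 (volume.restrict Ω) :=
    (((hη.continuous_fderiv (by simp)).clm_apply continuous_const).memLp_of_hasCompactSupport
      (hc.fderiv_apply ℝ v)).restrict Ω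
  have e1 : ∀ p : WithLp 2 (L2 Ω × L2Vec Ω),
      ∫ x in Ω, p.fst x * fderiv ℝ η x v = inner ℝ (hd.toLp _) p.fst := by
    intro p
    rw [L2.inner_def]
    refine integral_congr_ae ?_
    filter_upwards [hd.coeFn_toLp] with x hx
    rw [hx]; simp
  have e2 : ∀ p : WithLp 2 (L2 Ω × L2Vec Ω),
      ∫ x in Ω, inner ℝ (p.snd x) v * η x = inner ℝ (hη'.toLp _) p.snd := by
    intro p
    rw [L2.inner_def]
    refine integral_congr_ae ?_
    filter_upwards [hη'.coeFn_toLp] with x hx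
    rw [hx, real_inner_smul_left, real_inner_comm, mul_comm]
  simp only [e1, e2]
  refine isClosed_eq ?_ ?_
  · exact continuous_const.inner (WithLp.fstL 2 ℝ (L2 Ω) (L2Vec Ω)).continuous
  · exact (continuous_const.inner (WithLp.sndL 2 ℝ (L2 Ω) (L2Vec Ω)).continuous).neg

instance instCompleteSpaceH1 (Ω : Set (E d)) : CompleteSpace (H1 Ω) :=
  (isClosed_h1Submodule Ω).completeSpace_coe

instance instCompleteSpaceH10 (Ω γ : Set (E d)) : CompleteSpace (H10 Ω γ) :=
  (Submodule.isClosed_topologicalClosure _).completeSpace_coe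

/-- Integration by parts against a test function. -/
lemma integral_mul_fderiv_test {w : E d → ℝ} (hw : ContDiff ℝ 1 w) {η : E d → ℝ}
    (hη : ContDiff ℝ ∞ η) (hc : HasCompactSupport η) (v : E d) :
    ∫ x, w x * fderiv ℝ η x v = - ∫ x, fderiv ℝ w x v * η x := by
  have hηd : Continuous fun x => fderiv ℝ η x v :=
    (hη.continuous_fderiv (by simp)).clm_apply continuous_const
  have hwd : Continuous fun x => fderiv ℝ w x v :=
    (hw.continuous_fderiv one_ne_zero).clm_apply continuous_const
  refine integral_mul_fderiv_eq_neg_fderiv_mul_of_integrable ?_ ?_ ?_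
    (fun x _ => (hw.differentiable one_ne_zero).differentiableAt)
    (fun x _ => (hη.differentiable (by simp)).differentiableAt)
  · exact (hwd.mul hη.continuous).integrable_of_hasCompactSupport hc.mul_left
  · exact (hw.continuous.mul hηd).integrable_of_hasCompactSupport (hc.fderiv_apply ℝ v).mul_left
  · exact (hw.continuous.mul hη.continuous).integrable_of_hasCompactSupport hc.mul_left

lemma continuous_gradient {w : E d → ℝ} (hw : ContDiff ℝ 1 w) : Continuous (gradient w) :=
  (InnerProductSpace.toDual ℝ (E d)).symm.continuous.comp (hw.continuous_fderiv one_ne_zero)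

lemma inner_gradient (w : E d → ℝ) (x v : E d) : inner ℝ (gradient w x) v = fderiv ℝ w x v :=
  InnerProductSpace.toDual_symm_apply

lemma norm_gradient (w : E d → ℝ) (x : E d) : ‖gradient w x‖ = ‖fderiv ℝ w x‖ :=
  (InnerProductSpace.toDual ℝ (E d)).symm.norm_map _

lemma setIntegral_mul_test {Ω : Set (E d)} {η : E d → ℝ} (hs : tsupport η ⊆ Ω) (f : E d → ℝ) :
    ∫ x in Ω, f x * η x = ∫ x, f x * η x :=
  setIntegral_eq_integral_of_forall_compl_eq_zero fun x hx => by
    rw [image_eq_zero_of_notMem_tsupport (fun h => hx (hs h)), mul_zero]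

lemma setIntegral_mul_fderiv_test {Ω : Set (E d)} {η : E d → ℝ} (hs : tsupport η ⊆ Ω)
    (f : E d → ℝ) (v : E d) :
    ∫ x in Ω, f x * fderiv ℝ η x v = ∫ x, f x * fderiv ℝ η x v :=
  setIntegral_eq_integral_of_forall_compl_eq_zero fun x hx => by
    rw [image_eq_zero_of_notMem_tsupport (f := fderiv ℝ η)
      (fun h => hx (hs (tsupport_fderiv_subset ℝ h)))]
    simp

lemma memLp_of_continuous_of_isBounded {F : Type*} [NormedAddCommGroup F]
    {w : E d → F} (hw : Continuous w) (hΩ : Bornology.IsBounded Ω) (p : ℝ≥0∞) :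
    MemLp w p (volume.restrict Ω) := by
  have hK : IsCompact (closure Ω) := hΩ.isCompact_closure
  obtain ⟨C, hC⟩ := hK.exists_bound_of_continuousOn hw.continuousOn
  have : IsFiniteMeasure (volume.restrict (closure Ω)) := ⟨by simpa using hK.measure_lt_top⟩
  have h1 : MemLp w p (volume.restrict (closure Ω)) :=
    MemLp.of_bound hw.aestronglyMeasurable.restrict C
      ((ae_restrict_iff' isClosed_closure.measurableSet).2
        (Filter.Eventually.of_forall fun x hx => hC x hx))
  exact h1.mono_measure (Measure.restrict_mono subset_closure le_rfl)

/-- Smooth functions are in `H¹` of bounded sets. -/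
lemma exists_H1_of_contDiff (hΩ : Bornology.IsBounded Ω) {w : E d → ℝ} (hw : ContDiff ℝ 1 w) :
    ∃ u : H1 Ω, H1.toL2 Ω u =ᵐ[volume.restrict Ω] w ∧
      H1.grad Ω u =ᵐ[volume.restrict Ω] gradient w := by
  have h1 := memLp_of_continuous_of_isBounded (p := 2) hw.continuous hΩ
  have h2 := memLp_of_continuous_of_isBounded (p := 2) (continuous_gradient hw) hΩ
  refine ⟨⟨WithLp.toLp 2 (h1.toLp w, h2.toLp (gradient w)), ?_⟩, h1.coeFn_toLp, h2.coeFn_toLp⟩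
  intro η hη hc hs v
  have e1 : ∫ x in Ω, (h1.toLp w : E d → ℝ) x * fderiv ℝ η x v =
      ∫ x in Ω, w x * fderiv ℝ η x v := by
    refine integral_congr_ae ?_
    filter_upwards [h1.coeFn_toLp] with x hx
    rw [hx]
  have e2 : ∫ x in Ω, inner ℝ ((h2.toLp (gradient w) : E d → E d) x) v * η x =
      ∫ x in Ω, fderiv ℝ w x v * η x := by
    refine integral_congr_ae ?_
    filter_upwards [h2.coeFn_toLp] with x hx
    rw [hx, inner_gradient]
  change ∫ x in Ω, (h1.toLp w : E d → ℝ) x * fderiv ℝ η x v =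
    - ∫ x in Ω, inner ℝ ((h2.toLp (gradient w) : E d → E d) x) v * η x
  rw [e1, e2, setIntegral_mul_fderiv_test hs, setIntegral_mul_test hs]
  exact integral_mul_fderiv_test hw hη hc v

/-- The weak gradient of a function that is smooth on an open subset is the classical one. -/
lemma H1.grad_ae_eq (hΩ : Bornology.IsBounded Ω) {U : Set (E d)} (hU : IsOpen U) (hUΩ : U ⊆ Ω)
    {w : E d → ℝ} (hw : ContDiff ℝ 1 w) {u : H1 Ω}
    (hu : H1.toL2 Ω u =ᵐ[volume.restrict U] w) :
    H1.grad Ω u =ᵐ[volume.restrict U] gradient w := by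
  have hfin : IsFiniteMeasure (volume.restrict Ω) := ⟨by simpa using hΩ.measure_lt_top⟩
  have hgi : IntegrableOn (H1.grad Ω u) U :=
    ((Lp.memLp (H1.grad Ω u)).integrable (by norm_num)).mono_measure
      (Measure.restrict_mono hUΩ le_rfl)
  have hwi : IntegrableOn (gradient w) U :=
    ((memLp_of_continuous_of_isBounded (p := 1) (continuous_gradient hw) hΩ).integrable
      le_rfl).mono_measure (Measure.restrict_mono hUΩ le_rfl)
  have key : ∀ v : E d, ∀ᵐ x ∂volume, x ∈ U → inner ℝ (H1.grad Ω u x) v - fderiv ℝ w x v = 0 := by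
    intro v
    have hgv : IntegrableOn (fun x => inner ℝ (H1.grad Ω u x) v) U := hgi.inner_const v
    have hwv : IntegrableOn (fun x => fderiv ℝ w x v) U := by
      have h : IntegrableOn (fun x => (inner ℝ (gradient w x) v : ℝ)) U := hwi.inner_const v
      simpa only [inner_gradient] using h
    refine IsOpen.ae_eq_zero_of_integral_contDiff_smul_eq_zero hU
      (hgv.sub hwv).locallyIntegrableOn fun η hη hc hs => ?_
    obtain ⟨C, hC⟩ := hc.exists_bound_of_continuous hη.continuous
    have hmul : ∀ f : E d → ℝ, IntegrableOn f U → IntegrableOn (fun x => f x * η x) U :=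
      fun f hf => hf.mul_bdd (c := C) hη.continuous.aestronglyMeasurable.restrict
        (Filter.Eventually.of_forall hC)
    have e1 : ∫ x in U, H1.toL2 Ω u x * fderiv ℝ η x v = ∫ x in U, w x * fderiv ℝ η x v := by
      refine integral_congr_ae ?_
      filter_upwards [hu] with x hx
      rw [hx]
    calc ∫ x, η x • (inner ℝ (H1.grad Ω u x) v - fderiv ℝ w x v)
        = ∫ x, (inner ℝ (H1.grad Ω u x) v - fderiv ℝ w x v) * η x := by
          simp only [smul_eq_mul, mul_comm]
      _ = ∫ x in U, (inner ℝ (H1.grad Ω u x) v - fderiv ℝ w x v) * η x :=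
          (setIntegral_mul_test hs _).symm
      _ = (∫ x in U, inner ℝ (H1.grad Ω u x) v * η x) - ∫ x in U, fderiv ℝ w x v * η x := by
          simp only [sub_mul]
          exact integral_sub (hmul _ hgv) (hmul _ hwv)
      _ = 0 := by
          have h1 := H1.hasWeakGradient u η hη hc (hs.trans hUΩ) v
          rw [setIntegral_mul_fderiv_test (hs.trans hUΩ), setIntegral_mul_test (hs.trans hUΩ),
            ← setIntegral_mul_fderiv_test hs, e1, setIntegral_mul_fderiv_test hs,
            integral_mul_fderiv_test hw hη hc, neg_inj] at h1
          rw [setIntegral_mul_test hs, setIntegral_mul_test hs, h1, sub_self]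
  have hall : ∀ᵐ x ∂volume, ∀ i : Fin d, x ∈ U → inner ℝ (H1.grad Ω u x)
      (EuclideanSpace.single i (1 : ℝ)) - fderiv ℝ w x (EuclideanSpace.single i 1) = 0 :=
    ae_all_iff.2 fun i => key _
  rw [Filter.EventuallyEq, ae_restrict_iff' hU.measurableSet]
  filter_upwards [hall] with x hx hxU
  ext i
  have h := hx i hxU
  rw [← inner_gradient, sub_eq_zero, EuclideanSpace.inner_single_right,
    EuclideanSpace.inner_single_right] at h
  simpa using h

/-! ### Lipschitz functions that vanish on `γ` are in `H¹_{0,γ}` -/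

/-- Soft thresholding. -/
def softThreshold (ε t : ℝ) : ℝ := max (t - ε) 0 + min (t + ε) 0

lemma softThreshold_eq_zero {ε t : ℝ} (h : |t| ≤ ε) : softThreshold ε t = 0 := by
  rw [abs_le] at h
  rw [softThreshold, max_eq_right (by linarith), min_eq_right (by linarith), add_zero]

lemma abs_softThreshold_sub_le {ε : ℝ} (hε : 0 ≤ ε) (t : ℝ) : |softThreshold ε t - t| ≤ ε := by
  unfold softThreshold
  rw [abs_le]
  rcases max_cases (t - ε) 0 with ⟨h1, h1'⟩ | ⟨h1, h1'⟩ <;>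
  rcases min_cases (t + ε) 0 with ⟨h2, h2'⟩ | ⟨h2, h2'⟩ <;>
  rw [h1, h2] <;> constructor <;> linarith

lemma lipschitzWith_softThreshold {ε : ℝ} (hε : 0 ≤ ε) : LipschitzWith 1 (softThreshold ε) := by
  refine LipschitzWith.of_le_add fun s t => ?_
  rw [Real.dist_eq]
  unfold softThreshold
  have h := le_abs_self (s - t)
  have h' := abs_nonneg (s - t)
  rcases max_cases (s - ε) 0 with ⟨h1, h1'⟩ | ⟨h1, h1'⟩ <;>
  rcases min_cases (s + ε) 0 with ⟨h2, h2'⟩ | ⟨h2, h2'⟩ <;>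
  rcases max_cases (t - ε) 0 with ⟨h3, h3'⟩ | ⟨h3, h3'⟩ <;>
  rcases min_cases (t + ε) 0 with ⟨h4, h4'⟩ | ⟨h4, h4'⟩ <;>
  rw [h1, h2, h3, h4] <;> linarith

open scoped Convolution in
/-- Lipschitz functions are uniform limits of equi-Lipschitz smooth functions that vanish where the
given function vanishes. -/
lemma exists_smooth_approx {G : E d → ℝ} {L : ℝ≥0} (hG : LipschitzWith L G) {ε : ℝ} (hε : 0 < ε) :
    ∃ v : E d → ℝ, ContDiff ℝ ∞ v ∧ LipschitzWith L v ∧ (∀ x, |v x - G x| ≤ 2 * ε) ∧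
      ∀ x, G x = 0 → v x = 0 := by
  -- Within distance `δ` of a zero, `|G| ≤ L δ ≤ ε`, so the thresholded function vanishes on that
  -- whole ball and mollifying at radius `δ` preserves the zero. The `+ 1` covers the case `L = 0`.
  set δ : ℝ := ε / (L + 1) with hδ
  have hδ0 : 0 < δ := by positivity
  have hLδ : L * δ ≤ ε := by
    rw [hδ, ← mul_div_assoc, div_le_iff₀ (by positivity)]
    nlinarith [L.coe_nonneg]
  let φ : ContDiffBump (0 : E d) := ⟨δ / 2, δ, by positivity, by linarith⟩
  let Gε : E d → ℝ := fun x => softThreshold ε (G x)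
  have hGε : LipschitzWith L Gε := by
    have := (lipschitzWith_softThreshold hε.le).comp hG
    rwa [one_mul] at this
  have hGεc : Continuous Gε := hGε.continuous
  let v : E d → ℝ := φ.normed volume ⋆[ContinuousLinearMap.lsmul ℝ ℝ, volume] Gε
  have hexists : ConvolutionExists (φ.normed volume) Gε (ContinuousLinearMap.lsmul ℝ ℝ) volume :=
    φ.hasCompactSupport_normed.convolutionExists_left _ φ.continuous_normed
      hGεc.locallyIntegrable
  refine ⟨v, ?_, ?_, fun x => ?_, fun x hx => ?_⟩
  · exact φ.hasCompactSupport_normed.contDiff_convolution_left _ φ.contDiff_normed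
      hGεc.locallyIntegrable
  · refine LipschitzWith.of_dist_le_mul fun x y => ?_
    rw [Real.dist_eq]
    have h1 : v x - v y = ∫ t, φ.normed volume t * (Gε (x - t) - Gε (y - t)) := by
      simp only [v, convolution_def]
      rw [← integral_sub (hexists x) (hexists y)]
      refine integral_congr_ae (Filter.Eventually.of_forall fun t => ?_)
      simp [mul_sub]
    rw [h1, ← Real.norm_eq_abs]
    calc _ ≤ ∫ t, φ.normed volume t * (L * dist x y) := by
          refine norm_integral_le_of_norm_le (φ.integrable_normed.mul_const _)
            (Filter.Eventually.of_forall fun t => ?_)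
          rw [norm_mul, Real.norm_of_nonneg (φ.nonneg_normed t)]
          refine mul_le_mul_of_nonneg_left ?_ (φ.nonneg_normed t)
          have := hGε.dist_le_mul (x - t) (y - t)
          rwa [dist_sub_right, Real.dist_eq] at this
      _ = _ := by rw [integral_mul_const, φ.integral_normed, one_mul]
  · have h1 : dist (v x) (Gε x) ≤ ε := by
      refine φ.dist_normed_convolution_le hGεc.aestronglyMeasurable fun y hy => ?_
      refine (hGε.dist_le_mul y x).trans (le_trans ?_ hLδ)
      gcongr
      exact (Metric.mem_ball.1 hy).le
    have h2 := abs_softThreshold_sub_le hε.le (G x)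
    rw [Real.dist_eq] at h1
    calc |v x - G x| = |(v x - Gε x) + (Gε x - G x)| := by congr 1; ring
      _ ≤ _ := abs_add_le _ _
      _ ≤ ε + ε := add_le_add h1 h2
      _ = _ := by ring
  · have h0 : ∀ y ∈ Metric.ball x φ.rOut, Gε y = 0 := by
      intro y hy
      refine softThreshold_eq_zero ?_
      have h1 := hG.dist_le_mul y x
      rw [Real.dist_eq, hx, sub_zero] at h1
      refine h1.trans (le_trans ?_ hLδ)
      gcongr
      exact (Metric.mem_ball.1 hy).le
    have hx0 : Gε x = 0 := h0 x (Metric.mem_ball_self φ.rOut_pos)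
    have h2 := φ.normed_convolution_eq_right (μ := volume) (g := Gε) (x₀ := x)
      fun y hy => by rw [h0 y hy, hx0]
    exact h2.trans hx0

/-- The factor `volume.real Ω + 1` is a crude substitute for the square root of the volume. -/
lemma norm_Lp_two_le_of_bound {F : Type*} [NormedAddCommGroup F] {f : Lp F 2 (volume.restrict Ω)}
    {C : ℝ} (h : ∀ᵐ x ∂volume.restrict Ω, ‖f x‖ ≤ C) (hΩ : Bornology.IsBounded Ω) :
    ‖f‖ ≤ (volume.real Ω + 1) * |C| := by
  have hv : volume Ω ≠ ⊤ := hΩ.measure_lt_top.ne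
  have h1 : ‖f‖ₑ ^ 2 ≤ ENNReal.ofReal (((volume.real Ω + 1) * |C|) ^ 2) := by
    rw [enorm_Lp_two_sq]
    calc _ ≤ ∫⁻ _ in Ω, ENNReal.ofReal (|C| ^ 2) := by
          refine lintegral_mono_ae ?_
          filter_upwards [h] with x hx
          rw [← ofReal_norm, ← ENNReal.ofReal_pow (norm_nonneg _)]
          apply ENNReal.ofReal_le_ofReal
          gcongr
          exact hx.trans (le_abs_self C)
      _ = ENNReal.ofReal (|C| ^ 2 * volume.real Ω) := by
          rw [setLIntegral_const, ENNReal.ofReal_mul (by positivity)]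
          rw [measureReal_def, ENNReal.ofReal_toReal hv]
      _ ≤ _ := by
          apply ENNReal.ofReal_le_ofReal
          have : 0 ≤ volume.real Ω := measureReal_nonneg
          have hC := sq_nonneg |C|
          rw [mul_pow]
          nlinarith [mul_nonneg hC this, mul_nonneg hC (sq_nonneg (volume.real Ω))]
  rw [← ofReal_norm, ← ENNReal.ofReal_pow (norm_nonneg _),
    ENNReal.ofReal_le_ofReal_iff (by positivity)] at h1
  have : 0 ≤ volume.real Ω := measureReal_nonneg
  exact le_of_sq_le_sq h1 (by positivity)

lemma mem_H10_of_contDiff {u : H1 Ω} {v : E d → ℝ} (hv : ContDiff ℝ ∞ v) (h0 : ∀ x ∈ γ, v x = 0)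
    (hu : H1.toL2 Ω u =ᵐ[volume.restrict Ω] v) : u ∈ H10 Ω γ :=
  Submodule.le_topologicalClosure _ (Submodule.subset_span ⟨v, hv, h0, hu⟩)

/-- Lipschitz functions that vanish on `γ` are members of `H¹_{0,γ}(Ω)`. -/
theorem exists_H10_of_lipschitz (hΩ : Bornology.IsBounded Ω) {G : E d → ℝ} {L : ℝ≥0}
    (hG : LipschitzWith L G) (h0 : ∀ x ∈ γ, G x = 0) :
    ∃ u : H10 Ω γ, H10.toL2 Ω γ u =ᵐ[volume.restrict Ω] G := by
  have hGm := memLp_of_continuous_of_isBounded (p := 2) hG.continuous hΩ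
  have hpos : ∀ n : ℕ, (0 : ℝ) < 1 / (n + 1) := fun n => by positivity
  choose v hv hvL hvG hv0 using fun n : ℕ => exists_smooth_approx hG (hpos n)
  choose w hw hwg using fun n => exists_H1_of_contDiff hΩ ((hv n).of_le (by simp))
  have hmem : ∀ n, w n ∈ H10 Ω γ := fun n =>
    mem_H10_of_contDiff (hv n) (fun x hx => hv0 n x (h0 x hx)) (hw n)
  set g : L2 Ω := hGm.toLp G with hg
  have hdiff : ∀ n, ‖H1.toL2 Ω (w n) - g‖ ≤ (volume.real Ω + 1) * |2 * (1 / ((n : ℝ) + 1))| := by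
    intro n
    refine norm_Lp_two_le_of_bound ?_ hΩ
    filter_upwards [Lp.coeFn_sub (H1.toL2 Ω (w n)) g, hw n, hGm.coeFn_toLp] with x h1 h2 h3
    rw [h1, Pi.sub_apply, h2, h3]
    exact hvG n x
  -- The gradients are bounded by the common Lipschitz constant, but their convergence is not
  -- claimed. Together with `L₂` convergence, boundedness in the Hilbert space `H10 Ω γ` is enough.
  have hgrad : ∀ n, ‖H1.grad Ω (w n)‖ ≤ (volume.real Ω + 1) * |(L : ℝ)| := by
    intro n
    refine norm_Lp_two_le_of_bound ?_ hΩ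
    filter_upwards [hwg n] with x h1
    rw [h1, norm_gradient]
    exact norm_fderiv_le_of_lipschitz ℝ (hvL n)
  have htend : Filter.Tendsto (fun n => H1.toL2 Ω (w n)) Filter.atTop (𝓝 g) := by
    rw [tendsto_iff_norm_sub_tendsto_zero]
    refine squeeze_zero (fun _ => norm_nonneg _) hdiff ?_
    have h1 : Filter.Tendsto (fun n : ℕ => 1 / ((n : ℝ) + 1)) Filter.atTop (𝓝 0) :=
      tendsto_one_div_add_atTop_nhds_zero_nat
    have h2 := ((h1.const_mul 2).abs).const_mul (volume.real Ω + 1)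
    simpa using h2
  obtain ⟨R, hR⟩ : ∃ R, ∀ n, ‖H1.toL2 Ω (w n)‖ ≤ R := by
    obtain ⟨R, hR⟩ := htend.norm.bddAbove_range
    exact ⟨R, fun n => hR ⟨n, rfl⟩⟩
  have hbound : ∀ n, ‖(⟨w n, hmem n⟩ : H10 Ω γ)‖ ≤ R + (volume.real Ω + 1) * |(L : ℝ)| := by
    intro n
    change ‖w n‖ ≤ _
    have h1 := H1.norm_sq (w n)
    have h2 := hR n
    have h3 := hgrad n
    have h4 := norm_nonneg (H1.toL2 Ω (w n))
    have h5 := norm_nonneg (H1.grad Ω (w n))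
    have h6 : ‖w n‖ ≤ ‖H1.toL2 Ω (w n)‖ + ‖H1.grad Ω (w n)‖ := by
      refine le_of_sq_le_sq ?_ (by positivity)
      rw [h1]; nlinarith
    linarith
  obtain ⟨u, hu⟩ := exists_preimage_of_bounded (H10.toL2 Ω γ) hbound (x := g) htend
  refine ⟨u, ?_⟩
  rw [hu]
  exact hGm.coeFn_toLp

end Sobolev

/-! ### Existence of the nodal basis -/

section Nodal

variable {d : ℕ} {Ω γ : Set (E d)} {𝒯 : Finset (Finset (E d))}

/-- Barycentric coordinates of simplices of a conforming partition agree on intersections. -/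
lemma IsConformingPartition.bary_eq_bary (h : IsConformingPartition Ω 𝒯) {T T' : Finset (E d)}
    (hT : T ∈ 𝒯) (hT' : T' ∈ 𝒯) {x : E d} (hx : x ∈ Δ T) (hx' : x ∈ Δ T') (w : E d) :
    bary T w x = bary T' w x := by
  classical
  have hS := h.isSimplex hT
  have hS' := h.isSimplex hT'
  have hxF : x ∈ Δ (T ∩ T') := by rw [← h.inter_eq_hull hT hT']; exact ⟨hx, hx'⟩
  have h1 := ((hS.mem_subface Finset.inter_subset_left).1 hxF).2
  have hsub : T ∩ T' ⊆ T := Finset.inter_subset_left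
  have hsub' : T ∩ T' ⊆ T' := Finset.inter_subset_right
  -- The coordinates with respect to `T` vanish off `T ∩ T'`, so they also represent `x` by the
  -- vertices of `T'`; uniqueness identifies them with the coordinates there.
  have e1 : ∑ w ∈ T', bary T w x = 1 := by
    rw [← Finset.sum_subset hsub' fun w _ hw => h1 w hw, ← hS.sum_bary x]
    exact Finset.sum_subset hsub fun w _ hw => h1 w hw
  have e2 : ∑ w ∈ T', bary T w x • w = x := by
    rw [← Finset.sum_subset hsub' fun w _ hw => by rw [h1 w hw, zero_smul]]
    conv_rhs => rw [← hS.sum_bary_smul x]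
    exact Finset.sum_subset hsub fun w _ hw => by rw [h1 w hw, zero_smul]
  by_cases hw : w ∈ T'
  · have := hS'.bary_sum_smul e1 hw
    rw [e2] at this
    exact this.symm
  · rw [bary_of_notMem hw, h1 w (fun hh => hw (Finset.mem_inter.1 hh).2)]

/-- The differences of convex combinations in two simplices of a conforming partition determine
the differences of the weights. -/
lemma IsConformingPartition.coeff_eq_zero [DecidableEq (E d)] (h : IsConformingPartition Ω 𝒯)
    {T T' : Finset (E d)} (hT : T ∈ 𝒯) (hT' : T' ∈ 𝒯) {c : E d → ℝ} (h0 : ∑ v ∈ T ∪ T', c v = 0)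
    (hc' : ∀ v, v ∉ T' → 0 ≤ c v) (hc : ∀ v, v ∉ T → c v ≤ 0)
    (hs : ∑ v ∈ T ∪ T', c v • v = 0) : ∀ v ∈ T ∪ T', c v = 0 := by
  -- The sign conditions make the positive part of `c` live on `T` and the negative part on `T'`.
  -- The two parts have equal mass `σ`, and divided by `σ` they represent the same point `z` in both
  -- simplices. Conformity then makes them equal.
  set p : E d → ℝ := fun v => max (c v) 0 with hp
  set n : E d → ℝ := fun v => max (-c v) 0 with hn
  have hp0 : ∀ v, 0 ≤ p v := fun v => le_max_right _ _
  have hn0 : ∀ v, 0 ≤ n v := fun v => le_max_right _ _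
  have hpn : ∀ v, c v = p v - n v := fun v => by
    simp only [hp, hn]
    rcases max_cases (c v) 0 with ⟨h1, h1'⟩ | ⟨h1, h1'⟩ <;>
    rcases max_cases (-c v) 0 with ⟨h2, h2'⟩ | ⟨h2, h2'⟩ <;> rw [h1, h2] <;> linarith
  have hpT : ∀ v, v ∉ T → p v = 0 := fun v hv => max_eq_right (hc v hv)
  have hnT : ∀ v, v ∉ T' → n v = 0 := fun v hv => max_eq_right (by linarith [hc' v hv])
  have eT : ∀ {M : Type} [AddCommMonoid M] (f : E d → M), (∀ v, v ∉ T → f v = 0) →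
      ∑ v ∈ T ∪ T', f v = ∑ v ∈ T, f v := fun f hf =>
    (Finset.sum_subset Finset.subset_union_left fun v _ hv => hf v hv).symm
  have eT' : ∀ {M : Type} [AddCommMonoid M] (f : E d → M), (∀ v, v ∉ T' → f v = 0) →
      ∑ v ∈ T ∪ T', f v = ∑ v ∈ T', f v := fun f hf =>
    (Finset.sum_subset Finset.subset_union_right fun v _ hv => hf v hv).symm
  set σ := ∑ v ∈ T, p v with hσ
  have hσ' : ∑ v ∈ T', n v = σ := by
    have h1 : ∑ v ∈ T ∪ T', (p v - n v) = 0 := by rw [← h0]; simp only [hpn]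
    rw [Finset.sum_sub_distrib, eT _ hpT, eT' _ hnT] at h1
    linarith
  have hx : ∑ v ∈ T, p v • v = ∑ v ∈ T', n v • v := by
    have h1 : ∑ v ∈ T ∪ T', (p v • v - n v • v) = 0 := by
      rw [← hs]; simp only [hpn, sub_smul]
    rw [Finset.sum_sub_distrib, eT _ (fun v hv => by rw [hpT v hv, zero_smul]),
      eT' _ (fun v hv => by rw [hnT v hv, zero_smul])] at h1
    exact sub_eq_zero.1 h1
  have hσ0 : 0 ≤ σ := Finset.sum_nonneg fun v _ => hp0 v
  have heq : ∀ v, p v = n v := by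
    rcases hσ0.eq_or_lt with hz | hpos
    · have h1 := (Finset.sum_eq_zero_iff_of_nonneg fun v _ => hp0 v).1 (hσ.symm.trans hz.symm)
      have h2 := (Finset.sum_eq_zero_iff_of_nonneg fun v _ => hn0 v).1 (hσ'.trans hz.symm)
      intro v
      have e1 : p v = 0 := by by_cases hv : v ∈ T; exacts [h1 v hv, hpT v hv]
      have e2 : n v = 0 := by by_cases hv : v ∈ T'; exacts [h2 v hv, hnT v hv]
      rw [e1, e2]
    · have s1 : ∑ v ∈ T, p v / σ = 1 := by rw [← Finset.sum_div, div_self hpos.ne']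
      have s2 : ∑ v ∈ T', n v / σ = 1 := by rw [← Finset.sum_div, hσ', div_self hpos.ne']
      set z := ∑ v ∈ T, (p v / σ) • v with hz
      have hz' : z = ∑ v ∈ T', (n v / σ) • v := by
        simp only [hz, div_eq_inv_mul, mul_smul, ← Finset.smul_sum, hx]
      have m1 : z ∈ Δ T := (convex_convexHull ℝ _).sum_mem
        (fun v _ => div_nonneg (hp0 v) hpos.le) s1 fun v hv => subset_convexHull ℝ _ hv
      have m2 : z ∈ Δ T' := by
        rw [hz']
        exact (convex_convexHull ℝ _).sum_mem
          (fun v _ => div_nonneg (hn0 v) hpos.le) s2 fun v hv => subset_convexHull ℝ _ hv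
      intro v
      have b1 : bary T v z = p v / σ := by
        by_cases hv : v ∈ T
        · exact (h.isSimplex hT).bary_sum_smul s1 hv
        · rw [bary_of_notMem hv, hpT v hv, zero_div]
      have b2 : bary T' v z = n v / σ := by
        by_cases hv : v ∈ T'
        · rw [hz']; exact (h.isSimplex hT').bary_sum_smul s2 hv
        · rw [bary_of_notMem hv, hnT v hv, zero_div]
      have := h.bary_eq_bary hT hT' m1 m2 v
      rw [b1, b2] at this
      field_simp at this
      exact this
  intro v _
  rw [hpn, heq, sub_self]

/-- Barycentric coordinates are jointly Lipschitz continuous across two simplices. -/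
lemma IsConformingPartition.exists_lipschitz_pair (h : IsConformingPartition Ω 𝒯)
    {T T' : Finset (E d)} (hT : T ∈ 𝒯) (hT' : T' ∈ 𝒯) :
    ∃ L : ℝ, 0 ≤ L ∧ ∀ x ∈ Δ T, ∀ y ∈ Δ T', ∀ w,
      |bary T w x - bary T' w y| ≤ L * dist x y := by
  classical
  let V := T ∪ T'
  -- Differences of coordinates of points of `T` and `T'` lie in a closed cone on which `c ↦ ∑ c_v
  -- v` vanishes only at zero. Compactness of the unit sphere of this cone bounds the map below by
  -- some `δ`. The constant `δ⁻¹` depends on the two simplices and enters no uniform estimate.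
  let K : Set (V → ℝ) := {c | ‖c‖ = 1 ∧ ∑ v, c v = 0 ∧ (∀ v : V, (v : E d) ∉ T' → 0 ≤ c v) ∧
    ∀ v : V, (v : E d) ∉ T → c v ≤ 0}
  have hKc : IsCompact K := by
    refine (isCompact_sphere (0 : V → ℝ) 1).of_isClosed_subset ?_ fun c hc => by simpa using hc.1
    refine (isClosed_eq continuous_norm continuous_const).inter
      ((isClosed_eq (by fun_prop) continuous_const).inter (IsClosed.inter ?_ ?_))
    · change IsClosed {c : V → ℝ | ∀ v : V, (v : E d) ∉ T' → 0 ≤ c v}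
      simp only [Set.ofPred_forall]
      exact isClosed_iInter fun v => isClosed_iInter fun _ =>
        isClosed_le continuous_const (continuous_apply v)
    · change IsClosed {c : V → ℝ | ∀ v : V, (v : E d) ∉ T → c v ≤ 0}
      simp only [Set.ofPred_forall]
      exact isClosed_iInter fun v => isClosed_iInter fun _ =>
        isClosed_le (continuous_apply v) continuous_const
  let M : (V → ℝ) → E d := fun c => ∑ v, c v • (v : E d)
  have hMc : Continuous M := by fun_prop
  have hMpos : ∀ c ∈ K, 0 < ‖M c‖ := by
    rintro c ⟨h1, h2, h3, h4⟩
    rw [norm_pos_iff]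
    intro h0
    let c' : E d → ℝ := fun v => if hv : v ∈ V then c ⟨v, hv⟩ else 0
    have hc' : ∀ v : V, c' v = c v := fun v => by simp only [c', dif_pos v.2]
    have key := h.coeff_eq_zero hT hT' (c := c')
      (by
        change ∑ v ∈ V, c' v = 0
        rw [← Finset.sum_coe_sort, ← h2]; simp only [hc'])
      (fun v hv => by
        simp only [c']; split_ifs with hvV
        exacts [h3 ⟨v, hvV⟩ hv, le_rfl])
      (fun v hv => by
        simp only [c']; split_ifs with hvV
        exacts [h4 ⟨v, hvV⟩ hv, le_rfl])
      (by
        change ∑ v ∈ V, c' v • v = 0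
        rw [← Finset.sum_coe_sort V (fun v => c' v • v), ← h0]
        simp only [hc', M])
    have : c = 0 := by
      ext v
      rw [← hc', key v v.2]; rfl
    rw [this, norm_zero] at h1
    exact zero_ne_one h1
  obtain ⟨δ, hδ, hδK⟩ : ∃ δ > 0, ∀ c ∈ K, δ ≤ ‖M c‖ := by
    rcases K.eq_empty_or_nonempty with he | hne
    · exact ⟨1, one_pos, fun c hc => by rw [he] at hc; exact absurd hc (notMem_empty c)⟩
    · obtain ⟨c₀, hc₀, hmin⟩ := hKc.exists_isMinOn hne hMc.norm.continuousOn
      exact ⟨‖M c₀‖, hMpos c₀ hc₀, fun c hc => hmin hc⟩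
  refine ⟨δ⁻¹, by positivity, fun x hx y hy w => ?_⟩
  have hS := h.isSimplex hT
  have hS' := h.isSimplex hT'
  let c : V → ℝ := fun v => bary T v x - bary T' v y
  have sx : ∑ v ∈ V, bary T v x = 1 := by
    rw [← hS.sum_bary x]
    exact (Finset.sum_subset Finset.subset_union_left fun v _ hv => bary_of_notMem hv x).symm
  have sy : ∑ v ∈ V, bary T' v y = 1 := by
    rw [← hS'.sum_bary y]
    exact (Finset.sum_subset Finset.subset_union_right fun v _ hv => bary_of_notMem hv y).symm
  have sx' : ∑ v ∈ V, bary T v x • v = x := by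
    conv_rhs => rw [← hS.sum_bary_smul x]
    exact (Finset.sum_subset Finset.subset_union_left fun v _ hv => by
      rw [bary_of_notMem hv x, zero_smul]).symm
  have sy' : ∑ v ∈ V, bary T' v y • v = y := by
    conv_rhs => rw [← hS'.sum_bary_smul y]
    exact (Finset.sum_subset Finset.subset_union_right fun v _ hv => by
      rw [bary_of_notMem hv y, zero_smul]).symm
  have hMcx : M c = x - y := by
    simp only [M, c]
    rw [Finset.sum_coe_sort V (fun v => (bary T v x - bary T' v y) • v)]
    simp only [sub_smul]
    rw [Finset.sum_sub_distrib, sx', sy']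
  have hbound : ‖c‖ ≤ δ⁻¹ * dist x y := by
    rcases eq_or_ne c 0 with h0 | h0
    · rw [h0, norm_zero]; positivity
    have hn : 0 < ‖c‖ := norm_pos_iff.2 h0
    have hcK : ‖c‖⁻¹ • c ∈ K := by
      refine ⟨?_, ?_, fun v hv => ?_, fun v hv => ?_⟩
      · rw [norm_smul, norm_inv, norm_norm, inv_mul_cancel₀ hn.ne']
      · simp only [Pi.smul_apply, smul_eq_mul, ← Finset.mul_sum]
        simp only [c]
        rw [Finset.sum_coe_sort V (fun v => (bary T v x - bary T' v y)), Finset.sum_sub_distrib,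
          sx, sy, sub_self, mul_zero]
      · simp only [Pi.smul_apply, smul_eq_mul, c, bary_of_notMem hv, sub_zero]
        exact mul_nonneg (by positivity) (hS.bary_nonneg hx _)
      · simp only [Pi.smul_apply, smul_eq_mul, c, bary_of_notMem hv, zero_sub]
        exact mul_nonpos_of_nonneg_of_nonpos (by positivity)
          (neg_nonpos.2 (hS'.bary_nonneg hy _))
    have h1 := hδK _ hcK
    have h2 : M (‖c‖⁻¹ • c) = ‖c‖⁻¹ • M c := by
      simp only [M, Pi.smul_apply, smul_eq_mul, mul_smul, ← Finset.smul_sum]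
    rw [h2, hMcx, norm_smul, norm_inv, norm_norm, ← dist_eq_norm] at h1
    rw [inv_mul_eq_div, le_div_iff₀ hδ]
    rw [inv_mul_eq_div, le_div_iff₀ hn] at h1
    linarith
  by_cases hw : w ∈ V
  · refine le_trans ?_ hbound
    exact norm_le_pi_norm c ⟨w, hw⟩
  · rw [bary_of_notMem (fun hh => hw (Finset.mem_union_left _ hh)),
      bary_of_notMem (fun hh => hw (Finset.mem_union_right _ hh)), sub_zero, abs_zero]
    positivity

open Classical in
/-- The continuous piecewise linear function with value `1` at `ν` and `0` at all other
vertices. -/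
def hat (𝒯 : Finset (Finset (E d))) (ν x : E d) : ℝ :=
  if h : ∃ T ∈ 𝒯, x ∈ Δ T then bary h.choose ν x else 0

lemma IsConformingPartition.hat_eq (h : IsConformingPartition Ω 𝒯) {T : Finset (E d)}
    (hT : T ∈ 𝒯) {x : E d} (hx : x ∈ Δ T) (ν : E d) : hat 𝒯 ν x = bary T ν x := by
  have hex : ∃ T ∈ 𝒯, x ∈ Δ T := ⟨T, hT, hx⟩
  rw [hat, dif_pos hex]
  exact h.bary_eq_bary hex.choose_spec.1 hT hex.choose_spec.2 hx ν

/-- Points of two simplices are compared directly in the Euclidean distance, not along paths in `Ω`,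
so the function extends to a Lipschitz function on the whole space. Summing the constants of all
pairs dominates each of them. -/
lemma IsConformingPartition.exists_lipschitzOnWith_hat (h : IsConformingPartition Ω 𝒯) (ν : E d) :
    ∃ L : ℝ≥0, LipschitzOnWith L (hat 𝒯 ν) (closure Ω) := by
  classical
  have hex : ∀ T T' : Finset (E d), ∃ L : ℝ, 0 ≤ L ∧ (T ∈ 𝒯 → T' ∈ 𝒯 → ∀ x ∈ Δ T, ∀ y ∈ Δ T',
      ∀ w, |bary T w x - bary T' w y| ≤ L * dist x y) := by
    intro T T'
    by_cases hT : T ∈ 𝒯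
    · by_cases hT' : T' ∈ 𝒯
      · obtain ⟨L, hL, hL'⟩ := h.exists_lipschitz_pair hT hT'
        exact ⟨L, hL, fun _ _ => hL'⟩
      · exact ⟨0, le_rfl, fun _ h' => absurd h' hT'⟩
    · exact ⟨0, le_rfl, fun h' => absurd h' hT⟩
  choose L hL0 hL using hex
  have hsum0 : 0 ≤ ∑ T ∈ 𝒯, ∑ T' ∈ 𝒯, L T T' :=
    Finset.sum_nonneg fun T _ => Finset.sum_nonneg fun T' _ => hL0 T T'
  refine ⟨⟨_, hsum0⟩, LipschitzOnWith.of_dist_le_mul fun x hx y hy => ?_⟩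
  obtain ⟨T, hT, hxT⟩ := h.exists_mem_hull hx
  obtain ⟨T', hT', hyT'⟩ := h.exists_mem_hull hy
  rw [h.hat_eq hT hxT, h.hat_eq hT' hyT', Real.dist_eq]
  refine (hL T T' hT hT' x hxT y hyT' ν).trans ?_
  refine mul_le_mul_of_nonneg_right ?_ dist_nonneg
  calc L T T' ≤ ∑ S' ∈ 𝒯, L T S' :=
        Finset.single_le_sum (f := fun S' => L T S') (fun S' _ => hL0 T S') hT'
    _ ≤ _ := Finset.single_le_sum (f := fun S => ∑ S' ∈ 𝒯, L S S')
        (fun S _ => Finset.sum_nonneg fun S' _ => hL0 S S') hT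

lemma IsConformingPartition.isContPiecewiseLinear_hat (h : IsConformingPartition Ω 𝒯) (ν : E d) :
    IsContPiecewiseLinear Ω 𝒯 (hat 𝒯 ν) := by
  obtain ⟨L, hL⟩ := h.exists_lipschitzOnWith_hat ν
  exact ⟨hL.continuousOn, fun T hT => ⟨bary T ν, fun x hx => h.hat_eq hT hx ν⟩⟩

/-- As `ν` is not in `γ`, it is not a vertex of any face that makes up `γ`, and its coordinate
vanishes on those faces. -/
lemma IsConformingPartition.hat_eq_zero_of_mem (h : IsConformingPartition Ω 𝒯)
    (hγ : IsUnionOfFaces 𝒯 γ) {ν : E d} (hν : ν ∉ γ) {x : E d} (hx : x ∈ γ) :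
    x ∈ closure Ω ∧ hat 𝒯 ν x = 0 := by
  obtain ⟨ℱ, hℱ, rfl⟩ := hγ
  obtain ⟨F, hF, hxF⟩ := mem_iUnion₂.1 hx
  obtain ⟨_, T, hT, hFT⟩ := hℱ F hF
  have h1 := ((h.isSimplex hT).mem_subface hFT).1 hxF
  refine ⟨h.hull_subset_closure hT h1.1, ?_⟩
  rw [h.hat_eq hT h1.1]
  exact h1.2 ν fun hh => hν (mem_iUnion₂.2 ⟨F, hF, subset_convexHull ℝ _ hh⟩)

/-- The nodal basis functions exist in `H¹_{0,γ}(Ω)`. -/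
theorem isNodal_nodal (hΩ : IsPolytopalDomain Ω) (h : IsConformingPartition Ω 𝒯)
    (hγ : IsUnionOfFaces 𝒯 γ) {ν : E d} (hν : ν ∈ freeVertices 𝒯 γ) :
    IsNodal Ω γ 𝒯 ν (nodal Ω γ 𝒯 ν) := by
  refine Classical.epsilon_spec (p := IsNodal Ω γ 𝒯 ν) ?_
  obtain ⟨hνv, hνγ⟩ := mem_freeVertices.1 hν
  obtain ⟨L, hL⟩ := h.exists_lipschitzOnWith_hat ν
  obtain ⟨G, hG, hGe⟩ := hL.extend_real
  obtain ⟨u, hu⟩ := exists_H10_of_lipschitz (γ := γ) hΩ.isBounded hG fun x hx => by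
    obtain ⟨h1, h2⟩ := h.hat_eq_zero_of_mem hγ hνγ hx
    rw [← hGe h1, h2]
  refine ⟨u, hat 𝒯 ν, h.isContPiecewiseLinear_hat ν, ?_, fun ν' hν' hne => ?_, ?_⟩
  · obtain ⟨T, hT, hνT⟩ := mem_vertices.1 hνv
    rw [h.hat_eq hT (subset_convexHull ℝ _ hνT), (h.isSimplex hT).bary_self hνT]
  · obtain ⟨T, hT, hνT⟩ := mem_vertices.1 hν'
    rw [h.hat_eq hT (subset_convexHull ℝ _ hνT), (h.isSimplex hT).bary_of_ne hνT hne]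
  · have hm : ∀ᵐ x ∂volume.restrict Ω, x ∈ closure Ω :=
      ae_restrict_of_forall_mem hΩ.isOpen.measurableSet fun x hx => subset_closure hx
    filter_upwards [hu, hm] with x hx hxm
    rw [hx, hGe hxm]

end Nodal

/-! ### Finite element functions simplex by simplex; size of the nodal functions. -/

section NodalProperties

variable {d : ℕ} {Ω γ : Set (E d)} {𝒯 : Finset (Finset (E d))}

/-- On each simplex, a continuous piecewise linear function is the linear interpolant of its nodal
values. -/
lemma IsContPiecewiseLinear.eq_sum (h : IsConformingPartition Ω 𝒯) {g : E d → ℝ}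
    (hg : IsContPiecewiseLinear Ω 𝒯 g) {T : Finset (E d)} (hT : T ∈ 𝒯) {x : E d} (hx : x ∈ Δ T) :
    g x = ∑ w ∈ T, g w * bary T w x := by
  obtain ⟨a, ha⟩ := hg.2 T hT
  rw [ha hx, (h.isSimplex hT).affineMap_apply a x]
  refine Finset.sum_congr rfl fun w hw => ?_
  rw [ha (subset_convexHull ℝ _ hw), mul_comm]

/-- On each simplex, the nodal basis functions are barycentric coordinates. -/
lemma nodalL2_ae_eq (hΩ : IsPolytopalDomain Ω) (h : IsConformingPartition Ω 𝒯)
    (hγ : IsUnionOfFaces 𝒯 γ) {ν : E d} (hν : ν ∈ freeVertices 𝒯 γ) {T : Finset (E d)}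
    (hT : T ∈ 𝒯) : nodalL2 Ω γ 𝒯 ν =ᵐ[volume.restrict (Δ T)] bary T ν := by
  obtain ⟨g, hg, h1, h0, hu⟩ := isNodal_nodal hΩ h hγ hν
  have hu' := ae_mono (h.restrict_hull_le hΩ.interior_closure hT) hu
  filter_upwards [hu', ae_restrict_mem (measurableSet_hull T)] with x hx hxT
  refine hx.trans ?_
  rw [hg.eq_sum h hT hxT]
  by_cases hνT : ν ∈ T
  · rw [Finset.sum_eq_single_of_mem ν hνT, h1, one_mul]
    intro w hw hne
    rw [h0 w (mem_vertices.2 ⟨T, hT, hw⟩) hne, zero_mul]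
  · rw [bary_of_notMem hνT]
    refine Finset.sum_eq_zero fun w hw => ?_
    rw [h0 w (mem_vertices.2 ⟨T, hT, hw⟩) (fun hh => hνT (hh ▸ hw)), zero_mul]

lemma bary_eq_linear_add (T : Finset (E d)) (w x : E d) :
    bary T w x = LinearMap.toContinuousLinearMap (bary T w).linear x + bary T w 0 := by
  have := congrFun (bary T w).decomp x
  simpa using this

lemma contDiff_bary (T : Finset (E d)) (w : E d) : ContDiff ℝ 1 (bary T w) := by
  have : (bary T w : E d → ℝ) =
      fun x => LinearMap.toContinuousLinearMap (bary T w).linear x + bary T w 0 :=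
    funext fun x => bary_eq_linear_add T w x
  rw [this]
  exact (ContinuousLinearMap.contDiff _).add contDiff_const

lemma fderiv_bary (T : Finset (E d)) (w x : E d) :
    fderiv ℝ (bary T w) x = LinearMap.toContinuousLinearMap (bary T w).linear := by
  have : (bary T w : E d → ℝ) =
      fun x => LinearMap.toContinuousLinearMap (bary T w).linear x + bary T w 0 :=
    funext fun x => bary_eq_linear_add T w x
  rw [this, fderiv_add_const, ContinuousLinearMap.fderiv]

/-- The constant gradient of a barycentric coordinate. -/
def baryGrad (T : Finset (E d)) (w : E d) : E d := gradient (bary T w) 0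

lemma gradient_bary (T : Finset (E d)) (w x : E d) : gradient (bary T w) x = baryGrad T w := by
  simp only [baryGrad, gradient, fderiv_bary]

lemma IsSimplex.norm_baryGrad_le {T : Finset (E d)} (hT : IsSimplex T) (w : E d) {x : E d} {r : ℝ}
    (hr : 0 < r) (hx : Metric.closedBall x r ⊆ Δ T) : 2 * r * ‖baryGrad T w‖ ≤ 1 := by
  have h1 := hT.norm_bary_linear_le w hr hx (baryGrad T w)
  have h2 : (bary T w).linear (baryGrad T w) = ‖baryGrad T w‖ ^ 2 := by
    rw [← real_inner_self_eq_norm_sq]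
    nth_rw 2 [baryGrad]
    rw [inner_gradient, fderiv_bary]
    rfl
  rw [h2, abs_of_nonneg (sq_nonneg _)] at h1
  rcases (norm_nonneg (baryGrad T w)).eq_or_lt with h0 | h0
  · rw [← h0, mul_zero]; exact zero_le_one
  · refine le_of_mul_le_mul_right ?_ h0
    nlinarith

/-- The gradient of the identity that the coordinates add up to one. It permits subtracting any
constant from the nodal coefficients in a gradient bound. -/
lemma IsSimplex.sum_baryGrad {T : Finset (E d)} (hT : IsSimplex T) :
    ∑ w ∈ T, baryGrad T w = 0 := by
  refine ext_inner_right ℝ fun v => ?_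
  rw [sum_inner, inner_zero_left]
  have h1 := hT.sum_bary v
  have h0 := hT.sum_bary 0
  have : ∀ w, inner ℝ (baryGrad T w) v = bary T w v - bary T w 0 := by
    intro w
    rw [baryGrad, inner_gradient, fderiv_bary, bary_eq_linear_add T w v]
    ring
  simp only [this, Finset.sum_sub_distrib, h1, h0, sub_self]

lemma grad_nodal_ae_eq (hΩ : IsPolytopalDomain Ω) (h : IsConformingPartition Ω 𝒯)
    (hγ : IsUnionOfFaces 𝒯 γ) {ν : E d} (hν : ν ∈ freeVertices 𝒯 γ) {T : Finset (E d)}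
    (hT : T ∈ 𝒯) :
    ∀ᵐ x ∂volume.restrict (Δ T), H1.grad Ω (nodal Ω γ 𝒯 ν : H1 Ω) x = baryGrad T ν := by
  have h1 := nodalL2_ae_eq hΩ h hγ hν hT
  rw [← restrict_interior_hull] at h1 ⊢
  have h2 := H1.grad_ae_eq hΩ.isBounded isOpen_interior
    (h.interior_hull_subset hΩ.interior_closure hT) (contDiff_bary T ν)
    (u := (nodal Ω γ 𝒯 ν : H1 Ω)) h1
  filter_upwards [h2] with x hx
  rw [hx, gradient_bary]

lemma IsConformingPartition.enorm_Lp_sq (h : IsConformingPartition Ω 𝒯)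
    (hΩ : interior (closure Ω) = Ω) {F : Type*} [NormedAddCommGroup F]
    (f : Lp F 2 (volume.restrict Ω)) :
    ‖f‖ₑ ^ 2 = ∑ T ∈ 𝒯, ∫⁻ x in Δ T, ‖f x‖ₑ ^ 2 := by
  rw [enorm_Lp_two_sq, h.lintegral_eq_sum hΩ]

/-- On the copy of `T` shrunk by one half towards `ν` the coordinate is at least one half. The copy
has `2 ^ (-d)` of the volume, and squaring gives another factor `1/4`. -/
lemma IsSimplex.le_lintegral_bary_sq {T : Finset (E d)} (hT : IsSimplex T) {ν : E d}
    (hν : ν ∈ T) :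
    ENNReal.ofReal ((2 ^ (d + 2))⁻¹ * volume.real (Δ T)) ≤ ∫⁻ x in Δ T, ‖bary T ν x‖ₑ ^ 2 := by
  set S := AffineMap.homothety ν (2⁻¹ : ℝ) '' (Δ T) with hS
  have hνT : ν ∈ Δ T := subset_convexHull ℝ _ hν
  have hsub : S ⊆ Δ T := by
    rintro _ ⟨x, hx, rfl⟩
    rw [AffineMap.homothety_apply, vsub_eq_sub, vadd_eq_add, add_comm]
    exact (convex_convexHull ℝ _).add_smul_sub_mem hνT hx ⟨by norm_num, by norm_num⟩
  have hSm : MeasurableSet S :=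
    ((isCompact_hull T).image (AffineMap.continuous_of_finiteDimensional _)).measurableSet
  have hvol : volume S = ENNReal.ofReal ((2 ^ d)⁻¹ * volume.real (Δ T)) := by
    rw [hS, Measure.addHaar_image_homothety, finrank_euclideanSpace_fin,
      ENNReal.ofReal_mul (by positivity), measureReal_def,
      ENNReal.ofReal_toReal (volume_hull_lt_top T).ne, abs_of_pos (by positivity), inv_pow]
  calc _ = ∫⁻ _ in S, ENNReal.ofReal (2⁻¹ ^ 2) := by
        rw [setLIntegral_const, hvol, ← ENNReal.ofReal_mul (by positivity)]
        congr 1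
        rw [pow_add]; field_simp
    _ ≤ ∫⁻ x in S, ‖bary T ν x‖ₑ ^ 2 := by
        refine setLIntegral_mono' hSm fun x hx => ?_
        rw [enorm_sq_eq]
        apply ENNReal.ofReal_le_ofReal
        obtain ⟨y, hy, rfl⟩ := hx
        have h1 : bary T ν (AffineMap.homothety ν (2⁻¹ : ℝ) y) = 2⁻¹ * bary T ν y + 2⁻¹ := by
          rw [AffineMap.homothety_eq_lineMap, AffineMap.apply_lineMap, hT.bary_self hν,
            AffineMap.lineMap_apply]
          simp; ring
        rw [h1]
        have := hT.bary_nonneg hy ν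
        gcongr
        linarith
    _ ≤ _ := lintegral_mono_set hsub

/-- Valid for each simplex of the star separately, so the `L₂` bound needs no comparison of
neighbouring sizes. -/
lemma enorm_nodalL2_lower (hΩ : IsPolytopalDomain Ω) (h : IsConformingPartition Ω 𝒯)
    (hγ : IsUnionOfFaces 𝒯 γ) {ν : E d} (hν : ν ∈ freeVertices 𝒯 γ) {T : Finset (E d)}
    (hT : T ∈ star 𝒯 ν) :
    (2 ^ (d + 2))⁻¹ * volume.real (Δ T) ≤ ‖nodalL2 Ω γ 𝒯 ν‖ ^ 2 := by
  obtain ⟨hT𝒯, hνT⟩ := mem_star.1 hT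
  have h1 : ENNReal.ofReal ((2 ^ (d + 2))⁻¹ * volume.real (Δ T)) ≤
      ENNReal.ofReal (‖nodalL2 Ω γ 𝒯 ν‖ ^ 2) := by
    calc _ ≤ ∫⁻ x in Δ T, ‖bary T ν x‖ₑ ^ 2 := (h.isSimplex hT𝒯).le_lintegral_bary_sq hνT
      _ = ∫⁻ x in Δ T, ‖nodalL2 Ω γ 𝒯 ν x‖ₑ ^ 2 := by
          refine lintegral_congr_ae ?_
          filter_upwards [nodalL2_ae_eq hΩ h hγ hν hT𝒯] with x hx
          rw [hx]
      _ ≤ ∑ T ∈ 𝒯, ∫⁻ x in Δ T, ‖nodalL2 Ω γ 𝒯 ν x‖ₑ ^ 2 :=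
          Finset.single_le_sum (f := fun T : Finset (E d) =>
            ∫⁻ x in Δ T, ‖nodalL2 Ω γ 𝒯 ν x‖ₑ ^ 2) (fun _ _ => bot_le) hT𝒯
      _ = _ := by
          rw [← h.enorm_Lp_sq hΩ.interior_closure, ← ofReal_norm,
            ENNReal.ofReal_pow (norm_nonneg _)]
  exact (ENNReal.ofReal_le_ofReal_iff (sq_nonneg _)).1 h1

lemma norm_nodalL2_pos (hΩ : IsPolytopalDomain Ω) (h : IsConformingPartition Ω 𝒯)
    (hγ : IsUnionOfFaces 𝒯 γ) {ν : E d} (hν : ν ∈ freeVertices 𝒯 γ) :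
    0 < ‖nodalL2 Ω γ 𝒯 ν‖ := by
  obtain ⟨T, hT, hνT⟩ := mem_vertices.1 (mem_freeVertices.1 hν).1
  have h1 := enorm_nodalL2_lower hΩ h hγ hν (mem_star.2 ⟨hT, hνT⟩)
  have h2 := (h.isSimplex hT).volume_real_pos
  have h3 : 0 < ‖nodalL2 Ω γ 𝒯 ν‖ ^ 2 := lt_of_lt_of_le (by positivity) h1
  exact (sq_pos_iff.1 h3).symm.lt_of_le (norm_nonneg _)

/-- Finite element functions are combinations of the nodal basis functions. -/
lemma toL2_eq_sum_of_mem_feSpace (hΩ : IsPolytopalDomain Ω) (h : IsConformingPartition Ω 𝒯)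
    (hγ : IsUnionOfFaces 𝒯 γ) {u : H10 Ω γ} (hu : u ∈ feSpace Ω γ 𝒯) :
    ∃ a : freeVertices 𝒯 γ → ℝ, H10.toL2 Ω γ u = ∑ ν, a ν • nodalL2 Ω γ 𝒯 ν := by
  classical
  obtain ⟨g, hg, hg0, hug⟩ := hu
  refine ⟨fun ν => g ν, ?_⟩
  refine Lp.ext ((h.ae_restrict_iff hΩ.interior_closure).2 fun T hT => ?_)
  have hle := h.restrict_hull_le hΩ.interior_closure hT
  have h1 := ae_mono hle hug
  have h2 := ae_mono hle (Lp.coeFn_finsetSum Finset.univ fun ν : freeVertices 𝒯 γ =>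
    g ν • nodalL2 Ω γ 𝒯 ν)
  have h3 : ∀ᵐ x ∂volume.restrict (Δ T), ∀ ν : freeVertices 𝒯 γ,
      (g ν • nodalL2 Ω γ 𝒯 ν : L2 Ω) x = g ν * bary T ν x := by
    refine ae_all_iff.2 fun ν => ?_
    filter_upwards [ae_mono hle (Lp.coeFn_smul (g ν) (nodalL2 Ω γ 𝒯 ν)),
      nodalL2_ae_eq hΩ h hγ ν.2 hT] with x hx hx'
    rw [hx, Pi.smul_apply, hx', smul_eq_mul]
  filter_upwards [h1, h2, h3, ae_restrict_mem (measurableSet_hull T)] with x e1 e2 e3 hxT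
  rw [e1, e2, hg.eq_sum h hT hxT]
  simp only [Finset.sum_apply, e3]
  rw [Finset.sum_coe_sort (freeVertices 𝒯 γ) (fun ν => g ν * bary T ν x)]
  have s1 : ∑ w ∈ T, g w * bary T w x = ∑ w ∈ vertices 𝒯, g w * bary T w x :=
    Finset.sum_subset (fun w hw => mem_vertices.2 ⟨T, hT, hw⟩) fun w _ hw => by
      rw [bary_of_notMem hw, mul_zero]
  rw [s1]
  refine (Finset.sum_subset (fun w hw => (mem_freeVertices.1 hw).1) fun w hw hw' => ?_).symm
  have : w ∈ γ := by
    by_contra hn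
    exact hw' (mem_freeVertices.2 ⟨hw, hn⟩)
  rw [hg0 w this, zero_mul]

lemma nodal_mem_feSpace (hΩ : IsPolytopalDomain Ω) (h : IsConformingPartition Ω 𝒯)
    (hγ : IsUnionOfFaces 𝒯 γ) {ν : E d} (hν : ν ∈ freeVertices 𝒯 γ) :
    nodal Ω γ 𝒯 ν ∈ feSpace Ω γ 𝒯 := by
  obtain ⟨g, hg, h1, h0, hu⟩ := isNodal_nodal hΩ h hγ hν
  refine ⟨g, hg, fun x hx => ?_, hu⟩
  obtain ⟨hcl, hx0⟩ := h.hat_eq_zero_of_mem hγ (mem_freeVertices.1 hν).2 hx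
  obtain ⟨T, hT, hxT⟩ := h.exists_mem_hull hcl
  rw [h.hat_eq hT hxT] at hx0
  rw [hg.eq_sum h hT hxT]
  refine Finset.sum_eq_zero fun w hw => ?_
  by_cases hwν : w = ν
  · rw [hwν, hx0, mul_zero]
  · rw [h0 w (mem_vertices.2 ⟨T, hT, hw⟩) hwν, zero_mul]

end NodalProperties

/-! ### The projector and its adjoint -/

section Projector

variable {d : ℕ} {Ω γ : Set (E d)} {𝒯 : Finset (Finset (E d))} {s : ℝ} {c C : ℝ}

lemma IsBiorthogonalLocal.inner_ne_zero {ψ : freeVertices 𝒯 γ → L2 Ω}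
    (hψ : IsBiorthogonalLocal Ω γ 𝒯 c C ψ) (hc : 0 < c) (hΩ : IsPolytopalDomain Ω)
    (h : IsConformingPartition Ω 𝒯) (hγ : IsUnionOfFaces 𝒯 γ) (ν : freeVertices 𝒯 γ) :
    inner ℝ (nodalL2 Ω γ 𝒯 ν) (ψ ν) ≠ 0 := by
  have h1 := hψ.lower ν ν
  rw [if_pos rfl, mul_one] at h1
  have h2 := norm_nodalL2_pos hΩ h hγ ν.2
  have h3 := norm_pos_iff.2 (hψ.ne_zero ν)
  exact abs_pos.1 (lt_of_lt_of_le (by positivity) h1)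

lemma IsBiorthogonalLocal.inner_eq_zero {ψ : freeVertices 𝒯 γ → L2 Ω}
    (hψ : IsBiorthogonalLocal Ω γ 𝒯 c C ψ) {ν ν' : freeVertices 𝒯 γ} (hne : ν ≠ ν') :
    inner ℝ (nodalL2 Ω γ 𝒯 ν) (ψ ν') = 0 := by
  have h1 := hψ.upper ν ν'
  rw [if_neg hne, mul_zero, zero_mul, zero_mul] at h1
  exact abs_nonpos_iff.1 h1

lemma toW_nodalV (hs : s ∈ Icc (0 : ℝ) 1) (w : L2 Ω) (ν : E d) :
    L2.toW Ω γ s w (nodalV Ω γ 𝒯 hs ν) = inner ℝ (nodalL2 Ω γ 𝒯 ν) w := by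
  rw [real_inner_comm]; rfl

lemma projW_apply (hs : s ∈ Icc (0 : ℝ) 1) (ψ : freeVertices 𝒯 γ → L2 Ω) (f : WSpace Ω γ s) :
    projW Ω γ hs ψ f = ∑ ν : freeVertices 𝒯 γ, ((inner ℝ (nodalL2 Ω γ 𝒯 ν) (ψ ν))⁻¹ *
      f (nodalV Ω γ 𝒯 hs ν)) • L2.toW Ω γ s (ψ ν) := by
  simp [projW, mul_smul]

lemma projV_apply (hs : s ∈ Icc (0 : ℝ) 1) (ψ : freeVertices 𝒯 γ → L2 Ω) (v : VSpace Ω γ s) :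
    projV Ω γ hs ψ v = ∑ ν : freeVertices 𝒯 γ, ((inner ℝ (nodalL2 Ω γ 𝒯 ν) (ψ ν))⁻¹ *
      L2.toW Ω γ s (ψ ν) v) • nodalV Ω γ 𝒯 hs ν := by
  simp [projV, mul_smul]

lemma projW_apply_apply (hs : s ∈ Icc (0 : ℝ) 1) (ψ : freeVertices 𝒯 γ → L2 Ω)
    (f : WSpace Ω γ s) (v : VSpace Ω γ s) :
    projW Ω γ hs ψ f v = f (projV Ω γ hs ψ v) := by
  rw [projW_apply, projV_apply, map_sum, sum_apply]
  refine Finset.sum_congr rfl fun ν _ => ?_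
  rw [map_smul, smul_apply, smul_eq_mul, smul_eq_mul]
  ring

/-- An operator between dual spaces that is the transpose of a bounded operator has its norm. -/
lemma norm_eq_of_transpose {V : Type*} [NormedAddCommGroup V] [NormedSpace ℝ V]
    (P : StrongDual ℝ V →L[ℝ] StrongDual ℝ V) (Q : V →L[ℝ] V) (h : ∀ f v, P f v = f (Q v)) :
    ‖P‖ = ‖Q‖ := by
  apply le_antisymm
  · refine P.opNorm_le_bound (norm_nonneg _) fun f => ?_
    refine (P f).opNorm_le_bound (by positivity) fun v => ?_
    rw [h]
    calc ‖f (Q v)‖ ≤ ‖f‖ * (‖Q‖ * ‖v‖) :=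
          (f.le_opNorm _).trans (by gcongr; exact Q.le_opNorm v)
      _ = _ := by ring
  · refine Q.opNorm_le_bound P.opNorm_nonneg fun v => ?_
    -- By Hahn–Banach the norm of `Q v` is seen by the functionals on `V`.
    refine NormedSpace.norm_le_dual_bound ℝ _ (by positivity) fun f => ?_
    rw [← h]
    calc ‖P f v‖ ≤ ‖P‖ * ‖f‖ * ‖v‖ := P.le_opNorm₂ f v
      _ = _ := by ring

lemma norm_projW_eq (hs : s ∈ Icc (0 : ℝ) 1) (ψ : freeVertices 𝒯 γ → L2 Ω) :
    ‖projW Ω γ hs ψ‖ = ‖projV Ω γ hs ψ‖ :=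
  norm_eq_of_transpose _ _ (projW_apply_apply hs ψ)

lemma projW_toW (hs : s ∈ Icc (0 : ℝ) 1) {ψ : freeVertices 𝒯 γ → L2 Ω}
    (hψ : IsBiorthogonalLocal Ω γ 𝒯 c C ψ) (hc : 0 < c) (hΩ : IsPolytopalDomain Ω)
    (h : IsConformingPartition Ω 𝒯) (hγ : IsUnionOfFaces 𝒯 γ) (ν : freeVertices 𝒯 γ) :
    projW Ω γ hs ψ (L2.toW Ω γ s (ψ ν)) = L2.toW Ω γ s (ψ ν) := by
  rw [projW_apply, Finset.sum_eq_single_of_mem ν (Finset.mem_univ _), toW_nodalV,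
    inv_mul_cancel₀ (hψ.inner_ne_zero hc hΩ h hγ ν), one_smul]
  intro ν' _ hne
  rw [toW_nodalV, hψ.inner_eq_zero hne, mul_zero, zero_smul]

lemma projW_mem_span (hs : s ∈ Icc (0 : ℝ) 1) (ψ : freeVertices 𝒯 γ → L2 Ω) (f : WSpace Ω γ s) :
    projW Ω γ hs ψ f ∈ Submodule.span ℝ (range fun ν => L2.toW Ω γ s (ψ ν)) := by
  rw [projW_apply]
  exact Submodule.sum_mem _ fun ν _ => Submodule.smul_mem _ _
    (Submodule.subset_span (mem_range_self ν))

lemma projW_eq_self_of_mem_span (hs : s ∈ Icc (0 : ℝ) 1) {ψ : freeVertices 𝒯 γ → L2 Ω}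
    (hψ : IsBiorthogonalLocal Ω γ 𝒯 c C ψ) (hc : 0 < c) (hΩ : IsPolytopalDomain Ω)
    (h : IsConformingPartition Ω 𝒯) (hγ : IsUnionOfFaces 𝒯 γ) {f : WSpace Ω γ s}
    (hf : f ∈ Submodule.span ℝ (range fun ν => L2.toW Ω γ s (ψ ν))) :
    projW Ω γ hs ψ f = f := by
  induction hf using Submodule.span_induction with
  | mem x hx =>
    obtain ⟨ν, rfl⟩ := hx
    exact projW_toW hs hψ hc hΩ h hγ ν
  | zero => exact map_zero _
  | add x y _ _ hx hy => rw [map_add, hx, hy]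
  | smul a x _ hx => rw [map_smul, hx]

lemma projW_comp_projW (hs : s ∈ Icc (0 : ℝ) 1) {ψ : freeVertices 𝒯 γ → L2 Ω}
    (hψ : IsBiorthogonalLocal Ω γ 𝒯 c C ψ) (hc : 0 < c) (hΩ : IsPolytopalDomain Ω)
    (h : IsConformingPartition Ω 𝒯) (hγ : IsUnionOfFaces 𝒯 γ) :
    projW Ω γ hs ψ ∘L projW Ω γ hs ψ = projW Ω γ hs ψ :=
  ContinuousLinearMap.ext fun f =>
    projW_eq_self_of_mem_span hs hψ hc hΩ h hγ (projW_mem_span hs ψ f)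

lemma range_projW (hs : s ∈ Icc (0 : ℝ) 1) {ψ : freeVertices 𝒯 γ → L2 Ω}
    (hψ : IsBiorthogonalLocal Ω γ 𝒯 c C ψ) (hc : 0 < c) (hΩ : IsPolytopalDomain Ω)
    (h : IsConformingPartition Ω 𝒯) (hγ : IsUnionOfFaces 𝒯 γ) :
    range (projW Ω γ hs ψ) =
      (Submodule.span ℝ (range fun ν => L2.toW Ω γ s (ψ ν)) : Set (WSpace Ω γ s)) := by
  apply Subset.antisymm
  · rintro _ ⟨f, rfl⟩
    exact projW_mem_span hs ψ f
  · exact fun f hf => ⟨f, projW_eq_self_of_mem_span hs hψ hc hΩ h hγ hf⟩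

lemma ofSmall_eq_sum_of_mem_feSpace (hs : s ∈ Icc (0 : ℝ) 1) (hΩ : IsPolytopalDomain Ω)
    (h : IsConformingPartition Ω 𝒯) (hγ : IsUnionOfFaces 𝒯 γ) {u : H10 Ω γ}
    (hu : u ∈ feSpace Ω γ 𝒯) : ∃ a : freeVertices 𝒯 γ → ℝ,
      InterpSpace.ofSmall (H10.toL2 Ω γ) hs u = ∑ ν, a ν • nodalV Ω γ 𝒯 hs ν := by
  obtain ⟨a, ha⟩ := toL2_eq_sum_of_mem_feSpace hΩ h hγ hu
  refine ⟨a, InterpSpace.incl_injective _ _ ?_⟩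
  rw [map_sum]
  simp only [map_smul]
  exact ha

/-- By biorthogonality `f - P f` vanishes at every `φ_ν`, and these span the finite element space.
Conversely, a functional that annihilates all `φ_ν` satisfies `P f = 0` and is its own preimage. -/
lemma range_sub_projW (hs : s ∈ Icc (0 : ℝ) 1) {ψ : freeVertices 𝒯 γ → L2 Ω}
    (hψ : IsBiorthogonalLocal Ω γ 𝒯 c C ψ) (hc : 0 < c) (hΩ : IsPolytopalDomain Ω)
    (h : IsConformingPartition Ω 𝒯) (hγ : IsUnionOfFaces 𝒯 γ) :
    range (fun f => f - projW Ω γ hs ψ f) =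
      {f | ∀ u ∈ feSpace Ω γ 𝒯, f (InterpSpace.ofSmall (H10.toL2 Ω γ) hs u) = 0} := by
  apply Subset.antisymm
  · rintro _ ⟨f, rfl⟩ u hu
    obtain ⟨a, ha⟩ := ofSmall_eq_sum_of_mem_feSpace hs hΩ h hγ hu
    rw [ha, map_sum]
    refine Finset.sum_eq_zero fun ν _ => ?_
    have h1 : projW Ω γ hs ψ f (nodalV Ω γ 𝒯 hs ν) = f (nodalV Ω γ 𝒯 hs ν) := by
      rw [projW_apply, sum_apply,
        Finset.sum_eq_single_of_mem ν (Finset.mem_univ _)]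
      · rw [smul_apply, toW_nodalV, smul_eq_mul, mul_right_comm,
          inv_mul_cancel₀ (hψ.inner_ne_zero hc hΩ h hγ ν), one_mul]
      · intro ν' _ hne
        rw [smul_apply, toW_nodalV, hψ.inner_eq_zero hne.symm, smul_zero]
    rw [map_smul, sub_apply, h1, sub_self, smul_zero]
  · intro f hf
    refine ⟨f, ?_⟩
    have h0 : projW Ω γ hs ψ f = 0 := by
      rw [projW_apply]
      refine Finset.sum_eq_zero fun ν _ => ?_
      have : f (nodalV Ω γ 𝒯 hs ν) = 0 := hf _ (nodal_mem_feSpace hΩ h hγ ν.2)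
      rw [this, mul_zero, zero_smul]
    simp only [h0, sub_zero]

end Projector

/-! ### Interpolation of bounded operators -/

section OperatorInterpolation

variable {X Y : Type*} [NormedAddCommGroup X] [NormedSpace ℝ X]
  [NormedAddCommGroup Y] [NormedSpace ℝ Y]

/-- If `y` competes in the infimum for `x`, then `B y` competes for `A x`, and both terms grow by at
most the factor `M`. -/
lemma kFun_map_le {j : Y →L[ℝ] X} {A : X →L[ℝ] X} {B : Y → Y} (hAB : ∀ y, j (B y) = A (j y))
    {M : ℝ≥0} (hA : ∀ x, ‖A x‖ₑ ≤ M * ‖x‖ₑ) (hB : ∀ y, ‖B y‖ₑ ≤ M * ‖y‖ₑ) (t : ℝ) (x : X) :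
    kFun j t (A x) ≤ M * kFun j t x := by
  unfold kFun
  rw [ENNReal.mul_iInf (fun h => absurd h (by simp))]
  refine le_iInf fun y => (iInf_le _ (B y)).trans ?_
  rw [hAB, ← map_sub]
  calc _ ≤ M * ‖x - j y‖ₑ + ENNReal.ofReal t * (M * ‖y‖ₑ) := by
        gcongr
        · exact hA _
        · exact hB _
    _ = _ := by ring

/-- An operator that is bounded on both spaces of a couple is bounded on the interpolation
spaces. -/
lemma interpENorm_map_le {j : Y →L[ℝ] X} {A : X →L[ℝ] X} {B : Y → Y}
    (hAB : ∀ y, j (B y) = A (j y)) {M : ℝ≥0} (hA : ∀ x, ‖A x‖ₑ ≤ M * ‖x‖ₑ)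
    (hB : ∀ y, ‖B y‖ₑ ≤ M * ‖y‖ₑ) (s : ℝ) (x : X) :
    interpENorm j s (A x) ≤ M * interpENorm j s x := by
  unfold interpENorm
  split_ifs with h0 h1
  · exact hA x
  · by_cases hx : ∃ y, j y = x
    · simp only [iInf_subtype']
      have : Nonempty {y // j y = x} := ⟨⟨hx.choose, hx.choose_spec⟩⟩
      rw [ENNReal.mul_iInf (fun h => absurd h (by simp))]
      exact le_iInf fun y => (iInf_le (fun z : {z // j z = A x} => ‖z.1‖ₑ)
        ⟨B y.1, by rw [hAB, y.2]⟩).trans (hB y.1)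
    -- Outside the range of `j` the right-hand norm is `⊤`, but `0 * ⊤ = 0`; so `M = 0` needs `A x =
    -- 0` separately.
    · rcases eq_or_ne M 0 with rfl | hM
      · have hAx : A x = 0 := by
          have := hA x
          simpa using this
        refine (iInf₂_le (0 : Y) (by rw [hAx, map_zero])).trans ?_
        simp
      · have : (⨅ (y : Y) (_ : j y = x), ‖y‖ₑ) = ⊤ := by
          simp only [iInf_eq_top]
          exact fun y hy => absurd ⟨y, hy⟩ hx
        rw [this, ENNReal.mul_top (by simpa using hM)]
        exact le_top
  · calc _ ≤ (∫⁻ t, (M : ℝ≥0∞) ^ (2 : ℝ) *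
            (ENNReal.ofReal (t ^ (-s)) * kFun j t x) ^ (2 : ℝ) ∂dtOverT) ^ (1 / (2 : ℝ)) := by
          gcongr with t
          rw [← ENNReal.mul_rpow_of_nonneg _ _ (by norm_num)]
          refine ENNReal.rpow_le_rpow ?_ (by norm_num)
          calc _ ≤ ENNReal.ofReal (t ^ (-s)) * (M * kFun j t x) := by
                gcongr; exact kFun_map_le hAB hA hB t x
            _ = _ := by ring
      _ = _ := by
          rw [lintegral_const_mul _ ((measurable_integrand j s x).pow_const _),
            ENNReal.mul_rpow_of_nonneg _ _ (by norm_num), ← ENNReal.rpow_mul]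
          norm_num

end OperatorInterpolation

/-! ### From the bounds on the two endpoint spaces to the bound on `𝒱`. -/

section ProjectorBound

variable {d : ℕ} {Ω γ : Set (E d)} {𝒯 : Finset (Finset (E d))} {s : ℝ}

/-- The operator `P_𝒯'` on `L₂(Ω)`. -/
def projL2 (Ω γ : Set (E d)) {𝒯 : Finset (Finset (E d))} (ψ : freeVertices 𝒯 γ → L2 Ω) :
    L2 Ω →L[ℝ] L2 Ω :=
  ∑ ν : freeVertices 𝒯 γ, (inner ℝ (nodalL2 Ω γ 𝒯 ν) (ψ ν))⁻¹ •
    (innerSL ℝ (ψ ν)).smulRight (nodalL2 Ω γ 𝒯 ν)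

/-- The operator `P_𝒯'` from `L₂(Ω)` to `H¹_{0,γ}(Ω)`. -/
def projH10 (Ω γ : Set (E d)) {𝒯 : Finset (Finset (E d))} (ψ : freeVertices 𝒯 γ → L2 Ω) :
    L2 Ω →L[ℝ] H10 Ω γ :=
  ∑ ν : freeVertices 𝒯 γ, (inner ℝ (nodalL2 Ω γ 𝒯 ν) (ψ ν))⁻¹ •
    (innerSL ℝ (ψ ν)).smulRight (nodal Ω γ 𝒯 ν)

/-- The coefficient of `φ_ν` in `P_𝒯' u`. -/
def projCoeff (Ω γ : Set (E d)) {𝒯 : Finset (Finset (E d))} (ψ : freeVertices 𝒯 γ → L2 Ω)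
    (u : L2 Ω) (ν : freeVertices 𝒯 γ) : ℝ :=
  (inner ℝ (nodalL2 Ω γ 𝒯 ν) (ψ ν))⁻¹ * inner ℝ (ψ ν) u

lemma projL2_apply (ψ : freeVertices 𝒯 γ → L2 Ω) (u : L2 Ω) :
    projL2 Ω γ ψ u = ∑ ν, projCoeff Ω γ ψ u ν • nodalL2 Ω γ 𝒯 ν := by
  simp [projL2, projCoeff, mul_smul]

lemma projH10_apply (ψ : freeVertices 𝒯 γ → L2 Ω) (u : L2 Ω) :
    projH10 Ω γ ψ u = ∑ ν, projCoeff Ω γ ψ u ν • nodal Ω γ 𝒯 ν := by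
  simp [projH10, projCoeff, mul_smul]

lemma toL2_projH10 (ψ : freeVertices 𝒯 γ → L2 Ω) (u : L2 Ω) :
    H10.toL2 Ω γ (projH10 Ω γ ψ u) = projL2 Ω γ ψ u := by
  rw [projH10_apply, projL2_apply, map_sum]
  simp only [map_smul]
  rfl

lemma incl_projV (hs : s ∈ Icc (0 : ℝ) 1) (ψ : freeVertices 𝒯 γ → L2 Ω) (v : VSpace Ω γ s) :
    InterpSpace.incl (H10.toL2 Ω γ) s (projV Ω γ hs ψ v) =
      projL2 Ω γ ψ (InterpSpace.incl (H10.toL2 Ω γ) s v) := by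
  rw [projV_apply, projL2_apply, map_sum]
  simp only [map_smul]
  rfl

/-- `projL2` restricted to `H¹_{0,γ}(Ω)` is `projH10` after the embedding, so the pair is an
operator on the couple. -/
lemma norm_projV_le (hs : s ∈ Icc (0 : ℝ) 1) (ψ : freeVertices 𝒯 γ → L2 Ω) {M : ℝ≥0}
    (h0 : ∀ u, ‖projL2 Ω γ ψ u‖ₑ ≤ M * ‖u‖ₑ)
    (h1 : ∀ u, ‖projH10 Ω γ ψ (H10.toL2 Ω γ u)‖ₑ ≤ M * ‖u‖ₑ) :
    ‖projV Ω γ hs ψ‖ ≤ M := by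
  refine ContinuousLinearMap.opNorm_le_bound _ M.2 fun v => ?_
  have := interpENorm_map_le (fun y => toL2_projH10 ψ (H10.toL2 Ω γ y)) h0 h1 s
    (InterpSpace.incl (H10.toL2 Ω γ) s v)
  rw [← incl_projV hs] at this
  have h2 := ENNReal.toReal_mono (ENNReal.mul_lt_top ENNReal.coe_lt_top
    (InterpSpace.incl_lt_top _ s v)).ne this
  rwa [ENNReal.toReal_mul, ENNReal.coe_toReal] at h2

end ProjectorBound

/-! ### Local norms and coefficient bounds -/

section LocalNorms

variable {d : ℕ} {Ω γ : Set (E d)} {𝒯 : Finset (Finset (E d))} {c C κ : ℝ}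

/-- The square of the `L₂`-norm on a simplex. -/
def locNormSq {F : Type*} [NormedAddCommGroup F] (f : E d → F) (T : Finset (E d)) : ℝ :=
  (∫⁻ x in Δ T, ‖f x‖ₑ ^ 2).toReal

lemma locNormSq_nonneg {F : Type*} [NormedAddCommGroup F] (f : E d → F) (T : Finset (E d)) :
    0 ≤ locNormSq f T := ENNReal.toReal_nonneg

lemma IsConformingPartition.lintegral_hull_ne_top (h : IsConformingPartition Ω 𝒯)
    (hΩ : interior (closure Ω) = Ω) {F : Type*} [NormedAddCommGroup F]
    (f : Lp F 2 (volume.restrict Ω)) {T : Finset (E d)} (hT : T ∈ 𝒯) :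
    ∫⁻ x in Δ T, ‖f x‖ₑ ^ 2 ≠ ⊤ := by
  have h1 := Finset.single_le_sum (f := fun T : Finset (E d) => ∫⁻ x in Δ T, ‖f x‖ₑ ^ 2)
    (fun _ _ => bot_le) hT
  rw [← h.enorm_Lp_sq hΩ] at h1
  exact (h1.trans_lt (by simp [ENNReal.pow_lt_top_iff])).ne

lemma IsConformingPartition.norm_Lp_sq (h : IsConformingPartition Ω 𝒯)
    (hΩ : interior (closure Ω) = Ω) {F : Type*} [NormedAddCommGroup F]
    (f : Lp F 2 (volume.restrict Ω)) : ‖f‖ ^ 2 = ∑ T ∈ 𝒯, locNormSq f T := by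
  have h1 := congrArg ENNReal.toReal (h.enorm_Lp_sq hΩ f)
  rw [ENNReal.toReal_pow, toReal_enorm,
    ENNReal.toReal_sum fun T hT => h.lintegral_hull_ne_top hΩ f hT] at h1
  exact h1

lemma locNormSq_le {F : Type*} [NormedAddCommGroup F] {f : E d → F} {T : Finset (E d)} {B : ℝ}
    (hB : 0 ≤ B) (hf : ∀ᵐ x ∂volume.restrict (Δ T), ‖f x‖ ^ 2 ≤ B) :
    locNormSq f T ≤ volume.real (Δ T) * B := by
  refine ENNReal.toReal_le_of_le_ofReal (by positivity) ?_
  calc _ ≤ ∫⁻ _ in Δ T, ENNReal.ofReal B := by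
        refine lintegral_mono_ae ?_
        filter_upwards [hf] with x hx
        rw [← ofReal_norm, ← ENNReal.ofReal_pow (norm_nonneg _)]
        exact ENNReal.ofReal_le_ofReal hx
    _ = _ := by
        rw [setLIntegral_const, ENNReal.ofReal_mul (by positivity), measureReal_def,
          ENNReal.ofReal_toReal (volume_hull_lt_top T).ne, mul_comm]

/-- Squares of convex combinations. -/
lemma IsSimplex.sq_sum_mul_bary_le {T : Finset (E d)} (hT : IsSimplex T) {x : E d} (hx : x ∈ Δ T)
    (f : E d → ℝ) : (∑ w ∈ T, f w * bary T w x) ^ 2 ≤ ∑ w ∈ T, f w ^ 2 := by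
  calc (∑ w ∈ T, f w * bary T w x) ^ 2
      ≤ (∑ w ∈ T, f w ^ 2) * ∑ w ∈ T, bary T w x ^ 2 := Finset.sum_mul_sq_le_sq_mul_sq T _ _
    _ ≤ (∑ w ∈ T, f w ^ 2) * 1 := by
        refine mul_le_mul_of_nonneg_left ?_ (Finset.sum_nonneg fun _ _ => sq_nonneg _)
        rw [← hT.sum_bary x]
        refine Finset.sum_le_sum fun w _ => ?_
        have e0 := hT.bary_nonneg hx w
        have e1 := hT.bary_le_one hx w
        nlinarith
    _ = _ := mul_one _

lemma sum_vertices_star {M : Type*} [AddCommMonoid M] (f : E d → Finset (E d) → M) :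
    ∑ T ∈ 𝒯, ∑ ν ∈ T, f ν T = ∑ ν ∈ vertices 𝒯, ∑ T ∈ star 𝒯 ν, f ν T :=
  Finset.sum_comm' fun T ν => by
    rw [mem_star, mem_vertices]
    exact ⟨fun h => ⟨h, T, h⟩, fun h => h.1⟩

/-- Finite overlap of the patches. -/
lemma sum_sum_star_le (hd : 0 < d) (h : IsConformingPartition Ω 𝒯) (hκ : IsShapeRegular κ 𝒯)
    {F : Finset (E d) → ℝ} (hF : ∀ T ∈ 𝒯, 0 ≤ F T) :
    ∑ T ∈ 𝒯, ∑ ν ∈ T, ∑ S ∈ star 𝒯 ν, F S ≤ starConst d κ * (d + 1) * ∑ T ∈ 𝒯, F T := by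
  -- The sum over the star of a vertex occurs once for every simplex of that star, at most
  -- `starConst d κ` times; then each simplex is counted once for each of its `d + 1` vertices.
  calc ∑ T ∈ 𝒯, ∑ ν ∈ T, ∑ S ∈ star 𝒯 ν, F S
      = ∑ ν ∈ vertices 𝒯, (star 𝒯 ν).card * ∑ S ∈ star 𝒯 ν, F S := by
        rw [sum_vertices_star fun ν _ => ∑ S ∈ star 𝒯 ν, F S]
        simp only [Finset.sum_const, nsmul_eq_mul]
    _ ≤ ∑ ν ∈ vertices 𝒯, starConst d κ * ∑ S ∈ star 𝒯 ν, F S := by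
        refine Finset.sum_le_sum fun ν hν => mul_le_mul_of_nonneg_right ?_
          (Finset.sum_nonneg fun S hS => hF S (mem_star.1 hS).1)
        exact_mod_cast h.card_star_le_starConst hd hκ hν
    _ = _ := by
        rw [← Finset.mul_sum, ← sum_vertices_star (fun _ S => F S), mul_assoc]
        congr 1
        rw [Finset.mul_sum]
        refine Finset.sum_congr rfl fun T hT => ?_
        rw [Finset.sum_const, h.card_eq T hT, nsmul_eq_mul]
        push_cast
        rfl

/-- The support condition allows `u` to be replaced by its restriction to the patch before
Cauchy–Schwarz. -/
lemma IsBiorthogonalLocal.sq_inner_le {ψ : freeVertices 𝒯 γ → L2 Ω}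
    (hψ : IsBiorthogonalLocal Ω γ 𝒯 c C ψ) (hΩ : interior (closure Ω) = Ω)
    (h : IsConformingPartition Ω 𝒯) (u : L2 Ω) (ν : freeVertices 𝒯 γ) :
    (inner ℝ (ψ ν) u) ^ 2 ≤ ‖ψ ν‖ ^ 2 * ∑ T ∈ star 𝒯 ν, locNormSq u T := by
  have hm : MeasurableSet (patch 𝒯 (ν : E d)) := by
    exact Finset.measurableSet_biUnion _ fun T _ => measurableSet_hull T
  set v : L2 Ω := ((Lp.memLp u).indicator hm).toLp _ with hv
  have hva : (v : E d → ℝ) =ᵐ[volume.restrict Ω] (patch 𝒯 (ν : E d)).indicator u :=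
    MemLp.coeFn_toLp _
  have h1 : inner ℝ (ψ ν) u = inner ℝ (ψ ν) v := by
    rw [L2.inner_def, L2.inner_def]
    refine integral_congr_ae ?_
    filter_upwards [hva, hψ.support ν] with x hx hsx
    by_cases hxp : x ∈ patch 𝒯 (ν : E d)
    · rw [hx, indicator_of_mem hxp]
    · rw [hsx hxp, inner_zero_left, inner_zero_left]
  have h2 : ‖v‖ ^ 2 ≤ ∑ T ∈ star 𝒯 ν, locNormSq u T := by
    have e1 : ‖v‖ₑ ^ 2 ≤ ∑ T ∈ star 𝒯 (ν : E d), ∫⁻ x in Δ T, ‖u x‖ₑ ^ 2 := by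
      rw [enorm_Lp_two_sq]
      calc ∫⁻ x in Ω, ‖v x‖ₑ ^ 2
          = ∫⁻ x in Ω, (patch 𝒯 (ν : E d)).indicator (fun x => ‖u x‖ₑ ^ 2) x := by
            refine lintegral_congr_ae ?_
            filter_upwards [hva] with x hx
            rw [hx]
            by_cases hxp : x ∈ patch 𝒯 (ν : E d)
            · rw [indicator_of_mem hxp, indicator_of_mem hxp]
            · rw [indicator_of_notMem hxp, indicator_of_notMem hxp]; simp
        _ ≤ ∫⁻ x, (patch 𝒯 (ν : E d)).indicator (fun x => ‖u x‖ₑ ^ 2) x :=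
            setLIntegral_le_lintegral _ _
        _ = ∫⁻ x in patch 𝒯 (ν : E d), ‖u x‖ₑ ^ 2 := lintegral_indicator hm _
        _ = ∫⁻ x in ⋃ T ∈ star 𝒯 (ν : E d), Δ T, ‖u x‖ₑ ^ 2 := by
            simp only [patch, Finset.mem_filter, mem_star]
        _ ≤ ∑' T : star 𝒯 (ν : E d), ∫⁻ x in Δ T.1, ‖u x‖ₑ ^ 2 := by
            have : ⋃ T ∈ star 𝒯 (ν : E d), Δ T = ⋃ T : star 𝒯 (ν : E d), Δ T.1 := by
              ext x; simp
            rw [this]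
            exact lintegral_iUnion_le _ _
        _ = _ := by
            rw [tsum_fintype]
            exact Finset.sum_coe_sort (star 𝒯 (ν : E d)) fun T => ∫⁻ x in Δ T, ‖u x‖ₑ ^ 2
    have e2 := ENNReal.toReal_mono (ENNReal.sum_ne_top.2 fun T hT =>
      h.lintegral_hull_ne_top hΩ u (mem_star.1 hT).1) e1
    rwa [ENNReal.toReal_pow, toReal_enorm, ENNReal.toReal_sum fun T hT =>
      h.lintegral_hull_ne_top hΩ u (mem_star.1 hT).1] at e2
  rw [h1]
  calc (inner ℝ (ψ ν) v) ^ 2 ≤ (‖ψ ν‖ * ‖v‖) ^ 2 :=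
        sq_le_sq' (neg_le_of_abs_le (abs_real_inner_le_norm _ _)) (real_inner_le_norm _ _)
    _ = ‖ψ ν‖ ^ 2 * ‖v‖ ^ 2 := mul_pow _ _ _
    _ ≤ _ := by gcongr

/-- The term `a_ν φ_ν` is invariant under scaling of `ψ_ν`: the factor `‖ψ_ν‖` in the lower bound of
the pairing cancels the one from Cauchy–Schwarz. -/
lemma IsBiorthogonalLocal.sq_projCoeff_le {ψ : freeVertices 𝒯 γ → L2 Ω}
    (hψ : IsBiorthogonalLocal Ω γ 𝒯 c C ψ) (hc : 0 < c) (hΩ : IsPolytopalDomain Ω)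
    (h : IsConformingPartition Ω 𝒯) (hγ : IsUnionOfFaces 𝒯 γ) (u : L2 Ω)
    (ν : freeVertices 𝒯 γ) :
    c ^ 2 * ‖nodalL2 Ω γ 𝒯 ν‖ ^ 2 * projCoeff Ω γ ψ u ν ^ 2 ≤
      ∑ T ∈ star 𝒯 ν, locNormSq u T := by
  have h1 := hψ.lower ν ν
  rw [if_pos rfl, mul_one] at h1
  have h2 := hψ.sq_inner_le hΩ.interior_closure h u ν
  have h3 : 0 < ‖ψ ν‖ := norm_pos_iff.2 (hψ.ne_zero ν)
  have h4 := hψ.inner_ne_zero hc hΩ h hγ ν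
  set p := inner ℝ (nodalL2 Ω γ 𝒯 ν) (ψ ν)
  have h5 : (c * ‖nodalL2 Ω γ 𝒯 ν‖ * ‖ψ ν‖) ^ 2 ≤ p ^ 2 := by
    rw [← sq_abs p]
    exact pow_le_pow_left₀ (by positivity) h1 2
  have h6 : p ^ 2 * projCoeff Ω γ ψ u ν ^ 2 = (inner ℝ (ψ ν) u) ^ 2 := by
    rw [projCoeff, mul_pow, ← mul_assoc, ← mul_pow, mul_inv_cancel₀ h4, one_pow, one_mul]
  refine le_of_mul_le_mul_left ?_ (pow_pos h3 2)
  calc _ = (c * ‖nodalL2 Ω γ 𝒯 ν‖ * ‖ψ ν‖) ^ 2 * projCoeff Ω γ ψ u ν ^ 2 := by ring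
    _ ≤ p ^ 2 * projCoeff Ω γ ψ u ν ^ 2 := by gcongr
    _ ≤ _ := h6.trans_le h2

/-- Extension by zero of a family indexed by the free vertices. -/
def extendFree (a : freeVertices 𝒯 γ → ℝ) (ν : E d) : ℝ :=
  open Classical in if hν : ν ∈ freeVertices 𝒯 γ then a ⟨ν, hν⟩ else 0

lemma extendFree_coe (a : freeVertices 𝒯 γ → ℝ) (ν : freeVertices 𝒯 γ) :
    extendFree a ν = a ν := by
  rw [extendFree, dif_pos ν.2]

lemma extendFree_of_notMem (a : freeVertices 𝒯 γ → ℝ) {ν : E d} (hν : ν ∉ freeVertices 𝒯 γ) :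
    extendFree a ν = 0 := by
  rw [extendFree, dif_neg hν]

lemma sum_free_eq_sum {M : Type*} [AddCommGroup M] [Module ℝ M] (a : freeVertices 𝒯 γ → ℝ)
    {T : Finset (E d)} (hT : T ∈ 𝒯) {g : E d → M} (hg : ∀ w, w ∉ T → g w = 0) :
    ∑ ν, a ν • g (ν : E d) = ∑ w ∈ T, extendFree a w • g w := by
  have h1 : ∑ ν, a ν • g (ν : E d) = ∑ ν ∈ freeVertices 𝒯 γ, extendFree a ν • g ν := by
    rw [← Finset.sum_coe_sort (freeVertices 𝒯 γ)]
    simp only [extendFree_coe]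
  have h2 : ∑ w ∈ T, extendFree a w • g w = ∑ w ∈ vertices 𝒯, extendFree a w • g w :=
    Finset.sum_subset (fun w hw => mem_vertices.2 ⟨T, hT, hw⟩) fun w _ hw => by
      rw [hg w hw, smul_zero]
  rw [h1, h2]
  exact Finset.sum_subset (fun w hw => (mem_freeVertices.1 hw).1) fun w _ hw => by
    rw [extendFree_of_notMem a hw, zero_smul]

lemma sum_nodalL2_ae_eq (hΩ : IsPolytopalDomain Ω) (h : IsConformingPartition Ω 𝒯)
    (hγ : IsUnionOfFaces 𝒯 γ) (a : freeVertices 𝒯 γ → ℝ) {T : Finset (E d)} (hT : T ∈ 𝒯) :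
    ∀ᵐ x ∂volume.restrict (Δ T), (∑ ν, a ν • nodalL2 Ω γ 𝒯 ν : L2 Ω) x =
      ∑ w ∈ T, extendFree a w * bary T w x := by
  have hle := h.restrict_hull_le hΩ.interior_closure hT
  have h2 := ae_mono hle (Lp.coeFn_finsetSum Finset.univ fun ν : freeVertices 𝒯 γ =>
    a ν • nodalL2 Ω γ 𝒯 ν)
  have h3 : ∀ᵐ x ∂volume.restrict (Δ T), ∀ ν : freeVertices 𝒯 γ,
      (a ν • nodalL2 Ω γ 𝒯 ν : L2 Ω) x = a ν • bary T ν x := by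
    refine ae_all_iff.2 fun ν => ?_
    filter_upwards [ae_mono hle (Lp.coeFn_smul (a ν) (nodalL2 Ω γ 𝒯 ν)),
      nodalL2_ae_eq hΩ h hγ ν.2 hT] with x hx hx'
    rw [hx, Pi.smul_apply, hx']
  filter_upwards [h2, h3] with x e2 e3
  rw [e2]
  simp only [Finset.sum_apply, e3]
  rw [sum_free_eq_sum a hT (g := fun w => bary T w x) fun w hw => by rw [bary_of_notMem hw]]
  simp only [smul_eq_mul]

lemma sum_grad_nodal_ae_eq (hΩ : IsPolytopalDomain Ω) (h : IsConformingPartition Ω 𝒯)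
    (hγ : IsUnionOfFaces 𝒯 γ) (a : freeVertices 𝒯 γ → ℝ) {T : Finset (E d)} (hT : T ∈ 𝒯) :
    ∀ᵐ x ∂volume.restrict (Δ T), H1.grad Ω (∑ ν, a ν • nodal Ω γ 𝒯 ν : H10 Ω γ) x =
      ∑ w ∈ T, extendFree a w • baryGrad T w := by
  have hle := h.restrict_hull_le hΩ.interior_closure hT
  have e1 : H1.grad Ω (∑ ν, a ν • nodal Ω γ 𝒯 ν : H10 Ω γ) =
      ∑ ν, a ν • H1.grad Ω (nodal Ω γ 𝒯 ν : H1 Ω) := by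
    rw [Submodule.coe_sum, map_sum]
    simp only [Submodule.coe_smul, map_smul]
  rw [e1]
  have h2 := ae_mono hle (Lp.coeFn_finsetSum Finset.univ fun ν : freeVertices 𝒯 γ =>
    a ν • H1.grad Ω (nodal Ω γ 𝒯 ν : H1 Ω))
  have h3 : ∀ᵐ x ∂volume.restrict (Δ T), ∀ ν : freeVertices 𝒯 γ,
      (a ν • H1.grad Ω (nodal Ω γ 𝒯 ν : H1 Ω) : L2Vec Ω) x = a ν • baryGrad T ν := by
    refine ae_all_iff.2 fun ν => ?_
    filter_upwards [ae_mono hle (Lp.coeFn_smul (a ν) (H1.grad Ω (nodal Ω γ 𝒯 ν : H1 Ω))),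
      grad_nodal_ae_eq hΩ h hγ ν.2 hT] with x hx hx'
    rw [hx, Pi.smul_apply, hx']
  filter_upwards [h2, h3] with x e2 e3
  rw [e2]
  simp only [Finset.sum_apply, e3]
  refine sum_free_eq_sum a hT (g := baryGrad T) fun w hw => ?_
  have : (bary T w : E d → ℝ) = fun _ => 0 := funext fun x => bary_of_notMem hw x
  rw [baryGrad, this, gradient_fun_const]

/-- Uniform boundedness on `L₂(Ω)`. -/
lemma sq_norm_projL2_le (hd : 0 < d) (hΩ : IsPolytopalDomain Ω) (h : IsConformingPartition Ω 𝒯)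
    (hγ : IsUnionOfFaces 𝒯 γ) (hκ : IsShapeRegular κ 𝒯) {ψ : freeVertices 𝒯 γ → L2 Ω}
    (hψ : IsBiorthogonalLocal Ω γ 𝒯 c C ψ) (hc : 0 < c) (u : L2 Ω) :
    ‖projL2 Ω γ ψ u‖ ^ 2 ≤ 2 ^ (d + 2) / c ^ 2 * (starConst d κ * (d + 1)) * ‖u‖ ^ 2 := by
  set a := projCoeff Ω γ ψ u with ha
  have hcoeff : ∀ T ∈ 𝒯, ∀ w ∈ T, volume.real (Δ T) * extendFree a w ^ 2 ≤
      2 ^ (d + 2) / c ^ 2 * ∑ S ∈ star 𝒯 w, locNormSq u S := by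
    intro T hT w hw
    by_cases hf : w ∈ freeVertices 𝒯 γ
    · rw [extendFree, dif_pos hf]
      have h1 := hψ.sq_projCoeff_le hc hΩ h hγ u ⟨w, hf⟩
      have h2 := enorm_nodalL2_lower hΩ h hγ hf (mem_star.2 ⟨hT, hw⟩)
      rw [div_mul_eq_mul_div, le_div_iff₀ (by positivity)]
      rw [inv_mul_le_iff₀ (by positivity)] at h2
      calc _ ≤ (2 ^ (d + 2) * ‖nodalL2 Ω γ 𝒯 w‖ ^ 2) * a ⟨w, hf⟩ ^ 2 * c ^ 2 := by gcongr
        _ = 2 ^ (d + 2) * (c ^ 2 * ‖nodalL2 Ω γ 𝒯 w‖ ^ 2 * a ⟨w, hf⟩ ^ 2) := by ring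
        _ ≤ _ := by gcongr
    · rw [extendFree_of_notMem a hf, zero_pow two_ne_zero, mul_zero]
      exact mul_nonneg (by positivity) (Finset.sum_nonneg fun _ _ => locNormSq_nonneg _ _)
  rw [h.norm_Lp_sq hΩ.interior_closure, h.norm_Lp_sq hΩ.interior_closure u]
  calc ∑ T ∈ 𝒯, locNormSq (projL2 Ω γ ψ u) T
      ≤ ∑ T ∈ 𝒯, ∑ w ∈ T, 2 ^ (d + 2) / c ^ 2 * ∑ S ∈ star 𝒯 w, locNormSq u S := by
        refine Finset.sum_le_sum fun T hT => ?_
        have h1 : locNormSq (projL2 Ω γ ψ u) T ≤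
            volume.real (Δ T) * ∑ w ∈ T, extendFree a w ^ 2 := by
          refine locNormSq_le (Finset.sum_nonneg fun _ _ => sq_nonneg _) ?_
          filter_upwards [sum_nodalL2_ae_eq hΩ h hγ a hT,
            ae_restrict_mem (measurableSet_hull T)] with x hx hxT
          rw [projL2_apply, hx, Real.norm_eq_abs, sq_abs]
          exact (h.isSimplex hT).sq_sum_mul_bary_le hxT _
        rw [Finset.mul_sum] at h1
        exact h1.trans (Finset.sum_le_sum fun w hw => hcoeff T hT w hw)
    _ = 2 ^ (d + 2) / c ^ 2 * ∑ T ∈ 𝒯, ∑ w ∈ T, ∑ S ∈ star 𝒯 w, locNormSq u S := by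
        simp only [← Finset.mul_sum]
    _ ≤ 2 ^ (d + 2) / c ^ 2 * (starConst d κ * (d + 1) * ∑ T ∈ 𝒯, locNormSq u T) := by
        gcongr
        exact sum_sum_star_le hd h hκ fun _ _ => locNormSq_nonneg _ _
    _ = _ := by ring

end LocalNorms

/-! ### Uniform boundedness on `H¹_{0,γ}(Ω)` -/

section GradientBound

variable {d : ℕ} {Ω γ : Set (E d)} {𝒯 : Finset (Finset (E d))} {u : E d → ℝ} {c C κ K : ℝ}

/-- The constant in the comparison of weighted energies on second-order neighbours. -/
def weightConst (d : ℕ) (κ K : ℝ) : ℝ :=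
  κ ^ d * ((adjConst κ K ^ starConst d κ) ^ 2) ^ (d + 2)

lemma weight_mul_osc_le (hd : 0 < d) (hΩ : IsPolytopalDomain Ω) (h : IsConformingPartition Ω 𝒯)
    (hκ : IsShapeRegular κ 𝒯) (hK : d = 1 → IsKMesh K 𝒯) {ν w : E d} {T S R : Finset (E d)}
    (hT : T ∈ star 𝒯 ν) (hS : S ∈ star 𝒯 ν) (hS' : S ∈ star 𝒯 w) (hR : R ∈ star 𝒯 w) :
    volume.real (Δ T) / Metric.diam (Δ T) ^ 2 * osc u R ≤ weightConst d κ K * energy u R := by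
  have hT𝒯 := (mem_star.1 hT).1
  have hR𝒯 := (mem_star.1 hR).1
  have hκ0 : 0 < κ := by linarith [h.two_le_shape hd hκ hT𝒯]
  set L := adjConst κ K ^ starConst d κ with hL
  have hL0 : 0 ≤ L := by have := one_le_adjConst κ K; positivity
  have a1 := diam_le_of_mem_star hd hΩ h hκ hK hT hS
  have a2 := diam_le_of_mem_star hd hΩ h hκ hK hS' hR
  have a3 := diam_le_of_mem_star hd hΩ h hκ hK hR hS'
  have a4 := diam_le_of_mem_star hd hΩ h hκ hK hS hT
  have v1 := volume_real_hull_le (mem_star.1 hT).2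
  have v2 := le_volume_real_hull hκ0 (hκ R hR𝒯)
  have p1 := (h.isSimplex hT𝒯).diam_pos hd
  have p2 := (h.isSimplex hR𝒯).diam_pos hd
  have p3 := (h.isSimplex hR𝒯).volume_real_pos
  have hB := volume_real_ball_pos (d := d)
  rw [← hL] at a1 a2 a3 a4
  rw [weightConst, ← hL, osc]
  set x := Metric.diam (Δ T)
  set y := Metric.diam (Δ R)
  set B := volume.real (Metric.ball (0 : E d) 1)
  -- `S` links `T` through `ν` with `R` through `w`, which takes two star comparisons and gives `L ^
  -- 2`. The ratio of volumes costs `κ ^ d * (L ^ 2) ^ d` and that of squared diameters `(L ^ 2) ^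
  -- 2`, whence the exponent `d + 2`.
  have b1 : x ≤ L ^ 2 * y := by nlinarith [mul_le_mul_of_nonneg_left a2 hL0]
  have b2 : y ≤ L ^ 2 * x := by nlinarith [mul_le_mul_of_nonneg_left a4 hL0]
  have c1 : volume.real (Δ T) ≤ κ ^ d * (L ^ 2) ^ d * volume.real (Δ R) := by
    calc _ ≤ x ^ d * B := v1
      _ ≤ (L ^ 2 * y) ^ d * B := by gcongr
      _ = κ ^ d * (L ^ 2) ^ d * ((y / κ) ^ d * B) := by
          rw [div_pow, mul_pow]; field_simp
      _ ≤ _ := by gcongr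
  have c2 : y ^ 2 ≤ (L ^ 2 * x) ^ 2 := by gcongr
  have e0 := energy_nonneg u R
  rw [div_mul_div_comm, div_le_iff₀ (by positivity)]
  calc volume.real (Δ T) * (y ^ 2 * energy u R)
      ≤ (κ ^ d * (L ^ 2) ^ d * volume.real (Δ R)) * ((L ^ 2 * x) ^ 2 * energy u R) := by gcongr
    _ = _ := by ring

/-- The sum of the oscillations over the patches of the vertices of a simplex. -/
def nbhdOsc (u : E d → ℝ) (𝒯 : Finset (Finset (E d))) (S : Finset (E d)) : ℝ :=
  ∑ w ∈ S, starOsc u 𝒯 w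

lemma nbhdOsc_nonneg (u : E d → ℝ) (𝒯 : Finset (Finset (E d))) (S : Finset (E d)) :
    0 ≤ nbhdOsc u 𝒯 S := Finset.sum_nonneg fun _ _ => starOsc_nonneg _ _ _

lemma starOsc_le_nbhdOsc {S : Finset (E d)} {w : E d} (hw : w ∈ S) :
    starOsc u 𝒯 w ≤ nbhdOsc u 𝒯 S :=
  Finset.single_le_sum (f := fun w => starOsc u 𝒯 w) (fun _ _ => starOsc_nonneg _ _ _) hw

lemma lintegral_sub_const_le (hu : ContDiff ℝ 1 u) {S : Finset (E d)} (hS : IsSimplex S) {b : ℝ}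
    (hb : IsMeanOn u S b) (β : ℝ) :
    ∫⁻ x in Δ S, ‖u x - β‖ₑ ^ 2 ≤
      ENNReal.ofReal (volume.real (Δ S) * (2 ^ (d + 1) * osc u S + 2 * (b - β) ^ 2)) := by
  have hv := hS.volume_real_pos
  have ho := osc_nonneg u S
  have e1 : Metric.diam (Δ S) ^ 2 * energy u S = volume.real (Δ S) * osc u S := by
    rw [osc, mul_div_cancel₀ _ hv.ne']
  have hm : Measurable fun x => ENNReal.ofReal 2 * ‖u x - b‖ₑ ^ 2 :=
    ((hu.continuous.measurable.sub_const b).enorm.pow_const 2).const_mul _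
  calc ∫⁻ x in Δ S, ‖u x - β‖ₑ ^ 2
      ≤ ∫⁻ x in Δ S, (ENNReal.ofReal 2 * ‖u x - b‖ₑ ^ 2 + ENNReal.ofReal (2 * (b - β) ^ 2)) := by
        refine lintegral_mono fun x => ?_
        rw [enorm_sq_eq, enorm_sq_eq, ← ENNReal.ofReal_mul zero_le_two,
          ← ENNReal.ofReal_add (by positivity) (by positivity)]
        apply ENNReal.ofReal_le_ofReal
        nlinarith [sq_nonneg ((u x - b) - (b - β))]
    _ = ENNReal.ofReal 2 * (∫⁻ x in Δ S, ‖u x - b‖ₑ ^ 2) +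
          ENNReal.ofReal (2 * (b - β) ^ 2) * volume (Δ S) := by
        rw [lintegral_add_left hm, setLIntegral_const, lintegral_const_mul' _ _ (by simp)]
    _ ≤ ENNReal.ofReal 2 * ENNReal.ofReal (2 ^ d * (volume.real (Δ S) * osc u S)) +
          ENNReal.ofReal (2 * (b - β) ^ 2) * ENNReal.ofReal (volume.real (Δ S)) := by
        rw [measureReal_def, ENNReal.ofReal_toReal (volume_hull_lt_top S).ne, ← measureReal_def,
          ← e1]
        gcongr
        exact hb
    _ = _ := by
        rw [← ENNReal.ofReal_mul zero_le_two, ← ENNReal.ofReal_mul (by positivity),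
          ← ENNReal.ofReal_add (by positivity) (by positivity)]
        congr 1
        ring

/-- The quasi-interpolation error. -/
lemma locNormSq_sub_sum_nodal_le (hΩ : IsPolytopalDomain Ω) (h : IsConformingPartition Ω 𝒯)
    (hγ : IsUnionOfFaces 𝒯 γ) (hu : ContDiff ℝ 1 u) {U : L2 Ω}
    (hU : U =ᵐ[volume.restrict Ω] u) {b : Finset (E d) → ℝ} (hb : ∀ T ∈ 𝒯, IsMeanOn u T (b T))
    {β : E d → ℝ} (hβ0 : ∀ ν ∈ γ, β ν = 0)
    (hβ : ∀ ν, ∀ T ∈ star 𝒯 ν, (b T - β ν) ^ 2 ≤ meanConst d κ * starOsc u 𝒯 ν)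
    {S : Finset (E d)} (hS : S ∈ 𝒯) :
    locNormSq (U - ∑ ν : freeVertices 𝒯 γ, β ν • nodalL2 Ω γ 𝒯 ν : L2 Ω) S ≤
      volume.real (Δ S) * ((2 ^ (d + 1) + 2 * meanConst d κ) * nbhdOsc u 𝒯 S) := by
  have hSs := h.isSimplex hS
  have hle := h.restrict_hull_le hΩ.interior_closure hS
  have hmc := meanConst_nonneg d κ
  have hnb := nbhdOsc_nonneg u 𝒯 S
  refine ENNReal.toReal_le_of_le_ofReal (by positivity) ?_
  -- The vertices that are not free lie on `γ`, where `β` vanishes, so extension by zero agrees with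
  -- `β`.
  have hext : ∀ w ∈ S, extendFree (fun ν : freeVertices 𝒯 γ => β ν) w = β w := by
    intro w hw
    by_cases hf : w ∈ freeVertices 𝒯 γ
    · rw [extendFree, dif_pos hf]
    · rw [extendFree_of_notMem _ hf]
      have : w ∈ γ := by
        by_contra hn
        exact hf (mem_freeVertices.2 ⟨mem_vertices.2 ⟨S, hS, hw⟩, hn⟩)
      rw [hβ0 w this]
  calc _ ≤ ∫⁻ x in Δ S, ∑ w ∈ S, ‖u x - β w‖ₑ ^ 2 := by
        refine lintegral_mono_ae ?_
        filter_upwards [ae_mono hle (Lp.coeFn_sub U (∑ ν : freeVertices 𝒯 γ,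
          β ν • nodalL2 Ω γ 𝒯 ν)), ae_mono hle hU,
          sum_nodalL2_ae_eq hΩ h hγ (fun ν : freeVertices 𝒯 γ => β ν) hS,
          ae_restrict_mem (measurableSet_hull S)] with x e1 e2 e3 hxS
        rw [e1, Pi.sub_apply, e2, e3]
        -- The coordinates are a partition of unity, so the error is a convex combination of the
        -- deviations `u x - β w`.
        have e4 : u x - ∑ w ∈ S, extendFree (fun ν : freeVertices 𝒯 γ => β ν) w * bary S w x =
            ∑ w ∈ S, (u x - β w) * bary S w x := by
          simp only [sub_mul, Finset.sum_sub_distrib, ← Finset.mul_sum, hSs.sum_bary x, mul_one]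
          congr 1
          exact Finset.sum_congr rfl fun w hw => by rw [hext w hw]
        rw [e4]
        simp only [enorm_sq_eq]
        rw [← ENNReal.ofReal_sum_of_nonneg fun _ _ => sq_nonneg _]
        exact ENNReal.ofReal_le_ofReal (hSs.sq_sum_mul_bary_le hxS _)
    _ = ∑ w ∈ S, ∫⁻ x in Δ S, ‖u x - β w‖ₑ ^ 2 :=
        lintegral_finsetSum _ fun w _ =>
          (hu.continuous.measurable.sub_const _).enorm.pow_const 2
    _ ≤ ∑ w ∈ S, ENNReal.ofReal
          (volume.real (Δ S) * ((2 ^ (d + 1) + 2 * meanConst d κ) * starOsc u 𝒯 w)) := by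
        refine Finset.sum_le_sum fun w hw => (lintegral_sub_const_le hu hSs (hb S hS) _).trans ?_
        apply ENNReal.ofReal_le_ofReal
        have hSw : S ∈ star 𝒯 w := mem_star.2 ⟨hS, hw⟩
        have e1 := hβ w S hSw
        have e2 : osc u S ≤ starOsc u 𝒯 w := osc_le_starOsc hSw
        rw [add_mul, mul_assoc 2]
        gcongr
    _ = _ := by
        rw [← ENNReal.ofReal_sum_of_nonneg fun w _ => mul_nonneg measureReal_nonneg
          (mul_nonneg (by positivity) (starOsc_nonneg _ _ _)), ← Finset.mul_sum, ← Finset.mul_sum,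
          nbhdOsc]

/-- `P_𝒯'` reproduces combinations of nodal functions. Its coefficients thus differ from those of a
quasi-interpolant by coefficients of the interpolation error. -/
lemma projCoeff_sub_sum (hΩ : IsPolytopalDomain Ω) (h : IsConformingPartition Ω 𝒯)
    (hγ : IsUnionOfFaces 𝒯 γ) {ψ : freeVertices 𝒯 γ → L2 Ω}
    (hψ : IsBiorthogonalLocal Ω γ 𝒯 c C ψ) (hc : 0 < c) (U : L2 Ω) (a : freeVertices 𝒯 γ → ℝ)
    (ν : freeVertices 𝒯 γ) :
    projCoeff Ω γ ψ (U - ∑ ν, a ν • nodalL2 Ω γ 𝒯 ν) ν = projCoeff Ω γ ψ U ν - a ν := by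
  have h1 : inner ℝ (ψ ν) (∑ ν, a ν • nodalL2 Ω γ 𝒯 ν) =
      a ν * inner ℝ (nodalL2 Ω γ 𝒯 ν) (ψ ν) := by
    rw [inner_sum, Finset.sum_eq_single_of_mem ν (Finset.mem_univ _), real_inner_smul_right,
      real_inner_comm]
    intro ν' _ hne
    rw [real_inner_smul_right, real_inner_comm, hψ.inner_eq_zero hne, mul_zero]
  rw [projCoeff, inner_sub_right, h1, mul_sub, projCoeff]
  have := hψ.inner_ne_zero hc hΩ h hγ ν
  field_simp

/-- The constant in the comparison of the coefficients of `P_𝒯' u` with element means of `u`. -/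
def coeffConst (d : ℕ) (κ c : ℝ) : ℝ :=
  2 * (2 ^ (d + 2) / c ^ 2 * (2 ^ (d + 1) + 2 * meanConst d κ)) + 2 * meanConst d κ

lemma coeffConst_nonneg (d : ℕ) (κ c : ℝ) : 0 ≤ coeffConst d κ c := by
  have := meanConst_nonneg d κ
  unfold coeffConst
  positivity

/-- The nodal value `β w` is inserted between the coefficient and `b T`. At a free vertex the first
difference is a coefficient of the quasi-interpolation error, bounded by the local `L₂` estimate; at
a vertex on `γ` both terms of it are zero. -/
lemma sq_projCoeff_sub_mean_le (hΩ : IsPolytopalDomain Ω) (h : IsConformingPartition Ω 𝒯)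
    (hγ : IsUnionOfFaces 𝒯 γ) {ψ : freeVertices 𝒯 γ → L2 Ω}
    (hψ : IsBiorthogonalLocal Ω γ 𝒯 c C ψ) (hc : 0 < c) (hu : ContDiff ℝ 1 u) {U : L2 Ω}
    (hU : U =ᵐ[volume.restrict Ω] u) {b : Finset (E d) → ℝ} (hb : ∀ T ∈ 𝒯, IsMeanOn u T (b T))
    {β : E d → ℝ} (hβ0 : ∀ ν ∈ γ, β ν = 0)
    (hβ : ∀ ν, ∀ T ∈ star 𝒯 ν, (b T - β ν) ^ 2 ≤ meanConst d κ * starOsc u 𝒯 ν)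
    {T : Finset (E d)} (hT : T ∈ 𝒯) {w : E d} (hw : w ∈ T) :
    (extendFree (projCoeff Ω γ ψ U) w - b T) ^ 2 ≤
      coeffConst d κ c * ∑ S ∈ star 𝒯 w, nbhdOsc u 𝒯 S := by
  have hTw : T ∈ star 𝒯 w := mem_star.2 ⟨hT, hw⟩
  have hmc := meanConst_nonneg d κ
  set Z := ∑ S ∈ star 𝒯 w, nbhdOsc u 𝒯 S with hZ
  have hZ0 : 0 ≤ Z := Finset.sum_nonneg fun _ _ => nbhdOsc_nonneg _ _ _
  have h1 : starOsc u 𝒯 w ≤ Z := (starOsc_le_nbhdOsc hw).trans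
    (Finset.single_le_sum (f := fun S => nbhdOsc u 𝒯 S) (fun _ _ => nbhdOsc_nonneg _ _ _) hTw)
  have h2 : (b T - β w) ^ 2 ≤ meanConst d κ * Z :=
    (hβ w T hTw).trans (by gcongr)
  set C₁ := 2 ^ (d + 1) + 2 * meanConst d κ with hC₁
  have hC₁0 : 0 ≤ C₁ := by positivity
  have h3 : (extendFree (projCoeff Ω γ ψ U) w - β w) ^ 2 ≤ 2 ^ (d + 2) / c ^ 2 * C₁ * Z := by
    by_cases hf : w ∈ freeVertices 𝒯 γ
    · rw [extendFree, dif_pos hf]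
      have e1 := hψ.sq_projCoeff_le hc hΩ h hγ
        (U - ∑ ν : freeVertices 𝒯 γ, β ν • nodalL2 Ω γ 𝒯 ν) ⟨w, hf⟩
      rw [projCoeff_sub_sum hΩ h hγ hψ hc U (fun ν => β ν)] at e1
      set n := ‖nodalL2 Ω γ 𝒯 w‖ ^ 2 with hn
      have hn0 : 0 < n := pow_pos (norm_nodalL2_pos hΩ h hγ hf) 2
      have e2 : ∑ S ∈ star 𝒯 w, locNormSq
          (U - ∑ ν : freeVertices 𝒯 γ, β ν • nodalL2 Ω γ 𝒯 ν : L2 Ω) S ≤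
          n * (2 ^ (d + 2) * C₁ * Z) := by
        rw [hZ, Finset.mul_sum, Finset.mul_sum]
        refine Finset.sum_le_sum fun S hS => ?_
        have e3 := enorm_nodalL2_lower hΩ h hγ hf hS
        rw [inv_mul_le_iff₀ (by positivity), ← hn] at e3
        have hnb := nbhdOsc_nonneg u 𝒯 S
        calc _ ≤ volume.real (Δ S) * (C₁ * nbhdOsc u 𝒯 S) :=
              locNormSq_sub_sum_nodal_le hΩ h hγ hu hU hb hβ0 hβ (mem_star.1 hS).1
          _ ≤ (2 ^ (d + 2) * n) * (C₁ * nbhdOsc u 𝒯 S) := by gcongr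
          _ = _ := by ring
      have e4 := e1.trans e2
      rw [mul_comm (c ^ 2), mul_assoc] at e4
      have e5 := le_of_mul_le_mul_left e4 hn0
      rw [div_mul_eq_mul_div, div_mul_eq_mul_div, le_div_iff₀ (by positivity), mul_comm]
      exact e5
    · have : w ∈ γ := by
        by_contra hn
        exact hf (mem_freeVertices.2 ⟨mem_vertices.2 ⟨T, hT, hw⟩, hn⟩)
      rw [extendFree_of_notMem _ hf, hβ0 w this, sub_zero, zero_pow two_ne_zero]
      positivity
  rw [coeffConst, ← hC₁]
  nlinarith [sq_nonneg (extendFree (projCoeff Ω γ ψ U) w - β w + (b T - β w))]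

/-- An inverse inequality modulo constants: `b` may be subtracted because the gradients add up to
zero, and each gradient is at most `κ` over twice the diameter. -/
lemma IsSimplex.sq_norm_sum_baryGrad_le (hd : 0 < d) {T : Finset (E d)} (hT : IsSimplex T)
    (hshape : ∃ x : E d, ∃ r : ℝ, 0 < r ∧ Metric.closedBall x r ⊆ Δ T ∧
      Metric.diam (Δ T) ≤ κ * r) (a : E d → ℝ) (b : ℝ) :
    ‖∑ w ∈ T, a w • baryGrad T w‖ ^ 2 ≤
      (d + 1) * κ ^ 2 / (4 * Metric.diam (Δ T) ^ 2) * ∑ w ∈ T, (a w - b) ^ 2 := by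
  have hD := hT.diam_pos hd
  obtain ⟨x, r, hr, hsub, hle⟩ := hshape
  have h1 : ∑ w ∈ T, a w • baryGrad T w = ∑ w ∈ T, (a w - b) • baryGrad T w := by
    simp only [sub_smul, Finset.sum_sub_distrib, ← Finset.smul_sum, hT.sum_baryGrad, smul_zero,
      sub_zero]
  have h2 : ∀ w, ‖baryGrad T w‖ ^ 2 ≤ κ ^ 2 / (4 * Metric.diam (Δ T) ^ 2) := by
    intro w
    have e1 := hT.norm_baryGrad_le w hr hsub
    have e2 : 2 * Metric.diam (Δ T) * ‖baryGrad T w‖ ≤ κ := by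
      have hκ : 0 ≤ κ := by
        by_contra! hn
        nlinarith
      nlinarith [norm_nonneg (baryGrad T w), mul_le_mul_of_nonneg_right hle
        (norm_nonneg (baryGrad T w)), mul_le_mul_of_nonneg_left e1 hκ]
    rw [le_div_iff₀ (by positivity)]
    calc _ = (2 * Metric.diam (Δ T) * ‖baryGrad T w‖) ^ 2 := by ring
      _ ≤ _ := by gcongr
  rw [h1]
  calc ‖∑ w ∈ T, (a w - b) • baryGrad T w‖ ^ 2
      ≤ (∑ w ∈ T, ‖(a w - b) • baryGrad T w‖) ^ 2 := by gcongr; exact norm_sum_le _ _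
    _ ≤ T.card * ∑ w ∈ T, ‖(a w - b) • baryGrad T w‖ ^ 2 := sq_sum_le_card_mul_sum_sq
    _ ≤ T.card * ∑ w ∈ T, (a w - b) ^ 2 * (κ ^ 2 / (4 * Metric.diam (Δ T) ^ 2)) := by
        gcongr with w hw
        rw [norm_smul, mul_pow, Real.norm_eq_abs, sq_abs]
        gcongr
        exact h2 w
    _ = _ := by
        rw [hT.card_eq, ← Finset.sum_mul]
        push_cast
        ring

/-- The constant in the bound on the gradient of `P_𝒯' u`. -/
def gradConst (d : ℕ) (κ K c : ℝ) : ℝ :=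
  (d + 1) * κ ^ 2 / 4 * coeffConst d κ c * weightConst d κ K * (starConst d κ * (d + 1)) ^ 2

lemma sum_energy_eq (hΩ : IsPolytopalDomain Ω) (h : IsConformingPartition Ω 𝒯)
    (hu : ContDiff ℝ 1 u) {U : H1 Ω} (hU : H1.toL2 Ω U =ᵐ[volume.restrict Ω] u) :
    ∑ T ∈ 𝒯, energy u T = ‖H1.grad Ω U‖ ^ 2 := by
  rw [h.norm_Lp_sq hΩ.interior_closure]
  refine Finset.sum_congr rfl fun T hT => ?_
  have h1 := H1.grad_ae_eq hΩ.isBounded hΩ.isOpen subset_rfl hu hU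
  have h2 : ∫⁻ x in Δ T, ‖H1.grad Ω U x‖ₑ ^ 2 = ENNReal.ofReal (energy u T) := by
    rw [← ofReal_energy hu]
    refine lintegral_congr_ae ?_
    filter_upwards [ae_mono (h.restrict_hull_le hΩ.interior_closure hT) h1] with x hx
    rw [hx, ← ofReal_norm, norm_gradient, ofReal_norm]
  rw [locNormSq, h2, ENNReal.toReal_ofReal (energy_nonneg u T)]

/-- The inverse inequality contributes `|T|` over the squared diameter, which the oscillations on
second-order neighbours absorb up to `weightConst`. The two nested neighbourhood sums are removed by
two uses of finite overlap. -/
lemma sq_norm_grad_projH10_le (hd : 0 < d) (hΩ : IsPolytopalDomain Ω)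
    (h : IsConformingPartition Ω 𝒯) (hγ : IsUnionOfFaces 𝒯 γ) (hκ : IsShapeRegular κ 𝒯)
    (hK : d = 1 → IsKMesh K 𝒯) {ψ : freeVertices 𝒯 γ → L2 Ω}
    (hψ : IsBiorthogonalLocal Ω γ 𝒯 c C ψ) (hc : 0 < c) (hu : ContDiff ℝ 1 u)
    (hu0 : ∀ x ∈ γ, u x = 0) {U : H1 Ω} (hU : H1.toL2 Ω U =ᵐ[volume.restrict Ω] u) :
    ‖H1.grad Ω (projH10 Ω γ ψ (H1.toL2 Ω U) : H10 Ω γ)‖ ^ 2 ≤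
      gradConst d κ K c * ‖H1.grad Ω U‖ ^ 2 := by
  choose! b hb using fun T (hT : T ∈ 𝒯) => (h.isSimplex hT).exists_mean hu
  obtain ⟨β, hβ0, hβ⟩ := exists_nodal_values hd hΩ h hγ hκ hu hu0 hb
  set a := projCoeff Ω γ ψ (H1.toL2 Ω U) with ha
  have hcc := coeffConst_nonneg d κ c
  set A := (d + 1) * κ ^ 2 / 4 * coeffConst d κ c with hA
  have hA0 : 0 ≤ A := by positivity
  have hloc : ∀ T ∈ 𝒯, locNormSq (H1.grad Ω (projH10 Ω γ ψ (H1.toL2 Ω U) : H10 Ω γ)) T ≤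
      A * ∑ w ∈ T, ∑ S ∈ star 𝒯 w, ∑ w' ∈ S, ∑ R ∈ star 𝒯 w', weightConst d κ K * energy u R := by
    intro T hT
    have hTs := h.isSimplex hT
    have hD := hTs.diam_pos hd
    have e1 : locNormSq (H1.grad Ω (projH10 Ω γ ψ (H1.toL2 Ω U) : H10 Ω γ)) T ≤
        volume.real (Δ T) * ((d + 1) * κ ^ 2 / (4 * Metric.diam (Δ T) ^ 2) *
          ∑ w ∈ T, (extendFree a w - b T) ^ 2) := by
      refine locNormSq_le (mul_nonneg (by positivity)
        (Finset.sum_nonneg fun _ _ => sq_nonneg _)) ?_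
      filter_upwards [sum_grad_nodal_ae_eq hΩ h hγ a hT] with x hx
      rw [projH10_apply, hx]
      exact hTs.sq_norm_sum_baryGrad_le hd (hκ T hT) _ _
    refine e1.trans ?_
    calc _ ≤ volume.real (Δ T) * ((d + 1) * κ ^ 2 / (4 * Metric.diam (Δ T) ^ 2) *
          ∑ w ∈ T, coeffConst d κ c * ∑ S ∈ star 𝒯 w, nbhdOsc u 𝒯 S) := by
          gcongr with w hw
          exact sq_projCoeff_sub_mean_le hΩ h hγ hψ hc hu hU hb hβ0 hβ hT hw
      _ = A * ∑ w ∈ T, ∑ S ∈ star 𝒯 w, ∑ w' ∈ S, ∑ R ∈ star 𝒯 w',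
            volume.real (Δ T) / Metric.diam (Δ T) ^ 2 * osc u R := by
          simp only [← Finset.mul_sum, nbhdOsc, starOsc, hA]
          field_simp
      _ ≤ _ := by
          refine mul_le_mul_of_nonneg_left (Finset.sum_le_sum fun w hw =>
            Finset.sum_le_sum fun S hS => Finset.sum_le_sum fun w' hw' =>
            Finset.sum_le_sum fun R hR => ?_) hA0
          exact weight_mul_osc_le hd hΩ h hκ hK (mem_star.2 ⟨hT, hw⟩) hS
            (mem_star.2 ⟨(mem_star.1 hS).1, hw'⟩) hR
  -- The sign of `κ` is known only when a simplex exists; over an empty partition the sums are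
  -- empty.
  have hκ0 : 𝒯.Nonempty → 0 ≤ weightConst d κ K := fun ⟨T, hT⟩ => by
    have := h.two_le_shape hd hκ hT
    have := one_le_adjConst κ K
    unfold weightConst
    positivity
  rw [h.norm_Lp_sq hΩ.interior_closure, ← sum_energy_eq hΩ h hu hU]
  have hF : ∀ T ∈ 𝒯, ∀ R : Finset (E d), 0 ≤ weightConst d κ K * energy u R := fun T hT R =>
    mul_nonneg (hκ0 ⟨T, hT⟩) (energy_nonneg u R)
  calc _ ≤ ∑ T ∈ 𝒯, A * ∑ w ∈ T, ∑ S ∈ star 𝒯 w, ∑ w' ∈ S, ∑ R ∈ star 𝒯 w',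
          weightConst d κ K * energy u R := Finset.sum_le_sum hloc
    _ ≤ A * (starConst d κ * (d + 1) *
          ∑ S ∈ 𝒯, ∑ w' ∈ S, ∑ R ∈ star 𝒯 w', weightConst d κ K * energy u R) := by
        rw [← Finset.mul_sum]
        gcongr
        exact sum_sum_star_le hd h hκ (F := fun S => ∑ w' ∈ S, ∑ R ∈ star 𝒯 w',
          weightConst d κ K * energy u R) fun S hS =>
          Finset.sum_nonneg fun _ _ => Finset.sum_nonneg fun R _ => hF S hS R
    _ ≤ A * (starConst d κ * (d + 1) * (starConst d κ * (d + 1) *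
          ∑ R ∈ 𝒯, weightConst d κ K * energy u R)) := by
        gcongr
        exact sum_sum_star_le hd h hκ fun R hR => hF R hR R
    _ = _ := by
        rw [← Finset.mul_sum, gradConst, hA]
        ring

/-- The bound on the norm of `P_𝒯'` on `L₂(Ω)` and `H¹_{0,γ}(Ω)`. -/
def projConst (d : ℕ) (κ K c : ℝ) : ℝ≥0 :=
  Real.toNNReal (Real.sqrt (2 ^ (d + 2) / c ^ 2 * (starConst d κ * (d + 1)) +
    |gradConst d κ K c|))

lemma sq_projConst (d : ℕ) (κ K c : ℝ) : (projConst d κ K c : ℝ) ^ 2 =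
    2 ^ (d + 2) / c ^ 2 * (starConst d κ * (d + 1)) + |gradConst d κ K c| := by
  rw [projConst, Real.coe_toNNReal _ (Real.sqrt_nonneg _), Real.sq_sqrt (by positivity)]

lemma enorm_le_of_sq_le {F G : Type*} [SeminormedAddCommGroup F] [SeminormedAddCommGroup G] {x : F}
    {y : G} {M : ℝ≥0} (h : ‖x‖ ^ 2 ≤ (M : ℝ) ^ 2 * ‖y‖ ^ 2) : ‖x‖ₑ ≤ M * ‖y‖ₑ := by
  rw [← mul_pow] at h
  have h1 : ‖x‖ ≤ M * ‖y‖ := le_of_sq_le_sq h (by positivity)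
  rw [enorm_eq_nnnorm, enorm_eq_nnnorm, ← ENNReal.coe_mul]
  exact_mod_cast h1

lemma enorm_projL2_le (hd : 0 < d) (hΩ : IsPolytopalDomain Ω) (h : IsConformingPartition Ω 𝒯)
    (hγ : IsUnionOfFaces 𝒯 γ) (hκ : IsShapeRegular κ 𝒯) {ψ : freeVertices 𝒯 γ → L2 Ω}
    (hψ : IsBiorthogonalLocal Ω γ 𝒯 c C ψ) (hc : 0 < c) (U : L2 Ω) :
    ‖projL2 Ω γ ψ U‖ₑ ≤ projConst d κ K c * ‖U‖ₑ := by
  refine enorm_le_of_sq_le ((sq_norm_projL2_le hd hΩ h hγ hκ hψ hc U).trans ?_)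
  rw [sq_projConst]
  gcongr
  exact le_add_of_nonneg_right (abs_nonneg _)

/-- The smooth functions that vanish on `γ` are a subspace. -/
lemma exists_contDiff_of_mem_span {W : H1 Ω} (hW : W ∈ Submodule.span ℝ {u : H1 Ω |
      ∃ v : E d → ℝ, ContDiff ℝ ∞ v ∧ (∀ x ∈ γ, v x = 0) ∧
        H1.toL2 Ω u =ᵐ[volume.restrict Ω] v}) :
    ∃ v : E d → ℝ, ContDiff ℝ ∞ v ∧ (∀ x ∈ γ, v x = 0) ∧
      H1.toL2 Ω W =ᵐ[volume.restrict Ω] v := by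
  induction hW using Submodule.span_induction with
  | mem x hx => exact hx
  | zero =>
    refine ⟨fun _ => 0, contDiff_const, fun _ _ => rfl, ?_⟩
    rw [map_zero]
    exact Lp.coeFn_zero _ _ _
  | add x y _ _ hx hy =>
    obtain ⟨f, hf, hf0, hxf⟩ := hx
    obtain ⟨g, hg, hg0, hyg⟩ := hy
    refine ⟨fun x => f x + g x, hf.add hg, fun x hx => by simp [hf0 x hx, hg0 x hx], ?_⟩
    rw [map_add]
    filter_upwards [Lp.coeFn_add (H1.toL2 Ω x) (H1.toL2 Ω y), hxf, hyg] with z e1 e2 e3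
    rw [e1, Pi.add_apply, e2, e3]
  | smul t x _ hx =>
    obtain ⟨f, hf, hf0, hxf⟩ := hx
    refine ⟨fun x => t * f x, contDiff_const.mul hf, fun x hx => by simp [hf0 x hx], ?_⟩
    rw [map_smul]
    filter_upwards [Lp.coeFn_smul t (H1.toL2 Ω x), hxf] with z e1 e2
    rw [e1, Pi.smul_apply, e2, smul_eq_mul]

lemma H10.norm_sq (u : H10 Ω γ) :
    ‖u‖ ^ 2 = ‖H10.toL2 Ω γ u‖ ^ 2 + ‖H1.grad Ω (u : H1 Ω)‖ ^ 2 :=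
  H1.norm_sq (u : H1 Ω)

/-- Uniform boundedness on `H¹_{0,γ}(Ω)`. -/
lemma enorm_projH10_le (hd : 0 < d) (hΩ : IsPolytopalDomain Ω)
    (h : IsConformingPartition Ω 𝒯) (hγ : IsUnionOfFaces 𝒯 γ) (hκ : IsShapeRegular κ 𝒯)
    (hK : d = 1 → IsKMesh K 𝒯) {ψ : freeVertices 𝒯 γ → L2 Ω}
    (hψ : IsBiorthogonalLocal Ω γ 𝒯 c C ψ) (hc : 0 < c) (U : H10 Ω γ) :
    ‖projH10 Ω γ ψ (H10.toL2 Ω γ U)‖ₑ ≤ projConst d κ K c * ‖U‖ₑ := by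
  have key : ∀ V ∈ H10 Ω γ,
      ‖projH10 Ω γ ψ (H1.toL2 Ω V)‖ ^ 2 ≤ (projConst d κ K c : ℝ) ^ 2 * ‖V‖ ^ 2 := by
    intro V hV
    -- For a fixed partition `projH10` is continuous, although not yet uniformly bounded, so the
    -- estimate is a closed condition on `V`. It then suffices to verify it for the smooth functions
    -- whose closure is `H10 Ω γ`.
    have hcl : IsClosed {V : H1 Ω | ‖projH10 Ω γ ψ (H1.toL2 Ω V)‖ ^ 2 ≤
        (projConst d κ K c : ℝ) ^ 2 * ‖V‖ ^ 2} :=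
      isClosed_le (((projH10 Ω γ ψ).continuous.comp (H1.toL2 Ω).continuous).norm.pow 2)
        (continuous_const.mul (continuous_norm.pow 2))
    refine closure_minimal ?_ hcl hV
    intro W hW
    obtain ⟨v, hv, hv0, hWv⟩ := exists_contDiff_of_mem_span hW
    have h0 := sq_norm_projL2_le hd hΩ h hγ hκ hψ hc (H1.toL2 Ω W)
    have h1 := sq_norm_grad_projH10_le hd hΩ h hγ hκ hK hψ hc
      (hv.of_le (by exact_mod_cast le_top)) hv0 hWv
    have e1 : ‖projH10 Ω γ ψ (H1.toL2 Ω W)‖ ^ 2 = ‖projL2 Ω γ ψ (H1.toL2 Ω W)‖ ^ 2 +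
        ‖H1.grad Ω (projH10 Ω γ ψ (H1.toL2 Ω W) : H10 Ω γ)‖ ^ 2 := by
      rw [← toL2_projH10]
      exact H10.norm_sq _
    rw [Set.mem_ofPred_eq, e1, sq_projConst, H1.norm_sq]
    set M₀ : ℝ := 2 ^ (d + 2) / c ^ 2 * (starConst d κ * (d + 1))
    have hM₀ : 0 ≤ M₀ := by positivity
    have ha := le_abs_self (gradConst d κ K c)
    have ha0 := abs_nonneg (gradConst d κ K c)
    nlinarith [sq_nonneg ‖H1.toL2 Ω W‖, sq_nonneg ‖H1.grad Ω W‖,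
      mul_le_mul_of_nonneg_right ha (sq_nonneg ‖H1.grad Ω W‖),
      mul_nonneg hM₀ (sq_nonneg ‖H1.grad Ω W‖), mul_nonneg ha0 (sq_nonneg ‖H1.toL2 Ω W‖)]
  exact enorm_le_of_sq_le (key U U.2)

end GradientBound

end BiorthFE

theorem theorem4p1 {d : ℕ} (hd : 0 < d)
    -- the domain, the Dirichlet boundary and the smoothness index
    (Ω : Set (E d)) (hΩ : IsPolytopalDomain Ω) (γ : Set (E d)) (hγ : γ ⊆ frontier Ω)
    (s : ℝ) (hs : s ∈ Icc (0 : ℝ) 1)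
    -- the family of uniformly shape regular conforming partitions
    {ι : Type*} (𝒯 : ι → Finset (Finset (E d)))
    (h𝒯 : ∀ i, IsConformingPartition Ω (𝒯 i))
    (hγ𝒯 : ∀ i, IsUnionOfFaces (𝒯 i) γ)
    (κ : ℝ) (hκ : ∀ i, IsShapeRegular κ (𝒯 i))
    (K : ℝ) (hK : d = 1 → ∀ i, IsKMesh K (𝒯 i))
    -- the collections `Ψ_𝒯`
    (ψ : ∀ i, freeVertices (𝒯 i) γ → L2 Ω) (c C : ℝ) (hc : 0 < c)
    (hψ : ∀ i, IsBiorthogonalLocal Ω γ (𝒯 i) c C (ψ i)) :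
    -- the nodal basis functions exist in `H¹_{0,γ}(Ω)`
    (∀ i, ∀ ν : freeVertices (𝒯 i) γ, IsNodal Ω γ (𝒯 i) ν (nodal Ω γ (𝒯 i) ν)) ∧
    -- `P_𝒯` is the projector onto `𝒲_𝒯 = span Ψ_𝒯` whose complement has the annihilator of
    -- `𝒱_𝒯` as its range
    (∀ i, projW Ω γ hs (ψ i) ∘L projW Ω γ hs (ψ i) = projW Ω γ hs (ψ i) ∧
      range (projW Ω γ hs (ψ i)) =
        (Submodule.span ℝ (range fun ν => L2.toW Ω γ s (ψ i ν)) : Set (WSpace Ω γ s)) ∧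
      range (fun f => f - projW Ω γ hs (ψ i) f) =
        {f | ∀ u ∈ feSpace Ω γ (𝒯 i), f (InterpSpace.ofSmall (H10.toL2 Ω γ) hs u) = 0}) ∧
    -- `P_𝒯'` is its adjoint
    (∀ i, ∀ (f : WSpace Ω γ s) (v : VSpace Ω γ s),
      projW Ω γ hs (ψ i) f v = f (projV Ω γ hs (ψ i) v)) ∧
    -- uniform boundedness
    (⨆ i, ‖projW Ω γ hs (ψ i)‖ₑ) = (⨆ i, ‖projV Ω γ hs (ψ i)‖ₑ) ∧
    (⨆ i, ‖projW Ω γ hs (ψ i)‖ₑ) < ⊤ := by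
  have hbound : ∀ i, ‖projV Ω γ hs (ψ i)‖ ≤ projConst d κ K c := fun i =>
    norm_projV_le hs (ψ i) (enorm_projL2_le hd hΩ (h𝒯 i) (hγ𝒯 i) (hκ i) (hψ i) hc)
      (enorm_projH10_le hd hΩ (h𝒯 i) (hγ𝒯 i) (hκ i) (fun h => hK h i) (hψ i) hc)
  refine ⟨fun i ν => isNodal_nodal hΩ (h𝒯 i) (hγ𝒯 i) ν.2,
    fun i => ⟨projW_comp_projW hs (hψ i) hc hΩ (h𝒯 i) (hγ𝒯 i),
      range_projW hs (hψ i) hc hΩ (h𝒯 i) (hγ𝒯 i),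
      range_sub_projW hs (hψ i) hc hΩ (h𝒯 i) (hγ𝒯 i)⟩,
    fun i f v => projW_apply_apply hs (ψ i) f v, ?_, ?_⟩
  · refine iSup_congr fun i => ?_
    rw [← ofReal_norm, norm_projW_eq, ofReal_norm]
  · refine (iSup_le fun i => ?_).trans_lt (ENNReal.coe_lt_top (r := projConst d κ K c))
    rw [← ofReal_norm, norm_projW_eq, ← ENNReal.ofReal_coe_nnreal]
    exact ENNReal.ofReal_le_ofReal (hbound i)
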